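/- Let $q$ be a prime power and $n\ge 1$. An element $g$ of a group $G$ is real if $hgh^{-1}=g^{-1}$ for some $h\in G$, and strongly real if $h$ can be chosen with $h^2=1$; a conjugacy class is (strongly) real if its elements are. Write $|k|_2$ for the largest power of $2$ dividing a positive integer $k$. Type. Let $g\in GL_n(q)$ have elementary divisors $f_1^{a_1},\dots,f_r^{a_r}$ ($f_j\in\mathbb F_q[t]$ monic irreducible, $a_j\ge 1$), i.e. the $\mathbb F_q[t]$-module $\mathbb F_q^n$ on which $t$ acts as $g$ is isomorphic to $\bigoplus_j \mathbb F_q[t]/(f_j^{a_j})$. Let $u_i$ be the scalar multiple of $\prod_{a_j=i}f_j$ with constant term $1$, and $n_i=\deg u_i$. The type of $g$ is the partition $\nu=1^{n_1}2^{n_2}\cdots$ of $n$. All scalar multiples of $g$ have the same type, so one may speak of the type of an element, or a conjugacy class, of $PGL_n(q)$, and of $PSL_n(q)$, regarded as the image of $SL_n(q)$ in $PGL_n(q)$. Numbers. Let $n_{q,d}$ be the number of polynomials $f\in\mathbb F_q[t]$ of degree $d$ with $f(0)=1$ that are self-reciprocal, i.e. whose multiset of roots in $\overline{\mathbb F_q}$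 is invariant under $\alpha\mapsto\alpha^{-1}$. For a partition $\nu=\{\nu_1,\dots,\nu_k\}=1^{n_1}2^{n_2}\cdots$ of $n$ put $h_\nu=\gcd(q-1,\nu_1,\dots,\nu_k)$, $d=|\gcd(n_1,n_2,\dots)|_2$ and $$sl_\nu=\begin{cases}\prod_{n_i>0}n_{q,n_i}, & q\text{ even, or } n_i=0\text{ for all odd } i;\\ \frac12\prod_{n_i>0}n_{q,n_i}, & q\text{ odd and } i\,n_i\text{ odd for some } i;\\ f_\nu(q)\prod_{i\text{ odd},\,n_i>0}q^{\frac{n_i}2-1}\prod_{i\text{ even},\,n_i>0}n_{q,n_i}, & \text{otherwise,}\end{cases}$$ where $f_\nu(q)=\frac{(q+1)^r+(q-1)^r}2$ and $r$ is the number of odd $i$ with $n_i>0$. Let $psl_\nu$ be the number of conjugacy classes of $PGL_n(q)$ of type $\nu$ that are contained in $PSL_n(q)$ and are real in $PGL_n(q)$. Theorem. Suppose that $q$ is even or $|n|_2\neq|q-1|_2$. Then, for every partition $\nu$ of $n$, $$psl_\nu=\begin{cases}\frac1{(2,q-1)}\prod_{n_i>0}n_{q,n_i}, & q\text{ even, or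 } |n|_2<|q-1|_2;\\ sl_\nu, & q\text{ odd},\ |n|_2>|q-1|_2,\ d>1;\\ \frac12 sl_\nu, & q\text{ odd},\ |n|_2>|q-1|_2,\ d=1,\end{cases}$$ and the number of real conjugacy classes of $PSL_n(q)$ of type $\nu$ is $h_\nu\,psl_\nu$. Moreover all real classes of $PSL_n(q)$ are strongly real. -/

import Mathlib

open Polynomial
open scoped DirectSum

noncomputable section

namespace RealPSL

/-! ### Real and strongly real classes -/

/-- `g` is real in `G`: it is conjugate in `G` to its inverse. -/
def IsReal {G : Type*} [Group G] (g : G) : Prop :=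
  ∃ h : G, h * g * h⁻¹ = g⁻¹

/-- `g` is strongly real in `G`: some `h` with `h ^ 2 = 1` conjugates `g` to its inverse. -/
def IsStronglyReal {G : Type*} [Group G] (g : G) : Prop :=
  ∃ h : G, h ^ 2 = 1 ∧ h * g * h⁻¹ = g⁻¹

/-- A conjugacy class is real if its elements are real. -/
def IsRealClass {G : Type*} [Group G] (c : ConjClasses G) : Prop :=
  ∀ g ∈ c.carrier, IsReal g

/-- A conjugacy class is strongly real if its elements are strongly real. -/
def IsStronglyRealClass {G : Type*} [Group G] (c : ConjClasses G) : Prop :=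
  ∀ g ∈ c.carrier, IsStronglyReal g

/-! ### The type of an element -/

section TypeOf

variable {F : Type*} [Field F] {n : ℕ}

/-- The `F[X]`-module `F ^ n` on which `X` acts as `g` is the direct sum of the cyclic modules
`F[X] / (f j ^ a j)` with `f j` monic irreducible and `a j` positive. In other words, the
multiset of the `f j ^ a j` is the multiset of elementary divisors of `g`.
(No `f j` is equal to `X`, because `g` is invertible.) -/
structure IsElementaryDivisors (g : GL (Fin n) F) {r : ℕ} (f : Fin r → F[X]) (a : Fin r → ℕ) :
    Prop where
  monic : ∀ j, (f j).Monic
  irreducible : ∀ j, Irreducible (f j)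
  pos : ∀ j, 0 < a j
  equiv : Nonempty (Module.AEval' (Matrix.toLin' (g : Matrix (Fin n) (Fin n) F)) ≃ₗ[F[X]]
    (⨁ j, F[X] ⧸ Ideal.span {f j ^ a j}))

/-- The polynomial `u_i`: the product of the `f j` with exponent `a j = i`, scaled so that its
constant term is `1`. -/
def uPoly {r : ℕ} (f : Fin r → F[X]) (a : Fin r → ℕ) (i : ℕ) : F[X] :=
  C ((∏ j with a j = i, f j).coeff 0)⁻¹ * ∏ j with a j = i, f j

/-- The multiplicity `n_i` of `i` in the partition `ν = 1 ^ n_1 2 ^ n_2 ⋯`. -/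
def mult (ν : n.Partition) (i : ℕ) : ℕ := ν.parts.count i

/-- `g ∈ GL_n` is of type `ν = 1 ^ n_1 2 ^ n_2 ⋯`: `deg u_i = n_i` for all `i`. -/
def HasType (g : GL (Fin n) F) (ν : n.Partition) : Prop :=
  ∃ (r : ℕ) (f : Fin r → F[X]) (a : Fin r → ℕ), IsElementaryDivisors g f a ∧
    ∀ i, (uPoly f a i).natDegree = mult ν i

/-- An element of `PGL_n` is of type `ν` if it lifts to an element of `GL_n` of type `ν`
(scalar multiples have the same type, so that the choice of the lift is irrelevant). -/
def PGLHasType (x : Matrix.ProjGenLinGroup (Fin n) F) (ν : n.Partition) : Prop :=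
  ∃ g : GL (Fin n) F, Matrix.ProjGenLinGroup.mk g = x ∧ HasType g ν

/-- The type of an element of `PSL_n` is that of its image in `PGL_n`. -/
def PSLHasType (x : Matrix.ProjectiveSpecialLinearGroup (Fin n) F) (ν : n.Partition) : Prop :=
  PGLHasType (Matrix.ProjectiveSpecialLinearGroup.toPGL x) ν

end TypeOf

/-! ### The counting functions -/

section Counts

variable (F : Type*) [Field F] {n : ℕ}

/-- The number of real conjugacy classes of `PSL_n(F)` of type `ν`. -/
def numRealPSL (ν : n.Partition) : ℕ :=
  Nat.card {c : ConjClasses (Matrix.ProjectiveSpecialLinearGroup (Fin n) F) //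
    IsRealClass c ∧ ∀ x ∈ c.carrier, PSLHasType x ν}

/-- The number of conjugacy classes of `PGL_n(F)` of type `ν` which are real in `PGL_n(F)` and
are contained in (the image of) `PSL_n(F)`. -/
def numRealPGLInPSL (ν : n.Partition) : ℕ :=
  Nat.card {c : ConjClasses (Matrix.ProjGenLinGroup (Fin n) F) //
    IsRealClass c ∧ (∀ x ∈ c.carrier, PGLHasType x ν) ∧
    c.carrier ⊆ Set.range
      (Matrix.ProjectiveSpecialLinearGroup.toPGL :
        Matrix.ProjectiveSpecialLinearGroup (Fin n) F → Matrix.ProjGenLinGroup (Fin n) F)}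

end Counts

/-! ### The formulae -/

/-- `|k|_2`, the largest power of `2` dividing the positive integer `k`. -/
def twoPart (k : ℕ) : ℕ := 2 ^ padicValNat 2 k

section Formulae

variable (F : Type*) [Field F] [Fintype F] {n : ℕ}

/-- The multiset of the roots of `f` in the algebraic closure is invariant under inversion. -/
def SelfReciprocal {F : Type*} [Field F] (f : F[X]) : Prop :=
  (f.aroots (AlgebraicClosure F)).map (fun α => α⁻¹) = f.aroots (AlgebraicClosure F)

/-- `n_{q,d}`: the number of self-reciprocal `f ∈ F[X]` of degree `d` with `f(0) = 1`. -/
def nqd (d : ℕ) : ℕ :=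
  Nat.card {f : F[X] // f.natDegree = d ∧ f.eval 0 = 1 ∧ SelfReciprocal f}

/-- `h_ν = gcd(q - 1, ν_1, …, ν_r)`, where the `ν_j` are the parts of `ν`. -/
def hNu (ν : n.Partition) : ℕ := Nat.gcd (Fintype.card F - 1) ν.parts.gcd

/-- `|gcd(n_1, n_2, …)|_2`. -/
def dNu (ν : n.Partition) : ℕ := twoPart ((Finset.Icc 1 n).gcd (mult ν))

/-- `∏_{n_i > 0} n_{q, n_i}`; the indices `i` with `n_i > 0` are the distinct parts of `ν`. -/
def glNu (ν : n.Partition) : ℚ := ∏ i ∈ ν.parts.toFinset, (nqd F (mult ν i) : ℚ)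

/-- The number of odd `i` with `n_i > 0`. -/
def rNu (ν : n.Partition) : ℕ := (ν.parts.toFinset.filter Odd).card

/-- `f_ν(q) = ((q + 1) ^ r + (q - 1) ^ r) / 2`. -/
def fNu (ν : n.Partition) : ℚ :=
  (((Fintype.card F : ℚ) + 1) ^ rNu ν + ((Fintype.card F : ℚ) - 1) ^ rNu ν) / 2

open scoped Classical in
/-- `sl_ν`. In the last case `n_i` is even and positive in the first product, so that the
natural number `n_i / 2 - 1` is the true value of the exponent. -/
def slNu (ν : n.Partition) : ℚ :=
  if Even (Fintype.card F) ∨ ∀ i, Odd i → mult ν i = 0 then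
    glNu F ν
  else if ∃ i, Odd (i * mult ν i) then
    glNu F ν / 2
  else
    fNu F ν *
      (∏ i ∈ ν.parts.toFinset.filter Odd, (Fintype.card F : ℚ) ^ (mult ν i / 2 - 1)) *
      ∏ i ∈ ν.parts.toFinset.filter Even, (nqd F (mult ν i) : ℚ)

open scoped Classical in
/-- `psl_ν`, for `q` even or `|n|_2 ≠ |q - 1|_2`. The second and the third case are those with
`q` odd and `|n|_2 > |q - 1|_2`, and `d > 1` or `d = 1` respectively. -/
def pslNu (ν : n.Partition) : ℚ :=
  if Even (Fintype.card F) ∨ twoPart n < twoPart (Fintype.card F - 1) then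
    glNu F ν / (Nat.gcd 2 (Fintype.card F - 1) : ℚ)
  else if 1 < dNu ν then
    slNu F ν
  else
    slNu F ν / 2

end Formulae

end RealPSL

end

/-! A conjugacy class of `GL_n(q)` is determined by its polynomials `u_i`, normalised to constant
term 1 (`uInv_eq_iff`). Replacing `g` by `c g` multiplies all roots by `c` (`scale c`), and
replacing `g` by `l g⁻¹` turns each root `α` into `l / α` (`dual l`). So the image of `g` in `PGL_n`
is real iff a single `dual l` fixes all `u_i` (`isReal_toPGL_iff`), and it lies in `PSL_n` iff `det
g`, which is read off from the degrees and leading coefficients of the `u_i`, is an `n`-th power.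

Counting in `PGL_n`. The classes are the orbits of the units of `F` scaling such tuples. If `dual l`
fixes `u`, then `scale c` fixes `u` iff `dual (c l)` does, so Burnside's lemma gives the average
over `l` of the number of tuples fixed by `dual l` (`sum_card_dualTuple`). This number depends on
`l` only modulo squares. For `l = 1` or even degree a fixed polynomial has a sign `±1`, and the
determinant is `l ^ (n / 2)` times the product of the `i`-th powers of the signs (`detU_extendOne`).
For odd `q` with `|n|_2 < |q - 1|_2`, `-1` is an `n`-th power: the determinant condition is void for
`l = 1`, and nonsquares `l` contribute nothing. With `|n|_2 > |q - 1|_2`, `-1` is not an `n`-th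
power but `l ^ (n / 2)` is, so the signs must have product 1; a character sum evaluates this to
`slNu` (`card_sgn_prod_eq_slNu`). A nonsquare contributes equally if all `n_i` are even and nothing
otherwise.

Strong reality. If `dual l` fixes the `u_i`, an involution `t` of `GL_n` with `t g t = l g⁻¹` is
assembled from blocks (`exists_involution`). It may fail to lie in `PSL_n` only if `-1` is not an
`n`-th power, and then `4 ∣ n`. For square `l` one reduces to `l = 1`, where `t` can be given
determinant 1. For nonsquare `l` one uses `t g`, whose square is the scalar `l` and whose
determinant is `l ^ (n / 2)`. Consequently reality in `PGL_n` and strong reality in `PSL_n` agree on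
`PSL_n`.

Splitting. A class of `PGL_n` inside `PSL_n` splits according to the cosets of the group of
determinants of matrices commuting with `g` up to scalars. This is the group of `m`-th powers, `m`
the gcd of the parts (`mem_range_pow_iff`), of index `hNu`. -/

noncomputable section

namespace RealPSL

/-! ### Inverting and scaling the roots of a polynomial. -/

section DualPolynomial

variable {F : Type*} [Field F]

/-- The polynomial with constant term `1` whose roots are the `l / α` for the roots `α` of `u`. -/
def dual (l : Fˣ) (u : F[X]) : F[X] :=
  C (u.leadingCoeff⁻¹ * ((l : F)⁻¹) ^ u.natDegree) * reverse (u.comp (C (l : F) * X))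

/-- The polynomial whose roots are the `c α` for the roots `α` of `u`. -/
def scale (c : Fˣ) (u : F[X]) : F[X] := u.comp (C ((c : F)⁻¹) * X)

lemma ne_zero_of_coeff_zero {u : F[X]} (hu : u.coeff 0 = 1) : u ≠ 0 := by
  rintro rfl; simp at hu

lemma natDegree_comp_C_mul_X (l : Fˣ) (u : F[X]) :
    (u.comp (C (l : F) * X)).natDegree = u.natDegree := by
  rw [natDegree_comp, natDegree_C_mul_X _ l.ne_zero, mul_one]

lemma coeff_scale (c : Fˣ) (u : F[X]) (k : ℕ) :
    (scale c u).coeff k = u.coeff k * ((c : F)⁻¹) ^ k := by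
  rw [scale, comp_C_mul_X_coeff]

lemma coeff_dual (l : Fˣ) (u : F[X]) {k : ℕ} (hk : k ≤ u.natDegree) :
    (dual l u).coeff k = u.leadingCoeff⁻¹ * u.coeff (u.natDegree - k) * ((l : F)⁻¹) ^ k := by
  rw [dual, coeff_C_mul, coeff_reverse, natDegree_comp_C_mul_X, revAt_le hk, comp_C_mul_X_coeff]
  have h : ((l : F)⁻¹) ^ u.natDegree = ((l : F)⁻¹) ^ k * ((l : F)⁻¹) ^ (u.natDegree - k) := by
    rw [← pow_add]; congr 1; omega
  have h2 : ((l : F)⁻¹) ^ (u.natDegree - k) * (l : F) ^ (u.natDegree - k) = 1 := by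
    rw [← mul_pow, inv_mul_cancel₀ l.ne_zero, one_pow]
  rw [h]
  linear_combination (u.leadingCoeff⁻¹ * u.coeff (u.natDegree - k) * ((l : F)⁻¹) ^ k) * h2

lemma coeff_dual_of_lt (l : Fˣ) (u : F[X]) {k : ℕ} (hk : u.natDegree < k) :
    (dual l u).coeff k = 0 := by
  rw [dual, coeff_C_mul, coeff_reverse, natDegree_comp_C_mul_X, revAt_eq_self_of_lt hk,
    comp_C_mul_X_coeff, coeff_eq_zero_of_natDegree_lt hk]
  simp

lemma coeff_zero_dual (l : Fˣ) {u : F[X]} (hu : u ≠ 0) : (dual l u).coeff 0 = 1 := by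
  rw [coeff_dual _ _ (Nat.zero_le _)]
  simp [hu]

lemma coeff_natDegree_dual (l : Fˣ) {u : F[X]} (hu : u.coeff 0 = 1) :
    (dual l u).coeff u.natDegree = u.leadingCoeff⁻¹ * ((l : F)⁻¹) ^ u.natDegree := by
  rw [coeff_dual _ _ le_rfl]
  simp [hu]

lemma natDegree_dual (l : Fˣ) {u : F[X]} (hu : u.coeff 0 = 1) :
    (dual l u).natDegree = u.natDegree := by
  refine natDegree_eq_of_le_of_coeff_ne_zero ?_ ?_
  · rw [natDegree_le_iff_coeff_eq_zero]
    intro k hk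
    exact coeff_dual_of_lt l u hk
  · rw [coeff_natDegree_dual l hu]
    exact mul_ne_zero (inv_ne_zero (leadingCoeff_ne_zero.mpr (ne_zero_of_coeff_zero hu)))
      (pow_ne_zero _ (inv_ne_zero l.ne_zero))

lemma leadingCoeff_dual (l : Fˣ) {u : F[X]} (hu : u.coeff 0 = 1) :
    (dual l u).leadingCoeff = u.leadingCoeff⁻¹ * ((l : F)⁻¹) ^ u.natDegree := by
  rw [leadingCoeff, natDegree_dual l hu, coeff_natDegree_dual l hu]

/-- On roots this is `l / (m / α) = (l / m) α`. The other relations between `dual` and `scale`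
follow formally from it. -/
lemma dual_dual_eq_scale (l m : Fˣ) {u : F[X]} (hu : u.coeff 0 = 1) :
    dual l (dual m u) = scale (l / m) u := by
  ext k
  have hl := leadingCoeff_ne_zero.mpr (ne_zero_of_coeff_zero hu)
  by_cases hk : k ≤ u.natDegree
  · rw [coeff_dual _ _ (by rwa [natDegree_dual m hu]), leadingCoeff_dual m hu, natDegree_dual m hu,
      coeff_dual _ _ (Nat.sub_le _ _), Nat.sub_sub_self hk, coeff_scale]
    have h : (m : F)⁻¹ ^ u.natDegree = (m : F)⁻¹ ^ (u.natDegree - k) * (m : F)⁻¹ ^ k := by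
      rw [← pow_add]; congr 1; omega
    rw [h]
    have := m.ne_zero
    have := l.ne_zero
    simp only [Units.val_div_eq_div_val, inv_div, div_pow, inv_pow]
    field_simp
  · push Not at hk
    rw [coeff_dual_of_lt _ _ (by rwa [natDegree_dual m hu]), coeff_scale,
      coeff_eq_zero_of_natDegree_lt hk, zero_mul]

lemma scale_one (u : F[X]) : scale 1 u = u := by
  ext k; simp [coeff_scale]

lemma scale_mul (c d : Fˣ) (u : F[X]) : scale (c * d) u = scale c (scale d u) := by
  ext k
  simp only [coeff_scale, Units.val_mul, mul_inv, mul_pow]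
  ring

lemma natDegree_scale (c : Fˣ) (u : F[X]) : (scale c u).natDegree = u.natDegree := by
  have := natDegree_comp_C_mul_X c⁻¹ u
  rwa [Units.val_inv_eq_inv_val] at this

lemma coeff_zero_scale (c : Fˣ) (u : F[X]) : (scale c u).coeff 0 = u.coeff 0 := by
  simp [coeff_scale]

lemma leadingCoeff_scale (c : Fˣ) (u : F[X]) :
    (scale c u).leadingCoeff = u.leadingCoeff * ((c : F)⁻¹) ^ u.natDegree := by
  rw [leadingCoeff, natDegree_scale, coeff_scale, leadingCoeff]

lemma dual_dual (l : Fˣ) {u : F[X]} (hu : u.coeff 0 = 1) : dual l (dual l u) = u := by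
  rw [dual_dual_eq_scale l l hu, div_self', scale_one]

lemma dual_eq_scale_dual (l m : Fˣ) {u : F[X]} (hu : u.coeff 0 = 1) :
    dual l u = scale (l / m) (dual m u) := by
  rw [← dual_dual_eq_scale l m (coeff_zero_dual m (ne_zero_of_coeff_zero hu)), dual_dual m hu]

lemma dual_scale (l c : Fˣ) {u : F[X]} (hu : u.coeff 0 = 1) :
    dual l (scale c u) = dual (l / c) u := by
  have h : scale c u = dual l (dual (l / c) u) := by
    rw [dual_dual_eq_scale _ _ hu, div_div_cancel]
  rw [h, dual_dual _ (coeff_zero_dual _ (ne_zero_of_coeff_zero hu))]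

lemma dual_mul (l : Fˣ) (u w : F[X]) : dual l (u * w) = dual l u * dual l w := by
  by_cases hu : u = 0
  · simp [dual, hu]
  by_cases hw : w = 0
  · simp [dual, hw]
  simp only [dual]
  rw [leadingCoeff_mul, natDegree_mul hu hw, mul_comp, reverse_mul_of_domain]
  simp only [map_mul, mul_inv, pow_add]
  ring

lemma dual_one (l : Fˣ) : dual l (1 : F[X]) = 1 := by
  have : reverse (1 : F[X]) = 1 := by simpa using reverse_C (1 : F)
  simp [dual, this]

/-- `dual l` as a monoid homomorphism. -/
def dualHom (l : Fˣ) : F[X] →* F[X] where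
  toFun := dual l
  map_one' := dual_one l
  map_mul' := dual_mul l

lemma dual_prod {ι : Type*} (l : Fˣ) (s : Finset ι) (u : ι → F[X]) :
    dual l (∏ i ∈ s, u i) = ∏ i ∈ s, dual l (u i) := map_prod (dualHom l) u s

lemma dual_pow (l : Fˣ) (u : F[X]) (k : ℕ) : dual l (u ^ k) = dual l u ^ k :=
  map_pow (dualHom l) u k

/-- Evaluating a reversed polynomial at the inverse of `z` gives its value at `z` up to a power of a
unit. An arbitrary commutative algebra is allowed because the use is in `F[X] / (v ^ a)`. -/
lemma aeval_dual_eq_zero {A : Type*} [CommRing A] [Algebra F A] (l : Fˣ) (u : F[X]) {x y : A}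
    (hxy : x * y = algebraMap F A l) (hx : aeval x u = 0) : aeval y (dual l u) = 0 := by
  have hz : y * (algebraMap F A (l : F)⁻¹ * x) = 1 := by
    rw [mul_left_comm, mul_comm y, hxy, ← map_mul, inv_mul_cancel₀ l.ne_zero, map_one]
  let z := algebraMap F A (l : F)⁻¹ * x
  let _ : Invertible z := ⟨y, hz, by rw [mul_comm]; exact hz⟩
  have h := eval₂_reverse_mul_pow (algebraMap F A) z (u.comp (C (l : F) * X))
  have h1 : eval₂ (algebraMap F A) z (u.comp (C (l : F) * X)) = 0 := by
    rw [eval₂_comp]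
    simp only [eval₂_mul, eval₂_C, eval₂_X, z]
    rw [← mul_assoc, ← map_mul, mul_inv_cancel₀ l.ne_zero, map_one, one_mul]
    exact hx
  rw [h1] at h
  have h2 : eval₂ (algebraMap F A) y (reverse (u.comp (C (l : F) * X))) = 0 :=
    ((isUnit_of_invertible z).pow _).mul_left_eq_zero.mp h
  rw [dual, map_mul, aeval_def (R := F) y (reverse _), h2, mul_zero]

lemma natDegree_eq_zero_of_isUnit_dual {l : Fˣ} {u : F[X]} (hu : u.coeff 0 = 1)
    (h : IsUnit (dual l u)) : IsUnit u := by
  rw [isUnit_iff_degree_eq_zero, degree_eq_natDegree (ne_zero_of_coeff_zero hu)]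
  rw [isUnit_iff_degree_eq_zero, degree_eq_natDegree
    (ne_zero_of_coeff_zero (coeff_zero_dual l (ne_zero_of_coeff_zero hu))), natDegree_dual l hu] at h
  exact h

/-- `dual l` is multiplicative, preserves degrees and is an involution on polynomials with constant
term 1, so it transports factorisations. -/
lemma irreducible_dual (l : Fˣ) {u : F[X]} (hu : u.coeff 0 = 1) (h : Irreducible u) :
    Irreducible (dual l u) := by
  refine ⟨fun h' => h.not_isUnit (natDegree_eq_zero_of_isUnit_dual hu h'), fun p q hpq => ?_⟩
  have h0 : p.coeff 0 * q.coeff 0 = 1 := by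
    rw [← mul_coeff_zero, ← hpq, coeff_zero_dual l h.ne_zero]
  have hp : p.coeff 0 ≠ 0 := left_ne_zero_of_mul_eq_one h0
  have hq : q.coeff 0 ≠ 0 := right_ne_zero_of_mul_eq_one h0
  -- The constant terms of `p` and `q` are mutually inverse, so exchanging them as scalars
  -- normalises both factors to constant term 1.
  have hpq' : dual l u = (C (q.coeff 0) * p) * (C (p.coeff 0) * q) := by
    rw [hpq]
    have : (C (p.coeff 0) * C (q.coeff 0) : F[X]) = 1 := by rw [← C_mul, h0, C_1]
    linear_combination -(p * q) * this
  have hp1 : (C (q.coeff 0) * p).coeff 0 = 1 := by rw [coeff_C_mul, mul_comm, h0]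
  have hq1 : (C (p.coeff 0) * q).coeff 0 = 1 := by rw [coeff_C_mul, h0]
  have hu2 : u = dual l (C (q.coeff 0) * p) * dual l (C (p.coeff 0) * q) := by
    rw [← dual_mul, ← hpq', dual_dual l hu]
  rcases h.isUnit_or_isUnit hu2 with h' | h'
  · exact Or.inl (isUnit_of_mul_isUnit_right (natDegree_eq_zero_of_isUnit_dual hp1 h'))
  · exact Or.inr (isUnit_of_mul_isUnit_right (natDegree_eq_zero_of_isUnit_dual hq1 h'))

/-- Associated polynomials with constant term `1` are equal. -/
lemma eq_of_associated {u w : F[X]} (hu : u.coeff 0 = 1) (hw : w.coeff 0 = 1)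
    (h : Associated u w) : u = w := by
  obtain ⟨c, hc⟩ := h
  obtain ⟨r, hr, hrc⟩ := isUnit_iff.mp c.isUnit
  rw [← hrc] at hc
  have : r = 1 := by
    have := congrArg (fun p => coeff p 0) hc
    simpa [hu, hw] using this
  rw [← hc, this]; simp

lemma prod_coeff_zero {ι : Type*} (s : Finset ι) {v : ι → F[X]} (hv : ∀ i ∈ s, (v i).coeff 0 = 1) :
    (∏ i ∈ s, v i).coeff 0 = 1 := by
  rw [coeff_zero_prod]
  exact Finset.prod_eq_one hv

end DualPolynomial

end RealPSL

end

noncomputable section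

namespace RealPSL

/-! ### Elementary divisors as an explicit model of an endomorphism. -/

section Decomposition

variable {F : Type*} [Field F]

/-- `φ` acts on `V` as the multiplication by `X` acts on the direct sum of the
`F[X] / (v j ^ a j)`, where the `v j` are irreducible with constant term `1`. -/
structure Decomp {V ι : Type*} [AddCommGroup V] [Module F V] (φ : Module.End F V)
    (v : ι → F[X]) (a : ι → ℕ) : Prop where
  irreducible : ∀ j, Irreducible (v j)
  coeff_zero : ∀ j, (v j).coeff 0 = 1
  pos : ∀ j, 0 < a j
  equiv : ∃ e : V ≃ₗ[F] (∀ j, AdjoinRoot (v j ^ a j)),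
    ∀ x j, e (φ x) j = AdjoinRoot.root (v j ^ a j) * e x j

/-- Two functions on finite types with the same multiset of values differ by a bijection. -/
lemma exists_equiv_of_map_univ_eq {α β γ : Type*} [Fintype α] [Fintype β]
    {f : α → γ} {g : β → γ}
    (h : Finset.univ.val.map f = Finset.univ.val.map g) : ∃ e : α ≃ β, ∀ x, g (e x) = f x := by
  classical
  have key : ∀ c, Nonempty ({x // f x = c} ≃ {y // g y = c}) := by
    intro c
    have := congrArg (Multiset.count c) h
    rw [Multiset.count_map, Multiset.count_map] at this
    refine ⟨Fintype.equivOfCardEq ?_⟩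
    rw [Fintype.card_subtype, Fintype.card_subtype]
    simp only [Finset.card, Finset.filter_val]
    convert this using 3 <;> exact eq_comm
  exact ⟨Equiv.ofFiberEquiv fun c => (key c).some, fun x => Equiv.ofFiberEquiv_map _ x⟩

section Basic

variable {V : Type*} [AddCommGroup V] [Module F V] {ι : Type*}

lemma apply_aeval_of_intertwining {φ : Module.End F V} {w : ι → F[X]}
    (e : V →ₗ[F] (∀ j, AdjoinRoot (w j))) (he : ∀ x j, e (φ x) j = AdjoinRoot.root (w j) * e x j)
    (p : F[X]) (x : V) (j : ι) : e (aeval φ p x) j = AdjoinRoot.mk (w j) p * e x j := by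
  induction p using Polynomial.induction_on' generalizing x with
  | add p q hp hq => simp [hp, hq, add_mul]
  | monomial k c =>
    have : ∀ k x, e ((φ ^ k) x) j = AdjoinRoot.root (w j) ^ k * e x j := by
      intro k
      induction k with
      | zero => simp
      | succ k ih => intro x; rw [pow_succ, Module.End.mul_apply, ih, he, pow_succ, mul_assoc]
    rw [aeval_monomial, Module.End.mul_apply, Module.algebraMap_end_apply, map_smul, Pi.smul_apply,
      this, ← C_mul_X_pow_eq_monomial, map_mul, map_pow, AdjoinRoot.mk_C, AdjoinRoot.mk_X,
      Algebra.smul_def, mul_assoc]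
    rfl

lemma finite_adjoinRoot {w : F[X]} (hw : w ≠ 0) : Module.Finite F (AdjoinRoot w) :=
  (AdjoinRoot.powerBasis hw).finite

lemma finrank_adjoinRoot {w : F[X]} (hw : w ≠ 0) :
    Module.finrank F (AdjoinRoot w) = w.natDegree := by
  rw [(AdjoinRoot.powerBasis hw).finrank, AdjoinRoot.powerBasis_dim]

lemma quotient_smul_eq (w p : F[X]) (y : F[X] ⧸ Ideal.span {w}) :
    p • y = @HMul.hMul (AdjoinRoot w) (AdjoinRoot w) _ _ (AdjoinRoot.mk w p) y := by
  obtain ⟨y, rfl⟩ := Ideal.Quotient.mk_surjective y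
  rfl

lemma adjoinRoot_smul_eq (w : F[X]) (c : F) (y : AdjoinRoot w) :
    AdjoinRoot.of w c * y = c • y := by
  rw [Algebra.smul_def]; rfl

/-- An isomorphism of `F[X]`-modules with a direct sum of cyclic modules, as an `F`-linear map. -/
lemma exists_intertwining_of_directSum [Fintype ι] {φ : Module.End F V} {w : ι → F[X]}
    (E : Module.AEval' φ ≃ₗ[F[X]] ⨁ j, F[X] ⧸ Ideal.span {w j}) :
    ∃ e : V ≃ₗ[F] (∀ j, AdjoinRoot (w j)),
      ∀ x j, e (φ x) j = AdjoinRoot.root (w j) * e x j := by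
  classical
  let E' : Module.AEval' φ ≃ₗ[F[X]] (∀ j, F[X] ⧸ Ideal.span {w j}) :=
    E.trans (DirectSum.linearEquivFunOnFintype F[X] ι _)
  let e : V ≃+ (∀ j, AdjoinRoot (w j)) :=
    (Module.AEval'.of φ).toAddEquiv.trans E'.toAddEquiv
  have hsmul : ∀ (p : F[X]) (y : ∀ j, F[X] ⧸ Ideal.span {w j}) (j : ι),
      (p • y) j = @HMul.hMul (AdjoinRoot (w j)) (AdjoinRoot (w j)) _ _ (AdjoinRoot.mk (w j) p) (y j) := by
    intro p y j
    exact quotient_smul_eq (w j) p (y j)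
  refine ⟨e.toLinearEquiv ?_, ?_⟩
  · intro c x
    funext j
    have : Module.AEval'.of φ (c • x) = (C c : F[X]) • Module.AEval'.of φ x := by
      rw [Module.AEval.C_smul, map_smul]
    change E' (Module.AEval'.of φ (c • x)) j = _
    rw [this, map_smul, hsmul, AdjoinRoot.mk_C]
    change _ = @HSMul.hSMul F (AdjoinRoot (w j)) _ _ c (E' (Module.AEval'.of φ x) j)
    exact adjoinRoot_smul_eq _ _ _
  · intro x j
    change E' (Module.AEval'.of φ (φ x)) j = _
    rw [← Module.AEval'.X_smul_of, map_smul, hsmul, AdjoinRoot.mk_X]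
    rfl

/-- The converse of `exists_intertwining_of_directSum`. -/
lemma nonempty_directSum_of_intertwining [Fintype ι] {φ : Module.End F V} {w : ι → F[X]}
    (e : V ≃ₗ[F] (∀ j, AdjoinRoot (w j)))
    (he : ∀ x j, e (φ x) j = AdjoinRoot.root (w j) * e x j) :
    Nonempty (Module.AEval' φ ≃ₗ[F[X]] ⨁ j, F[X] ⧸ Ideal.span {w j}) := by
  classical
  have hsmul : ∀ (p : F[X]) (y : ∀ j, F[X] ⧸ Ideal.span {w j}) (j : ι),
      (p • y) j = @HMul.hMul (AdjoinRoot (w j)) (AdjoinRoot (w j)) _ _ (AdjoinRoot.mk (w j) p) (y j) := by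
    intro p y j
    exact quotient_smul_eq (w j) p (y j)
  let e' : Module.AEval' φ ≃+ (∀ j, F[X] ⧸ Ideal.span {w j}) :=
    (Module.AEval'.of φ).symm.toAddEquiv.trans e.toAddEquiv
  let E' : Module.AEval' φ ≃ₗ[F[X]] (∀ j, F[X] ⧸ Ideal.span {w j}) := e'.toLinearEquiv (by
    intro p x
    obtain ⟨x, rfl⟩ := (Module.AEval'.of φ).surjective x
    funext j
    rw [hsmul]
    change e ((Module.AEval'.of φ).symm (p • Module.AEval'.of φ x)) j = _ * e _ j
    rw [Module.AEval.of_symm_smul, LinearEquiv.symm_apply_apply]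
    exact apply_aeval_of_intertwining e.toLinearMap he p x j)
  exact ⟨E'.trans (DirectSum.linearEquivFunOnFintype F[X] ι _).symm⟩

lemma intertwining_congr {φ : Module.End F V} {w w' : ι → F[X]}
    (h : ∀ j, Associated (w j) (w' j))
    (e : V ≃ₗ[F] (∀ j, AdjoinRoot (w j)))
    (he : ∀ x j, e (φ x) j = AdjoinRoot.root (w j) * e x j) :
    ∃ e' : V ≃ₗ[F] (∀ j, AdjoinRoot (w' j)),
      ∀ x j, e' (φ x) j = AdjoinRoot.root (w' j) * e' x j := by
  refine ⟨e.trans (LinearEquiv.piCongrRight fun j =>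
    (AdjoinRoot.algEquivOfAssociated F (w j) (w' j) (h j)).toLinearEquiv), fun x j => ?_⟩
  simp [he]

lemma associated_C_mul {c : F} (hc : c ≠ 0) (u : F[X]) : Associated u (C c * u) :=
  associated_unit_mul_right u _ (isUnit_C.mpr hc.isUnit)

/-- An intertwining isomorphism for an injective `φ` gives rise to a decomposition. -/
lemma decomp_of_intertwining {φ : Module.End F V} (hφ : Function.Injective φ) {f : ι → F[X]}
    {a : ι → ℕ} (hf : ∀ j, Irreducible (f j)) (ha : ∀ j, 0 < a j)
    (e : V ≃ₗ[F] (∀ j, AdjoinRoot (f j ^ a j)))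
    (he : ∀ x j, e (φ x) j = AdjoinRoot.root (f j ^ a j) * e x j) :
    (∀ j, (f j).coeff 0 ≠ 0) ∧ Decomp φ (fun j => C ((f j).coeff 0)⁻¹ * f j) a := by
  classical
  -- If `X` divided `f j`, the class of `f j ^ a j / X` would be a non-zero vector killed by `X`,
  -- against the injectivity of `φ`.
  have h0 : ∀ j, (f j).coeff 0 ≠ 0 := by
    intro j hj
    have hX : X ∣ f j := X_dvd_iff.mpr hj
    obtain ⟨w, hw⟩ := hX
    have hdvd : f j ^ a j = X * (w * f j ^ (a j - 1)) := by
      conv_lhs => rw [← Nat.sub_add_cancel (ha j), pow_succ]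
      rw [hw]; ring
    have hne : w * f j ^ (a j - 1) ≠ 0 := by
      intro h
      rw [h, mul_zero] at hdvd
      exact pow_ne_zero _ (hf j).ne_zero hdvd
    have hy : AdjoinRoot.mk (f j ^ a j) (w * f j ^ (a j - 1)) ≠ 0 := by
      intro h
      rw [AdjoinRoot.mk_eq_zero] at h
      have h1 := natDegree_le_of_dvd h hne
      have h2 := congrArg natDegree hdvd
      rw [natDegree_X_mul hne] at h2
      omega
    let y : ∀ i, AdjoinRoot (f i ^ a i) :=
      Pi.single j (AdjoinRoot.mk (f j ^ a j) (w * f j ^ (a j - 1)))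
    let x := e.symm y
    have hx : φ x = 0 := by
      apply e.injective
      funext i
      rw [he, map_zero, Pi.zero_apply, LinearEquiv.apply_symm_apply]
      simp only [y]
      by_cases hi : i = j
      · subst hi
        rw [Pi.single_eq_same, ← AdjoinRoot.mk_X, ← map_mul, ← hdvd, AdjoinRoot.mk_self]
      · rw [Pi.single_eq_of_ne hi, mul_zero]
    have hx0 : x = 0 := hφ (by rw [hx, map_zero])
    have : y = 0 := by simpa [x] using hx0
    exact hy (by simpa [y] using congrFun this j)
  refine ⟨h0, ⟨fun j => ?_, fun j => ?_, ha, ?_⟩⟩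
  · exact (associated_C_mul (inv_ne_zero (h0 j)) (f j)).irreducible (hf j)
  · rw [coeff_C_mul, inv_mul_cancel₀ (h0 j)]
  · exact intertwining_congr
      (fun j => (associated_C_mul (inv_ne_zero (h0 j)) (f j)).pow_pow) e he

lemma Decomp.reindex {κ : Type*} {φ : Module.End F V} {v : ι → F[X]} {a : ι → ℕ}
    (h : Decomp φ v a) (s : κ ≃ ι) : Decomp φ (v ∘ s) (a ∘ s) := by
  obtain ⟨e, he⟩ := h.equiv
  exact ⟨fun j => h.irreducible _, fun j => h.coeff_zero _, fun j => h.pos _,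
    e.trans (LinearEquiv.piCongrLeft F (fun j => AdjoinRoot (v j ^ a j)) s).symm,
    fun x j => he x (s j)⟩

lemma Decomp.conj {V' : Type*} [AddCommGroup V'] [Module F V'] {φ : Module.End F V}
    {ψ : Module.End F V'} {v : ι → F[X]} {a : ι → ℕ} (h : Decomp φ v a) (s : V' ≃ₗ[F] V)
    (hs : ∀ x, s (ψ x) = φ (s x)) : Decomp ψ v a := by
  obtain ⟨e, he⟩ := h.equiv
  exact ⟨h.irreducible, h.coeff_zero, h.pos, s.trans e, fun x j => by simp [hs, he]⟩

/-- Every invertible endomorphism has a decomposition. -/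
theorem exists_decomp [FiniteDimensional F V] {φ : Module.End F V} (hφ : Function.Injective φ) :
    ∃ (r : ℕ) (v : Fin r → F[X]) (a : Fin r → ℕ), Decomp φ v a := by
  classical
  obtain ⟨ι, _, p, hp, k, ⟨E⟩⟩ := Module.equiv_directSum_of_isTorsion
    (R := F[X]) (M := Module.AEval' φ) (Module.AEval.isTorsion_of_finiteDimensional F V φ)
  obtain ⟨e, he⟩ := exists_intertwining_of_directSum (w := fun i => p i ^ k i) E
  -- The structure theorem permits exponents 0. These summands vanish and are dropped.
  have hsub : ∀ i, ¬ 0 < k i → Subsingleton (AdjoinRoot (p i ^ k i)) := by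
    intro i hi
    have : k i = 0 := by omega
    rw [this, pow_zero]
    refine subsingleton_of_zero_eq_one ?_
    rw [← map_one (AdjoinRoot.mk (1 : F[X])), AdjoinRoot.mk_self]
  let ρ : (∀ i, AdjoinRoot (p i ^ k i)) →ₗ[F]
      (∀ i : {i // 0 < k i}, AdjoinRoot (p i ^ k i)) :=
    LinearMap.pi fun i => LinearMap.proj (i : ι)
  have hρ : Function.Bijective ρ := by
    constructor
    · intro x y hxy
      funext i
      by_cases hi : 0 < k i
      · exact congrFun hxy ⟨i, hi⟩
      · have := hsub i hi
        exact Subsingleton.elim _ _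
    · intro y
      refine ⟨fun i => if hi : 0 < k i then y ⟨i, hi⟩ else 0, ?_⟩
      funext i
      simp only [ρ, LinearMap.pi_apply, LinearMap.proj_apply]
      rw [dif_pos i.2]
  have := (decomp_of_intertwining hφ (f := fun i : {i // 0 < k i} => p i) (a := fun i => k i)
    (fun i => hp i) (fun i => i.2) (e.trans (LinearEquiv.ofBijective ρ hρ))
    (fun x j => he x j)).2
  exact ⟨_, _, _, this.reindex (Fintype.equivFin _).symm⟩

lemma Decomp.finrank [Fintype ι] {φ : Module.End F V} {v : ι → F[X]} {a : ι → ℕ}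
    (h : Decomp φ v a) : Module.finrank F V = ∑ j, a j * (v j).natDegree := by
  obtain ⟨e, -⟩ := h.equiv
  have : ∀ j, Module.Finite F (AdjoinRoot (v j ^ a j)) := fun j =>
    finite_adjoinRoot (pow_ne_zero _ (h.irreducible j).ne_zero)
  rw [e.finrank_eq, Module.finrank_pi_fintype]
  refine Finset.sum_congr rfl fun j _ => ?_
  rw [finrank_adjoinRoot (pow_ne_zero _ (h.irreducible j).ne_zero), natDegree_pow]

/-- Every family of the right total degree comes from an endomorphism. -/
theorem exists_of_finrank_eq [Fintype ι] [FiniteDimensional F V] {v : ι → F[X]} {a : ι → ℕ}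
    (hv : ∀ j, Irreducible (v j)) (h0 : ∀ j, (v j).coeff 0 = 1) (ha : ∀ j, 0 < a j)
    (hn : Module.finrank F V = ∑ j, a j * (v j).natDegree) :
    ∃ φ : Module.End F V, Decomp φ v a := by
  have : ∀ j, Module.Finite F (AdjoinRoot (v j ^ a j)) := fun j =>
    finite_adjoinRoot (pow_ne_zero _ (hv j).ne_zero)
  have hd : Module.finrank F V = Module.finrank F (∀ j, AdjoinRoot (v j ^ a j)) := by
    rw [hn, Module.finrank_pi_fintype]
    refine Finset.sum_congr rfl fun j _ => ?_
    rw [finrank_adjoinRoot (pow_ne_zero _ (hv j).ne_zero), natDegree_pow]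
  let e := LinearEquiv.ofFinrankEq _ _ hd
  let m : Module.End F (∀ j, AdjoinRoot (v j ^ a j)) :=
    LinearMap.mulLeft F (fun j => AdjoinRoot.root (v j ^ a j))
  refine ⟨e.symm.toLinearMap ∘ₗ m ∘ₗ e.toLinearMap, hv, h0, ha, e, fun x j => ?_⟩
  simp [m]

/-- A conjugate of `φ` is determined by the decomposition. -/
theorem Decomp.exists_conj {V' κ : Type*} [AddCommGroup V'] [Module F V'] [Fintype ι] [Fintype κ]
    {φ : Module.End F V} {ψ : Module.End F V'} {v : ι → F[X]} {a : ι → ℕ} {v' : κ → F[X]}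
    {a' : κ → ℕ} (h : Decomp φ v a) (h' : Decomp ψ v' a')
    (heq : Finset.univ.val.map (fun j => (v j, a j)) =
      Finset.univ.val.map (fun j => (v' j, a' j))) :
    ∃ s : V ≃ₗ[F] V', ∀ x, s (φ x) = ψ (s x) := by
  obtain ⟨s, hs⟩ := exists_equiv_of_map_univ_eq heq
  have hv : v = v' ∘ s := by funext x; exact (congrArg Prod.fst (hs x)).symm
  have ha : a = a' ∘ s := by funext x; exact (congrArg Prod.snd (hs x)).symm
  have h2 := h'.reindex s
  rw [← hv, ← ha] at h2
  obtain ⟨e, he⟩ := h.equiv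
  obtain ⟨e', he'⟩ := h2.equiv
  refine ⟨e.trans e'.symm, fun x => e'.injective ?_⟩
  funext j
  simp [he, he']

end Basic

end Decomposition

end RealPSL

end

noncomputable section

namespace RealPSL

/-! ### Uniqueness of elementary divisors over a finite field, by counting kernels. -/

section Uniqueness

variable {F : Type*} [Field F]

lemma eq_of_dvd_irreducible {p v : F[X]} (hp : Irreducible p) (hp0 : p.coeff 0 = 1)
    (hv : Irreducible v) (hv0 : v.coeff 0 = 1) (h : p ∣ v) : v = p :=
  (eq_of_associated hp0 hv0 (hp.associated_of_dvd hv h)).symm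

lemma isUnit_mk_pow {p v : F[X]} (hp : Irreducible p) (hp0 : p.coeff 0 = 1)
    (hv : Irreducible v) (hv0 : v.coeff 0 = 1) (h : v ≠ p) (a k : ℕ) :
    IsUnit (AdjoinRoot.mk (v ^ a) (p ^ k)) := by
  have hc : IsCoprime (p ^ k) (v ^ a) :=
    (hp.coprime_iff_not_dvd.mpr fun hd => h (eq_of_dvd_irreducible hp hp0 hv hv0 hd)).pow
  obtain ⟨s, t, hst⟩ := hc
  refine IsUnit.of_mul_eq_one (AdjoinRoot.mk (v ^ a) s) ?_
  have := congrArg (AdjoinRoot.mk (v ^ a)) hst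
  rw [map_add, map_mul, map_mul, AdjoinRoot.mk_self, mul_zero, add_zero, map_one] at this
  rw [mul_comm, this]

/-- As a function of `k`, `min k a` is linear except for a kink at `k = a`, so its negated second
difference is the indicator of `a`. Thus the multiplicities can be recovered from the sums of
minima. -/
lemma count_eq_min_sub {ι : Type*} [Fintype ι] [DecidableEq F[X]] (v : ι → F[X])
    (a : ι → ℕ) (p : F[X]) (i : ℕ) :
    (((Finset.univ.val.map (fun j => (v j, a j))).count (p, i + 1) : ℕ) : ℤ) =
      2 * ((∑ j with v j = p, min (i + 1) (a j) : ℕ) : ℤ)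
      - ((∑ j with v j = p, min i (a j) : ℕ) : ℤ)
      - ((∑ j with v j = p, min (i + 2) (a j) : ℕ) : ℤ) := by
  rw [Multiset.count_map]
  have : Multiset.card (Finset.univ.val.filter fun j => (p, i + 1) = (v j, a j)) =
      ∑ j with v j = p, if a j = i + 1 then 1 else 0 := by
    rw [← Finset.card_filter, Finset.filter_filter]
    simp only [Finset.card, Finset.filter_val]
    congr 1
    refine Multiset.filter_congr fun j _ => ?_
    rw [Prod.mk.injEq]
    tauto
  rw [this]
  push_cast
  rw [Finset.mul_sum, ← Finset.sum_sub_distrib, ← Finset.sum_sub_distrib]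
  refine Finset.sum_congr rfl fun j _ => ?_
  split_ifs <;> omega

variable [Fintype F]

/-- For `v ≠ p` the element `p ^ k` is a unit modulo `v ^ a`. For `v = p` its kernel is the ideal
generated by `v ^ (a - min k a)`, a copy of `F[X] / (v ^ min k a)`. -/
lemma card_ker_mk_pow {p v : F[X]} (hp : Irreducible p) (hp0 : p.coeff 0 = 1)
    (hv : Irreducible v) (hv0 : v.coeff 0 = 1) (a k : ℕ) [Decidable (v = p)] :
    Nat.card {y : AdjoinRoot (v ^ a) // AdjoinRoot.mk (v ^ a) (p ^ k) * y = 0} =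
      if v = p then Fintype.card F ^ (p.natDegree * min k a) else 1 := by
  split_ifs with h
  · subst h
    have hfin : ∀ k, Nat.card (AdjoinRoot (v ^ k)) = Fintype.card F ^ (v.natDegree * k) := by
      intro k
      have := finite_adjoinRoot (pow_ne_zero k hv.ne_zero)
      rw [Module.natCard_eq_pow_finrank (K := F), finrank_adjoinRoot (pow_ne_zero k hv.ne_zero),
        natDegree_pow, mul_comm, Nat.card_eq_fintype_card]
    rcases le_total a k with hk | hk
    · rw [min_eq_right hk, ← hfin a]
      refine Nat.card_congr (Equiv.subtypeUnivEquiv fun y => ?_)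
      rw [AdjoinRoot.mk_eq_zero.mpr (pow_dvd_pow v hk), zero_mul]
    · rw [min_eq_left hk, ← hfin k]
      obtain ⟨b, rfl⟩ := Nat.exists_eq_add_of_le hk
      have hle : Ideal.span {v ^ k} ≤
          Submodule.comap (LinearMap.lsmul F[X] F[X] (v ^ b)) (Ideal.span {v ^ (k + b)}) := by
        refine Ideal.span_le.mpr (Set.singleton_subset_iff.mpr ?_)
        change v ^ b * v ^ k ∈ Ideal.span {v ^ (k + b)}
        rw [← pow_add, add_comm]
        exact Ideal.mem_span_singleton_self _
      let T : AdjoinRoot (v ^ k) → AdjoinRoot (v ^ (k + b)) :=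
        Submodule.mapQ (Ideal.span {v ^ k}) (Ideal.span {v ^ (k + b)})
          (LinearMap.lsmul F[X] F[X] (v ^ b)) hle
      have hT : ∀ z, T (AdjoinRoot.mk _ z) = AdjoinRoot.mk _ (v ^ b * z) := fun z => rfl
      symm
      refine Nat.card_congr (Equiv.ofBijective (fun z => ⟨T z, ?_⟩) ⟨?_, ?_⟩)
      · obtain ⟨z, rfl⟩ := AdjoinRoot.mk_surjective z
        rw [hT, ← map_mul, AdjoinRoot.mk_eq_zero]
        exact ⟨z, by ring⟩
      · intro z z' h
        obtain ⟨z, rfl⟩ := AdjoinRoot.mk_surjective z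
        obtain ⟨z', rfl⟩ := AdjoinRoot.mk_surjective z'
        have h' := congrArg Subtype.val h
        simp only [hT, AdjoinRoot.mk_eq_mk] at h' ⊢
        rw [← mul_sub, pow_add, mul_comm (v ^ k)] at h'
        exact (mul_dvd_mul_iff_left (pow_ne_zero _ hv.ne_zero)).mp h'
      · rintro ⟨y, hy⟩
        obtain ⟨y, rfl⟩ := AdjoinRoot.mk_surjective y
        rw [← map_mul, AdjoinRoot.mk_eq_zero, pow_add] at hy
        obtain ⟨z, rfl⟩ := (mul_dvd_mul_iff_left (pow_ne_zero _ hv.ne_zero)).mp hy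
        exact ⟨AdjoinRoot.mk _ z, rfl⟩
  · have hu := isUnit_mk_pow hp hp0 hv hv0 h a k
    rw [Nat.card_eq_one_iff_unique]
    refine ⟨⟨fun x y => Subtype.ext ?_⟩, ⟨0, mul_zero _⟩⟩
    rw [hu.mul_right_eq_zero.mp x.2, hu.mul_right_eq_zero.mp y.2]

variable {V ι : Type*} [AddCommGroup V] [Module F V] [Fintype ι]

lemma Decomp.card_ker [DecidableEq F[X]] {φ : Module.End F V} {v : ι → F[X]} {a : ι → ℕ}
    (h : Decomp φ v a) {p : F[X]} (hp : Irreducible p) (hp0 : p.coeff 0 = 1) (k : ℕ) :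
    Nat.card {x : V // aeval φ (p ^ k) x = 0} =
      Fintype.card F ^ (p.natDegree * ∑ j with v j = p, min k (a j)) := by
  obtain ⟨e, he⟩ := h.equiv
  have h1 : Nat.card {x : V // aeval φ (p ^ k) x = 0} =
      Nat.card (∀ j, {y : AdjoinRoot (v j ^ a j) // AdjoinRoot.mk (v j ^ a j) (p ^ k) * y = 0}) := by
    refine Nat.card_congr ((e.toEquiv.subtypeEquiv fun x => ?_).trans
      (Equiv.subtypePiEquivPi (p := fun j (y : AdjoinRoot (v j ^ a j)) =>
        AdjoinRoot.mk (v j ^ a j) (p ^ k) * y = 0)))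
    rw [← e.map_eq_zero_iff, funext_iff]
    exact forall_congr' fun j =>
      (congrArg (· = 0) (apply_aeval_of_intertwining e.toLinearMap he (p ^ k) x j)).to_iff
  rw [h1, Nat.card_pi, Finset.mul_sum, ← Finset.prod_pow_eq_pow_sum, Finset.prod_filter]
  exact Finset.prod_congr rfl fun j _ =>
    card_ker_mk_pow hp hp0 (h.irreducible j) (h.coeff_zero j) (a j) k

/-- The decomposition of an endomorphism is unique. -/
theorem Decomp.unique {κ : Type*} [Fintype κ] {φ : Module.End F V} {v : ι → F[X]} {a : ι → ℕ}
    {v' : κ → F[X]} {a' : κ → ℕ} (h : Decomp φ v a) (h' : Decomp φ v' a') :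
    Finset.univ.val.map (fun j => (v j, a j)) =
      Finset.univ.val.map (fun j => (v' j, a' j)) := by
  classical
  ext ⟨p, i⟩
  by_cases hpi : (Irreducible p ∧ p.coeff 0 = 1) ∧ 0 < i
  · obtain ⟨⟨hp, hp0⟩, hi⟩ := hpi
    obtain ⟨i, rfl⟩ := Nat.exists_eq_succ_of_ne_zero hi.ne'
    -- The order of the kernel of `p(φ) ^ k` does not depend on the decomposition, and the sum is
    -- its logarithm divided by `deg p`.
    have key : ∀ k, ∑ j with v j = p, min k (a j) = ∑ j with v' j = p, min k (a' j) := by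
      intro k
      have h1 := (h.card_ker hp hp0 k).symm.trans (h'.card_ker hp hp0 k)
      exact Nat.eq_of_mul_eq_mul_left hp.natDegree_pos
        (Nat.pow_right_injective Fintype.one_lt_card h1)
    have h1 := count_eq_min_sub v a p i
    have h2 := count_eq_min_sub v' a' p i
    rw [key, key, key, ← h2] at h1
    exact_mod_cast h1
  · rw [Multiset.count_eq_zero_of_notMem, Multiset.count_eq_zero_of_notMem]
    · intro hm
      obtain ⟨j, -, hj⟩ := Multiset.mem_map.mp hm
      rw [Prod.mk.injEq] at hj
      exact hpi ⟨⟨hj.1 ▸ h'.irreducible j, hj.1 ▸ h'.coeff_zero j⟩, hj.2 ▸ h'.pos j⟩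
    · intro hm
      obtain ⟨j, -, hj⟩ := Multiset.mem_map.mp hm
      rw [Prod.mk.injEq] at hj
      exact hpi ⟨⟨hj.1 ▸ h.irreducible j, hj.1 ▸ h.coeff_zero j⟩, hj.2 ▸ h.pos j⟩

end Uniqueness

/-! ### The isomorphism inverting the root, and the decomposition of `l φ⁻¹`. -/

section Flip

variable {F : Type*} [Field F]

/-- The inverse of the root of `W`, if `W` has constant term `1`. -/
def rootInv (W : F[X]) : AdjoinRoot W := -AdjoinRoot.mk W (divX W)

/-- Read `W = divX W * X + 1` modulo `W`. -/
lemma root_mul_rootInv {W : F[X]} (h : W.coeff 0 = 1) : AdjoinRoot.root W * rootInv W = 1 := by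
  have := congrArg (AdjoinRoot.mk W) (divX_mul_X_add W)
  rw [AdjoinRoot.mk_self, h, map_add, map_mul, AdjoinRoot.mk_X, C_1, map_one] at this
  rw [rootInv, mul_neg, mul_comm]
  linear_combination -this

/-- The homomorphism which maps the root of `W` to `l` times the inverse of the root of `W'`. -/
def flip (l : Fˣ) (W W' : F[X]) (h : dual l W' = W) (h0 : W'.coeff 0 = 1) :
    AdjoinRoot W →ₐ[F] AdjoinRoot W' :=
  AdjoinRoot.liftAlgHom W (Algebra.ofId F _) (algebraMap F _ (l : F) * rootInv W') (by
    rw [← h]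
    refine aeval_dual_eq_zero l W' (x := AdjoinRoot.root W') ?_ (AdjoinRoot.eval₂_root W')
    rw [mul_left_comm, root_mul_rootInv h0, mul_one])

lemma flip_root (l : Fˣ) (W W' : F[X]) (h : dual l W' = W) (h0 : W'.coeff 0 = 1) :
    flip l W W' h h0 (AdjoinRoot.root W) = algebraMap F _ (l : F) * rootInv W' :=
  AdjoinRoot.liftAlgHom_root ..

lemma root_mul_flip_root (l : Fˣ) (W W' : F[X]) (h : dual l W' = W) (h0 : W'.coeff 0 = 1) :
    AdjoinRoot.root W' * flip l W W' h h0 (AdjoinRoot.root W) = algebraMap F _ (l : F) := by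
  rw [flip_root, mul_left_comm, root_mul_rootInv h0, mul_one]

lemma flip_flip (l : Fˣ) (W W' : F[X]) (h : dual l W' = W) (h0 : W'.coeff 0 = 1)
    (h' : dual l W = W') (h0' : W.coeff 0 = 1) (x : AdjoinRoot W) :
    flip l W' W h' h0' (flip l W W' h h0 x) = x := by
  have : (flip l W' W h' h0').comp (flip l W W' h h0) = AlgHom.id F _ := by
    apply AdjoinRoot.algHom_ext
    rw [AlgHom.comp_apply, AlgHom.id_apply]
    have h1 := congrArg (flip l W' W h' h0') (root_mul_flip_root l W W' h h0)
    rw [map_mul, AlgHom.commutes, ← root_mul_flip_root l W' W h' h0'] at h1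
    have hu : IsUnit (flip l W' W h' h0' (AdjoinRoot.root W')) :=
      (IsUnit.of_mul_eq_one _ (root_mul_rootInv h0)).map _
    rw [mul_comm (AdjoinRoot.root W)] at h1
    exact hu.mul_left_cancel h1
  exact congrArg (fun f => f x) this

/-- `flip` as an isomorphism. -/
def flipEquiv (l : Fˣ) (W W' : F[X]) (h : dual l W' = W) (h0 : W'.coeff 0 = 1)
    (h' : dual l W = W') (h0' : W.coeff 0 = 1) : AdjoinRoot W ≃ₗ[F] AdjoinRoot W' :=
  LinearEquiv.ofLinearMap (flip l W W' h h0).toLinearMap (flip l W' W h' h0').toLinearMap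
    (LinearMap.ext fun x => flip_flip l W' W h' h0' h h0 x)
    (LinearMap.ext fun x => flip_flip l W W' h h0 h' h0' x)

lemma coeff_zero_pow {v : F[X]} (h : v.coeff 0 = 1) (a : ℕ) : (v ^ a).coeff 0 = 1 := by
  rw [coeff_zero_eq_eval_zero, eval_pow, ← coeff_zero_eq_eval_zero, h, one_pow]

variable {V ι : Type*} [AddCommGroup V] [Module F V]

/-- Here `ψ` is `l φ⁻¹`. Composing the model of `φ` with `flip` in each summand turns multiplication
by `l` over the root into multiplication by the new root. -/
lemma Decomp.dual {φ ψ : Module.End F V} {v : ι → F[X]} {a : ι → ℕ}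
    (h : Decomp φ v a) (l : Fˣ) (hl : ∀ x, φ (ψ x) = (l : F) • x) :
    Decomp ψ (fun j => dual l (v j)) a := by
  obtain ⟨e, he⟩ := h.equiv
  have h0 : ∀ j, (v j ^ a j).coeff 0 = 1 := fun j => coeff_zero_pow (h.coeff_zero j) _
  have h0' : ∀ j, (RealPSL.dual l (v j)).coeff 0 = 1 :=
    fun j => coeff_zero_dual l (h.irreducible j).ne_zero
  have hd : ∀ j, RealPSL.dual l (v j ^ a j) = RealPSL.dual l (v j) ^ a j :=
    fun j => dual_pow l (v j) (a j)
  have hd' : ∀ j, RealPSL.dual l (RealPSL.dual l (v j) ^ a j) = v j ^ a j :=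
    fun j => by rw [← hd, dual_dual l (h0 j)]
  refine ⟨fun j => irreducible_dual l (h.coeff_zero j) (h.irreducible j), h0', h.pos,
    e.trans (LinearEquiv.piCongrRight fun j => flipEquiv l (v j ^ a j)
      (RealPSL.dual l (v j) ^ a j) (hd' j) (coeff_zero_pow (h0' j) _) (hd j) (h0 j)), fun x j => ?_⟩
  let T := flip l (v j ^ a j) (RealPSL.dual l (v j) ^ a j) (hd' j) (coeff_zero_pow (h0' j) _)
  change T (e (ψ x) j) = _ * T (e x j)
  have h1 : AdjoinRoot.root (v j ^ a j) * e (ψ x) j = (l : F) • e x j := by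
    rw [← he, hl, map_smul]; rfl
  have h2 := congrArg T h1
  rw [map_mul, map_smul] at h2
  have h3 := root_mul_flip_root l (v j ^ a j) (RealPSL.dual l (v j) ^ a j) (hd' j)
    (coeff_zero_pow (h0' j) _)
  have h4 : (l : F) • T (e (ψ x) j) = (l : F) • (AdjoinRoot.root _ * T (e x j)) := by
    rw [mul_comm (AdjoinRoot.root _), ← smul_mul_assoc, ← h2, Algebra.smul_def, ← h3]
    ring
  exact smul_right_injective _ l.ne_zero h4

end Flip

/-! ### The determinant in terms of elementary divisors. -/

section Determinant

variable {F : Type*} [Field F]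

lemma det_blockDiagonal {ι : Type*} [Fintype ι] [DecidableEq ι] {m : ι → Type*}
    [∀ j, Fintype (m j)] [∀ j, DecidableEq (m j)] (A : ∀ j, Matrix (m j) (m j) F) :
    (Matrix.blockDiagonal' A).det = ∏ j, (A j).det := by
  -- An arbitrary order on the blocks, which makes the matrix block triangular.
  let _ : LinearOrder ι := LinearOrder.lift' (Fintype.equivFin ι) (Fintype.equivFin ι).injective
  have hA : (Matrix.blockDiagonal' A).BlockTriangular Sigma.fst := by
    rintro ⟨i, k⟩ ⟨j, l⟩ hij
    rw [Matrix.blockDiagonal'_apply, dif_neg (ne_of_gt hij)]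
  rw [hA.det_fintype]
  refine Finset.prod_congr rfl fun j _ => ?_
  let e : m j ≃ {x : Σ j, m j // x.1 = j} :=
    ⟨fun k => ⟨⟨j, k⟩, rfl⟩, fun x => x.2 ▸ x.1.2, fun k => rfl, by rintro ⟨⟨i, k⟩, rfl⟩; rfl⟩
  rw [← Matrix.det_submatrix_equiv_self e]
  congr 1
  ext k l
  simp [Matrix.toSquareBlock_def, e, Matrix.blockDiagonal'_apply]

lemma det_pi_map {ι : Type*} [Fintype ι] {M : ι → Type*} [∀ j, AddCommGroup (M j)]
    [∀ j, Module F (M j)] [∀ j, Module.Finite F (M j)] (f : ∀ j, Module.End F (M j)) :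
    LinearMap.det (LinearMap.pi fun j => f j ∘ₗ LinearMap.proj j : Module.End F (∀ j, M j)) =
      ∏ j, LinearMap.det (f j) := by
  classical
  let b : ∀ j, Module.Basis (Fin (Module.finrank F (M j))) F (M j) := fun j => Module.finBasis F _
  rw [← LinearMap.det_toMatrix (Pi.basis b)]
  have : LinearMap.toMatrix (Pi.basis b) (Pi.basis b)
      (LinearMap.pi fun j => f j ∘ₗ LinearMap.proj j) =
      Matrix.blockDiagonal' fun j => LinearMap.toMatrix (b j) (b j) (f j) := by
    ext ⟨i, k⟩ ⟨j, m⟩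
    rw [LinearMap.toMatrix_apply, Pi.basis_apply, Pi.basis_repr]
    by_cases hij : i = j
    · subst hij
      simp [LinearMap.toMatrix_apply, Matrix.blockDiagonal'_apply]
    · rw [Matrix.blockDiagonal'_apply, dif_neg hij]
      simp only [LinearMap.pi_apply, LinearMap.comp_apply, LinearMap.proj_apply]
      rw [Pi.single_eq_of_ne hij]
      simp
  rw [this, det_blockDiagonal]
  exact Finset.prod_congr rfl fun j _ => LinearMap.det_toMatrix (b j) (f j)

/-- The minimal polynomial of the root is `W` divided by its leading coefficient, and its constant
term is therefore the inverse of that coefficient. -/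
lemma norm_root {W : F[X]} (hW : W.coeff 0 = 1) :
    Algebra.norm F (AdjoinRoot.root W) = (-1) ^ W.natDegree * W.leadingCoeff⁻¹ := by
  have hne := ne_zero_of_coeff_zero hW
  have := Algebra.PowerBasis.norm_gen_eq_coeff_zero_minpoly (AdjoinRoot.powerBasis hne)
  rw [AdjoinRoot.powerBasis_gen, AdjoinRoot.powerBasis_dim, AdjoinRoot.minpoly_root hne] at this
  rw [this, coeff_mul_C, hW, one_mul]

variable {V ι : Type*} [AddCommGroup V] [Module F V]

lemma Decomp.det [Fintype ι] {φ : Module.End F V} {v : ι → F[X]} {a : ι → ℕ} (h : Decomp φ v a) :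
    LinearMap.det φ = ∏ j, ((-1) ^ (v j).natDegree * (v j).leadingCoeff⁻¹) ^ a j := by
  obtain ⟨e, he⟩ := h.equiv
  have : ∀ j, Module.Finite F (AdjoinRoot (v j ^ a j)) := fun j =>
    finite_adjoinRoot (pow_ne_zero _ (h.irreducible j).ne_zero)
  have h1 := det_pi_map (F := F)
    (fun j => LinearMap.mulLeft F (AdjoinRoot.root (v j ^ a j)))
  rw [← LinearMap.det_conj φ e]
  have h2 : (e.toLinearMap ∘ₗ φ ∘ₗ e.symm.toLinearMap) = LinearMap.pi fun j =>
      LinearMap.mulLeft F (AdjoinRoot.root (v j ^ a j)) ∘ₗ LinearMap.proj j := by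
    ext1 x
    funext j
    simp [he]
  rw [h2, h1]
  refine Finset.prod_congr rfl fun j _ => ?_
  have := norm_root (coeff_zero_pow (h.coeff_zero j) (a j))
  rw [Algebra.norm_apply] at this
  change LinearMap.det (Algebra.lmul F (AdjoinRoot (v j ^ a j)) (AdjoinRoot.root _)) = _
  rw [this, natDegree_pow, leadingCoeff_pow, mul_pow, inv_pow, ← pow_mul, mul_comm (a j)]

end Determinant

end RealPSL

end

noncomputable section

namespace RealPSL

/-! ### Elementary divisors versus the products `u_i`. -/

section FactorProducts

variable {F : Type*} [Field F]

/-- The analogue of `uPoly` for a decomposition into polynomials with constant term `1`. -/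
def partProd {ι : Type*} [Fintype ι] (v : ι → F[X]) (a : ι → ℕ) (i : ℕ) : F[X] :=
  ∏ j with a j = i, v j

lemma partProd_eq_multiset {ι : Type*} [Fintype ι] (v : ι → F[X]) (a : ι → ℕ) (i : ℕ) :
    partProd v a i =
      (((Finset.univ.val.map fun j => (v j, a j)).filter fun x => x.2 = i).map Prod.fst).prod := by
  rw [Multiset.filter_map, Multiset.map_map]
  rfl

lemma multiset_eq_of_prod_eq {s t : Multiset F[X]}
    (hs : ∀ p ∈ s, Irreducible p ∧ p.coeff 0 = 1) (ht : ∀ p ∈ t, Irreducible p ∧ p.coeff 0 = 1)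
    (h : s.prod = t.prod) : s = t := by
  have h1 : Multiset.Rel Associated s t := UniqueFactorizationMonoid.factors_unique
    (fun p hp => (hs p hp).1) (fun p hp => (ht p hp).1) (h ▸ Associated.refl _)
  rw [← Multiset.rel_eq]
  exact h1.mono fun p hp q hq hpq => eq_of_associated (hs p hp).2 (ht q hq).2 hpq

/-- Unique factorisation of each `u_i` recovers the elementary divisors of exponent `i`. The
normalisation of the constant terms removes the ambiguity by units. -/
lemma map_eq_of_partProd_eq {V V' ι κ : Type*} [AddCommGroup V] [Module F V] [AddCommGroup V']
    [Module F V'] [Fintype ι] [Fintype κ] {φ : Module.End F V} {ψ : Module.End F V'}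
    {v : ι → F[X]} {a : ι → ℕ} {v' : κ → F[X]} {a' : κ → ℕ} (h : Decomp φ v a)
    (h' : Decomp ψ v' a') (heq : ∀ i, partProd v a i = partProd v' a' i) :
    Finset.univ.val.map (fun j => (v j, a j)) =
      Finset.univ.val.map (fun j => (v' j, a' j)) := by
  classical
  have key : ∀ i, ((Finset.univ.val.map fun j => (v j, a j)).filter fun x => x.2 = i).map Prod.fst =
      ((Finset.univ.val.map fun j => (v' j, a' j)).filter fun x => x.2 = i).map Prod.fst := by
    intro i
    have h1 := heq i
    rw [partProd_eq_multiset, partProd_eq_multiset] at h1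
    refine multiset_eq_of_prod_eq (fun p hp => ?_) (fun p hp => ?_) h1
    · simp only [Multiset.mem_map, Multiset.mem_filter] at hp
      obtain ⟨_, ⟨⟨j, -, rfl⟩, -⟩, rfl⟩ := hp
      exact ⟨h.irreducible j, h.coeff_zero j⟩
    · simp only [Multiset.mem_map, Multiset.mem_filter] at hp
      obtain ⟨_, ⟨⟨j, -, rfl⟩, -⟩, rfl⟩ := hp
      exact ⟨h'.irreducible j, h'.coeff_zero j⟩
  have hcount : ∀ (m : Multiset (F[X] × ℕ)) (p : F[X]) (i : ℕ),
      m.count (p, i) = ((m.filter fun x => x.2 = i).map Prod.fst).count p := by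
    intro m p i
    rw [Multiset.count_map, Multiset.filter_filter, Multiset.count_eq_card_filter_eq]
    congr 1
    refine Multiset.filter_congr fun x _ => ?_
    constructor
    · rintro rfl; exact ⟨rfl, rfl⟩
    · rintro ⟨rfl, rfl⟩; rfl
  ext ⟨p, i⟩
  rw [hcount, hcount, key]

lemma partProd_coeff_zero {ι : Type*} [Fintype ι] {v : ι → F[X]} (hv : ∀ j, (v j).coeff 0 = 1)
    (a : ι → ℕ) (i : ℕ) : (partProd v a i).coeff 0 = 1 :=
  prod_coeff_zero _ fun j _ => hv j

lemma natDegree_partProd {ι : Type*} [Fintype ι] {v : ι → F[X]} (hv : ∀ j, (v j).coeff 0 = 1)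
    (a : ι → ℕ) (i : ℕ) : (partProd v a i).natDegree = ∑ j with a j = i, (v j).natDegree :=
  natDegree_prod _ _ fun j _ => ne_zero_of_coeff_zero (hv j)

lemma exists_list_factors {u : F[X]} (hu : u.coeff 0 = 1) :
    ∃ L : List F[X], (∀ p ∈ L, Irreducible p ∧ p.coeff 0 = 1) ∧ L.prod = u := by
  obtain ⟨f, hf, hfu⟩ := WfDvdMonoid.exists_factors u (ne_zero_of_coeff_zero hu)
  have h0 : ∀ p ∈ f, p.coeff 0 ≠ 0 := by
    intro p hp h
    have h1 : p ∣ u := (Multiset.dvd_prod hp).trans hfu.dvd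
    have h2 : X ∣ u := (X_dvd_iff.mpr h).trans h1
    rw [X_dvd_iff, hu] at h2
    exact one_ne_zero h2
  let N : F[X] → F[X] := fun p => C (p.coeff 0)⁻¹ * p
  have hN : ∀ p ∈ f.toList.map N, Irreducible p ∧ p.coeff 0 = 1 := by
    intro p hp
    obtain ⟨w, hw, rfl⟩ := List.mem_map.mp hp
    have hw := Multiset.mem_toList.mp hw
    exact ⟨(associated_C_mul (inv_ne_zero (h0 w hw)) w).irreducible (hf w hw),
      by simp only [N, coeff_C_mul, inv_mul_cancel₀ (h0 w hw)]⟩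
  refine ⟨f.toList.map N, hN, eq_of_associated ?_ hu (Associated.trans ?_ hfu)⟩
  · have : ∀ L : List F[X], (∀ p ∈ L, p.coeff 0 = 1) → L.prod.coeff 0 = 1 := by
      intro L
      induction L with
      | nil => intro _; simp
      | cons p L ih =>
        intro h
        rw [List.prod_cons, mul_coeff_zero, h p (by simp), ih fun q hq => h q (by simp [hq]),
          one_mul]
    exact this _ fun p hp => (hN p hp).2
  · rw [← Multiset.prod_toList]
    have : ∀ L : List F[X], (∀ p ∈ L, p.coeff 0 ≠ 0) → Associated (L.map N).prod L.prod := by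
      intro L
      induction L with
      | nil => intro _; simp
      | cons p L ih =>
        intro h
        rw [List.map_cons, List.prod_cons, List.prod_cons]
        exact (associated_C_mul (inv_ne_zero (h p (by simp))) p).symm.mul_mul
          (ih fun q hq => h q (by simp [hq]))
    exact this _ fun p hp => h0 p (Multiset.mem_toList.mp hp)

end FactorProducts

/-! ### The polynomials `u_i` as complete invariants of conjugacy in `GL_n`. -/

section GeneralLinear

variable {F : Type*} [Field F] {n : ℕ}

/-- The endomorphism of `F ^ n` defined by an element of `GL_n`. -/
def lin (g : GL (Fin n) F) : Module.End F (Fin n → F) :=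
  Matrix.toLin' (g : Matrix (Fin n) (Fin n) F)

lemma lin_mul (g h : GL (Fin n) F) : lin (g * h) = lin g * lin h := by
  simp [lin, Matrix.toLin'_mul, Module.End.mul_eq_comp]

lemma lin_one : lin (1 : GL (Fin n) F) = 1 := by
  simp [lin, Module.End.one_eq_id]

lemma lin_injective : Function.Injective (lin : GL (Fin n) F → _) := fun _ _ hgh =>
  Units.ext (Matrix.toLin'.injective hgh)

lemma lin_apply_injective (g : GL (Fin n) F) : Function.Injective (lin g) := by
  refine Function.LeftInverse.injective (g := lin g⁻¹) fun x => ?_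
  rw [← Module.End.mul_apply, ← lin_mul, inv_mul_cancel, lin_one, Module.End.one_apply]

lemma lin_scalar_apply (c : Fˣ) (x : Fin n → F) :
    lin (Matrix.GeneralLinearGroup.scalar (Fin n) c) x = (c : F) • x := by
  simp [lin, Matrix.toLin'_apply]

lemma det_lin (g : GL (Fin n) F) :
    LinearMap.det (lin g) = ((Matrix.GeneralLinearGroup.det g : Fˣ) : F) := by
  simp [lin]

/-- The element of `GL_n` defined by an automorphism of `F ^ n`. -/
def ofEquiv (s : (Fin n → F) ≃ₗ[F] (Fin n → F)) : GL (Fin n) F :=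
  ⟨LinearMap.toMatrix' s.toLinearMap, LinearMap.toMatrix' s.symm.toLinearMap,
    by rw [← LinearMap.toMatrix'_comp]; simp, by rw [← LinearMap.toMatrix'_comp]; simp⟩

lemma lin_ofEquiv (s : (Fin n → F) ≃ₗ[F] (Fin n → F)) : lin (ofEquiv s) = s.toLinearMap := by
  simp [lin, ofEquiv]

lemma exists_lin_eq {φ : Module.End F (Fin n → F)} (hφ : Function.Injective φ) :
    ∃ g : GL (Fin n) F, lin g = φ :=
  ⟨ofEquiv (LinearEquiv.ofInjectiveEndo φ hφ), by rw [lin_ofEquiv]; rfl⟩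

lemma exists_decomp_lin (g : GL (Fin n) F) :
    ∃ (r : ℕ) (v : Fin r → F[X]) (a : Fin r → ℕ), Decomp (lin g) v a :=
  exists_decomp (lin_apply_injective g)

/-- The polynomials `u_i` of an element of `GL_n`. -/
def uInv (g : GL (Fin n) F) : ℕ → F[X] :=
  partProd (exists_decomp_lin g).choose_spec.choose
    (exists_decomp_lin g).choose_spec.choose_spec.choose

lemma exists_decomp_uInv (g : GL (Fin n) F) :
    ∃ (r : ℕ) (v : Fin r → F[X]) (a : Fin r → ℕ), Decomp (lin g) v a ∧ uInv g = partProd v a :=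
  ⟨_, _, _, (exists_decomp_lin g).choose_spec.choose_spec.choose_spec, rfl⟩

lemma uInv_coeff_zero (g : GL (Fin n) F) (i : ℕ) : (uInv g i).coeff 0 = 1 := by
  obtain ⟨r, v, a, h, h'⟩ := exists_decomp_uInv g
  rw [h']
  exact partProd_coeff_zero h.coeff_zero a i

lemma Decomp.det_eq {V ι : Type*} [AddCommGroup V] [Module F V] [Fintype ι]
    {φ : Module.End F V} {v : ι → F[X]} {a : ι → ℕ} (h : Decomp φ v a) {s : Finset ℕ}
    (hs : ∀ j, a j ∈ s) :
    LinearMap.det φ = ∏ i ∈ s,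
      ((-1) ^ (partProd v a i).natDegree * (partProd v a i).leadingCoeff⁻¹) ^ i := by
  rw [h.det, ← Finset.prod_fiberwise_of_maps_to (t := s) (g := a) fun j _ => hs j]
  refine Finset.prod_congr rfl fun i _ => ?_
  rw [natDegree_partProd h.coeff_zero, partProd, leadingCoeff_prod, ← Finset.prod_inv_distrib,
    ← Finset.prod_pow_eq_pow_sum, ← Finset.prod_mul_distrib, ← Finset.prod_pow]
  exact Finset.prod_congr rfl fun j hj => by rw [(Finset.mem_filter.mp hj).2]

/-- Irreducible polynomials have positive degree, so every exponent that occurs is detected by the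
degree of its product. -/
lemma Decomp.mem_of_natDegree {V ι : Type*} [AddCommGroup V] [Module F V] [Fintype ι]
    {φ : Module.End F V} {v : ι → F[X]} {a : ι → ℕ} (h : Decomp φ v a) {s : Finset ℕ}
    (hs : ∀ i, i ∉ s → (partProd v a i).natDegree = 0) (j : ι) : a j ∈ s := by
  by_contra hj
  have h1 := hs _ hj
  rw [natDegree_partProd h.coeff_zero, Finset.sum_eq_zero_iff] at h1
  exact (h.irreducible j).natDegree_pos.ne' (h1 j (by simp))

lemma det_eq_prod_uInv (g : GL (Fin n) F) {s : Finset ℕ}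
    (hs : ∀ i, i ∉ s → (uInv g i).natDegree = 0) :
    ((Matrix.GeneralLinearGroup.det g : Fˣ) : F) = ∏ i ∈ s,
      ((-1) ^ (uInv g i).natDegree * (uInv g i).leadingCoeff⁻¹) ^ i := by
  obtain ⟨r, v, a, h, h'⟩ := exists_decomp_uInv g
  rw [h'] at hs ⊢
  rw [← det_lin, h.det_eq (h.mem_of_natDegree hs)]

/-- Elements of `GL_n` with the same polynomials `u_i` are conjugate. -/
theorem exists_conj_of_uInv_eq {g g' : GL (Fin n) F} (h : uInv g = uInv g') :
    ∃ k, k * g * k⁻¹ = g' := by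
  obtain ⟨r, v, a, h1, h1'⟩ := exists_decomp_uInv g
  obtain ⟨r', v', a', h2, h2'⟩ := exists_decomp_uInv g'
  obtain ⟨s, hs⟩ := h1.exists_conj h2
    (map_eq_of_partProd_eq h1 h2 fun i => by rw [← h1', ← h2', h])
  refine ⟨ofEquiv s, ?_⟩
  rw [mul_inv_eq_iff_eq_mul]
  apply lin_injective
  rw [lin_mul, lin_mul, lin_ofEquiv]
  exact LinearMap.ext hs

lemma Decomp.injective {V ι : Type*} [AddCommGroup V] [Module F V] {φ : Module.End F V}
    {v : ι → F[X]} {a : ι → ℕ} (h : Decomp φ v a) : Function.Injective φ := by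
  obtain ⟨e, he⟩ := h.equiv
  intro x y hxy
  apply e.injective
  funext j
  have h1 : e (φ x) j = e (φ y) j := by rw [hxy]
  rw [he, he] at h1
  have hu : IsUnit (AdjoinRoot.root (v j ^ a j)) :=
    IsUnit.of_mul_eq_one _ (root_mul_rootInv (coeff_zero_pow (h.coeff_zero j) (a j)))
  exact hu.mul_left_cancel h1

/-- Every family of polynomials of the right degrees is the family of the `u_i` of a matrix. -/
theorem exists_decomp_of_natDegree {u : ℕ → F[X]} {s : Finset ℕ}
    (hu : ∀ i, (u i).coeff 0 = 1) (h0 : 0 ∉ s) (hs : ∀ i, i ∉ s → u i = 1)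
    (hn : ∑ i ∈ s, i * (u i).natDegree = n) :
    ∃ (g : GL (Fin n) F) (r : ℕ) (v : Fin r → F[X]) (a : Fin r → ℕ),
      Decomp (lin g) v a ∧ partProd v a = u := by
  choose L hL hLu using fun i => exists_list_factors (hu i)
  -- One index for each irreducible factor of each `u i`; this factor is taken with exponent `i`.
  let ι := Σ i : s, Fin (L i).length
  let v : ι → F[X] := fun x => (L x.1).get x.2
  let a : ι → ℕ := fun x => x.1
  have hv : ∀ x : ι, Irreducible (v x) ∧ (v x).coeff 0 = 1 := fun x => hL _ _ (List.get_mem _ _)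
  have hprod : ∀ i : s, ∏ k, v ⟨i, k⟩ = u i := by
    intro i
    rw [← hLu i, Fin.prod_univ_def]
    simp only [v]
    rw [List.map_get_finRange]
  have hn' : Module.finrank F (Fin n → F) = ∑ x, a x * (v x).natDegree := by
    rw [Module.finrank_fin_fun, Fintype.sum_sigma, ← hn, ← Finset.sum_coe_sort]
    refine Finset.sum_congr rfl fun i _ => ?_
    change _ = ∑ k, (i : ℕ) * (v ⟨i, k⟩).natDegree
    rw [← Finset.mul_sum, ← natDegree_prod _ _ fun k _ => (hv _).1.ne_zero, hprod]
  obtain ⟨φ, hφ⟩ := exists_of_finrank_eq (V := Fin n → F) (fun x => (hv x).1) (fun x => (hv x).2)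
    (fun x => Nat.pos_of_ne_zero fun h => h0 (h ▸ x.1.2)) hn'
  obtain ⟨g, rfl⟩ := exists_lin_eq hφ.injective
  have hpart : ∀ i, partProd v a i = u i := by
    intro i
    rw [partProd, Finset.prod_filter, Fintype.prod_sigma]
    by_cases hi : i ∈ s
    · rw [Finset.prod_eq_single (⟨i, hi⟩ : s)]
      · simp only [a, if_true]
        exact hprod ⟨i, hi⟩
      · intro j _ hj
        refine Finset.prod_eq_one fun k _ => if_neg fun h => hj (Subtype.ext h)
      · simp
    · rw [hs i hi]
      exact Finset.prod_eq_one fun j _ => Finset.prod_eq_one fun k _ =>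
        if_neg fun (h : (j : ℕ) = i) => hi (h ▸ j.2)
  refine ⟨g, _, _, _, hφ.reindex (Fintype.equivFin ι).symm, funext fun i => ?_⟩
  rw [← hpart i, partProd_eq_multiset, partProd_eq_multiset]
  congr 3
  rw [← Multiset.map_univ_val_equiv (Fintype.equivFin ι).symm, Multiset.map_map]
  rfl

variable [Fintype F]

/-- The decomposition chosen in `uInv` is immaterial, by `Decomp.unique`. -/
lemma uInv_eq {ι : Type*} [Fintype ι] {g : GL (Fin n) F} {v : ι → F[X]} {a : ι → ℕ}
    (h : Decomp (lin g) v a) : uInv g = partProd v a := by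
  obtain ⟨r, v', a', h1, h1'⟩ := exists_decomp_uInv g
  rw [h1']
  funext i
  rw [partProd_eq_multiset, partProd_eq_multiset, h.unique h1]

lemma exists_uInv_eq {u : ℕ → F[X]} {s : Finset ℕ}
    (hu : ∀ i, (u i).coeff 0 = 1) (h0 : 0 ∉ s) (hs : ∀ i, i ∉ s → u i = 1)
    (hn : ∑ i ∈ s, i * (u i).natDegree = n) : ∃ g : GL (Fin n) F, uInv g = u := by
  obtain ⟨g, r, v, a, h, rfl⟩ := exists_decomp_of_natDegree hu h0 hs hn
  exact ⟨g, uInv_eq h⟩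

lemma uInv_conj (g k : GL (Fin n) F) : uInv (k * g * k⁻¹) = uInv g := by
  obtain ⟨r, v, a, h, h'⟩ := exists_decomp_uInv g
  rw [h']
  let s : (Fin n → F) ≃ₗ[F] (Fin n → F) :=
    LinearEquiv.ofInjectiveEndo (lin k⁻¹) (lin_apply_injective _)
  refine uInv_eq (h.conj s fun x => ?_)
  change (lin k⁻¹ * lin (k * g * k⁻¹)) x = (lin g * lin k⁻¹) x
  rw [← lin_mul, ← lin_mul]
  congr 2
  group

lemma uInv_eq_iff {g g' : GL (Fin n) F} : uInv g = uInv g' ↔ ∃ k, k * g * k⁻¹ = g' :=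
  ⟨exists_conj_of_uInv_eq, by rintro ⟨k, rfl⟩; rw [uInv_conj]⟩

lemma uInv_of_mul_eq_scalar {g g' : GL (Fin n) F} {l : Fˣ}
    (h : g * g' = Matrix.GeneralLinearGroup.scalar (Fin n) l) (i : ℕ) :
    uInv g' i = dual l (uInv g i) := by
  obtain ⟨r, v, a, h1, h1'⟩ := exists_decomp_uInv g
  have h2 : Decomp (lin g') (fun j => dual l (v j)) a := h1.dual l fun x => by
    rw [← Module.End.mul_apply, ← lin_mul, h, lin_scalar_apply]
  rw [uInv_eq h2, h1', partProd, partProd, dual_prod]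

lemma uInv_inv (g : GL (Fin n) F) (i : ℕ) : uInv g⁻¹ i = dual 1 (uInv g i) :=
  uInv_of_mul_eq_scalar (by rw [mul_inv_cancel, map_one]) i

/-- Since `g⁻¹ * (c g) = c`, the effect of a scalar is the composite of `dual 1` and `dual c`, which
is a scaling. -/
lemma uInv_scalar_mul (c : Fˣ) (g : GL (Fin n) F) (i : ℕ) :
    uInv (Matrix.GeneralLinearGroup.scalar (Fin n) c * g) i = scale c (uInv g i) := by
  have hc : g⁻¹ * (Matrix.GeneralLinearGroup.scalar (Fin n) c * g) =
      Matrix.GeneralLinearGroup.scalar (Fin n) c := by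
    have : Matrix.GeneralLinearGroup.scalar (Fin n) c * g =
        g * Matrix.GeneralLinearGroup.scalar (Fin n) c := by
      ext i j
      simp [mul_comm]
    rw [this, inv_mul_cancel_left]
  rw [uInv_of_mul_eq_scalar hc, uInv_inv, dual_dual_eq_scale _ _ (uInv_coeff_zero g i), div_one]

lemma uInv_scalar_mul_inv (l : Fˣ) (g : GL (Fin n) F) (i : ℕ) :
    uInv (Matrix.GeneralLinearGroup.scalar (Fin n) l * g⁻¹) i = dual l (uInv g i) := by
  rw [uInv_scalar_mul, uInv_inv, dual_eq_scale_dual l 1 (uInv_coeff_zero g i), div_one]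

/-- The type of a matrix is given by the degrees of the `u_i`. -/
lemma hasType_iff {g : GL (Fin n) F} {ν : n.Partition} :
    HasType g ν ↔ ∀ i, (uInv g i).natDegree = mult ν i := by
  constructor
  · rintro ⟨r, f, a, hfa, hdeg⟩ i
    obtain ⟨E⟩ := hfa.equiv
    obtain ⟨e, he⟩ := exists_intertwining_of_directSum (φ := lin g) (w := fun j => f j ^ a j) E
    obtain ⟨h0, hd⟩ := decomp_of_intertwining (lin_apply_injective g) hfa.irreducible hfa.pos e he
    rw [← hdeg, uInv_eq hd, partProd, uPoly, Finset.prod_mul_distrib, ← map_prod,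
      coeff_zero_prod, Finset.prod_inv_distrib]
  · intro h
    obtain ⟨r, v, a, h1, h1'⟩ := exists_decomp_uInv g
    have hl : ∀ j, (v j).leadingCoeff ≠ 0 := fun j =>
      leadingCoeff_ne_zero.mpr (h1.irreducible j).ne_zero
    obtain ⟨e, he⟩ := h1.equiv
    obtain ⟨e', he'⟩ := intertwining_congr
      (fun j => (associated_C_mul (inv_ne_zero (hl j)) (v j)).pow_pow (n := a j)) e he
    refine ⟨r, fun j => C (v j).leadingCoeff⁻¹ * v j, a, ⟨fun j => ?_, fun j => ?_, h1.pos,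
      nonempty_directSum_of_intertwining (φ := lin g) e' he'⟩, fun i => ?_⟩
    · rw [mul_comm]; exact monic_mul_leadingCoeff_inv (h1.irreducible j).ne_zero
    · exact (associated_C_mul (inv_ne_zero (hl j)) (v j)).irreducible (h1.irreducible j)
    · rw [← h i, h1', uPoly, partProd, Finset.prod_mul_distrib, ← map_prod, coeff_C_mul,
        prod_coeff_zero _ fun j _ => h1.coeff_zero j, mul_one, ← mul_assoc, ← C_mul,
        inv_mul_cancel₀ (Finset.prod_ne_zero_iff.mpr fun j _ => inv_ne_zero (hl j)), C_1, one_mul]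

end GeneralLinear

end RealPSL

end

noncomputable section

namespace RealPSL

/-! ### Polynomials fixed by `dual l` and their signs. -/

section SelfReciprocalPolynomials

variable {F : Type*} [Field F]

lemma map_dual_one {E : Type*} [Field E] (i : F →+* E) (u : F[X]) :
    (dual 1 u).map i = dual 1 (u.map i) := by
  ext k
  rw [coeff_map]
  by_cases hk : k ≤ u.natDegree
  · rw [coeff_dual _ _ hk, coeff_dual _ _ (by rwa [natDegree_map]), natDegree_map, coeff_map,
      leadingCoeff_map]
    simp
  · push Not at hk
    rw [coeff_dual_of_lt _ _ hk, coeff_dual_of_lt _ _ (by rwa [natDegree_map]), map_zero]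

lemma dual_one_C {c : F} (hc : c ≠ 0) : dual 1 (C c) = 1 := by
  simp [dual, reverse_C, ← C_mul, hc]

lemma dual_one_X_sub_C {c : F} (hc : c ≠ 0) : dual 1 (X - C c) = C (-c) * (X - C c⁻¹) := by
  have h0 : natDegree (X - C c) = 1 := natDegree_X_sub_C c
  ext k
  by_cases hk : k ≤ 1
  · rw [coeff_dual _ _ (by rwa [h0]), h0, (monic_X_sub_C c).leadingCoeff]
    interval_cases k <;> simp [hc, coeff_X, coeff_C]
  · push Not at hk
    rw [coeff_dual_of_lt _ _ (by rwa [h0]), coeff_C_mul, coeff_eq_zero_of_natDegree_lt, mul_zero]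
    rwa [natDegree_X_sub_C]

lemma roots_dual_one {f : F[X]} (hf : f.Splits) (h0 : f.coeff 0 = 1) :
    (dual 1 f).roots = f.roots.map (fun x => x⁻¹) := by
  have hne := ne_zero_of_coeff_zero h0
  have hr : ∀ x ∈ f.roots, x ≠ 0 := by
    rintro x hx rfl
    rw [mem_roots hne, IsRoot, ← coeff_zero_eq_eval_zero, h0] at hx
    exact one_ne_zero hx
  conv_lhs => rw [hf.eq_prod_roots]
  rw [dual_mul, dual_one_C (leadingCoeff_ne_zero.mpr hne), one_mul]
  change (dualHom 1 (f.roots.map _).prod).roots = _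
  rw [map_multiset_prod, Multiset.map_map]
  have : f.roots.map (⇑(dualHom 1) ∘ fun x => X - C x) =
      f.roots.map fun x => C (-x) * (X - C x⁻¹) :=
    Multiset.map_congr rfl fun x hx => dual_one_X_sub_C (hr x hx)
  rw [this, roots_multiset_prod, Multiset.bind_map]
  · conv_rhs => rw [← Multiset.bind_singleton]
    refine Multiset.bind_congr fun x hx => ?_
    rw [roots_C_mul _ (neg_ne_zero.mpr (hr x hx)), roots_X_sub_C]
  · intro h
    obtain ⟨x, hx, hx0⟩ := Multiset.mem_map.mp h
    rcases mul_eq_zero.mp hx0 with h' | h'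
    · exact neg_ne_zero.mpr (hr x hx) (C_eq_zero.mp h')
    · exact X_sub_C_ne_zero _ h'

/-- Self-reciprocal polynomials are the fixed points of `dual 1`. -/
lemma selfReciprocal_iff {f : F[X]} (h0 : f.coeff 0 = 1) :
    SelfReciprocal f ↔ dual 1 f = f := by
  let i := algebraMap F (AlgebraicClosure F)
  have hs : (f.map i).Splits := IsAlgClosed.splits _
  have h0' : (f.map i).coeff 0 = 1 := by rw [coeff_map, h0, map_one]
  have h1 : (f.aroots (AlgebraicClosure F)).map (fun α => α⁻¹) = (dual 1 (f.map i)).roots :=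
    (roots_dual_one hs h0').symm
  rw [SelfReciprocal, h1]
  constructor
  · intro h
    -- Over the algebraic closure, equal multisets of roots give associated polynomials; constant
    -- terms 1 then give equality, which descends to `F`.
    have hassoc : Associated (dual 1 (f.map i)) (f.map i) := by
      have hs' : (dual 1 (f.map i)).Splits := IsAlgClosed.splits _
      have e1 := hs'.eq_prod_roots
      rw [h] at e1
      rw [e1]
      conv_rhs => rw [hs.eq_prod_roots]
      refine (associated_C_mul ?_ _).symm.trans (associated_C_mul ?_ _)
      · exact leadingCoeff_ne_zero.mpr
          (ne_zero_of_coeff_zero (coeff_zero_dual 1 (ne_zero_of_coeff_zero h0')))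
      · exact leadingCoeff_ne_zero.mpr (ne_zero_of_coeff_zero h0')
    have := eq_of_associated (coeff_zero_dual 1 (ne_zero_of_coeff_zero h0')) h0' hassoc
    rw [← map_dual_one] at this
    exact map_injective i i.injective this
  · intro h
    rw [← map_dual_one, h]

/-- The polynomials of degree `d` with constant term `1` which are fixed by `dual l`. -/
abbrev FixedPoly (F : Type*) [Field F] (l : Fˣ) (d : ℕ) : Type _ :=
  {p : F[X] // (p.natDegree = d ∧ p.coeff 0 = 1) ∧ dual l p = p}

lemma nqd_eq (d : ℕ) : nqd F d = Nat.card (FixedPoly F 1 d) := by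
  refine Nat.card_congr (Equiv.subtypeEquivRight fun p => ?_)
  rw [← coeff_zero_eq_eval_zero, and_assoc]
  constructor
  · rintro ⟨h1, h2, h3⟩; exact ⟨h1, h2, (selfReciprocal_iff h2).mp h3⟩
  · rintro ⟨h1, h2, h3⟩; exact ⟨h1, h2, (selfReciprocal_iff h2).mpr h3⟩

lemma finite_polyOfDegree [Finite F] (d : ℕ) :
    Finite {p : F[X] // p.natDegree = d ∧ p.coeff 0 = 1} := by
  refine Finite.of_injective (β := Fin (d + 1) → F) (fun p j => p.1.coeff j) fun p q h => ?_
  refine Subtype.ext (Polynomial.ext fun k => ?_)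
  by_cases hk : k < d + 1
  · exact congrFun h ⟨k, hk⟩
  · rw [coeff_eq_zero_of_natDegree_lt, coeff_eq_zero_of_natDegree_lt]
    · rw [q.2.1]; omega
    · rw [p.2.1]; omega

instance [Finite F] (l : Fˣ) (d : ℕ) : Finite (FixedPoly F l d) := by
  have := finite_polyOfDegree (F := F) d
  exact Finite.of_injective
    (β := {p : F[X] // p.natDegree = d ∧ p.coeff 0 = 1}) (fun p => ⟨p.1, p.2.1⟩)
    fun p q h => Subtype.ext (congrArg (fun x => x.1) h)

/-- The sign of a polynomial fixed by `dual l`, for `l = 1` or even degree. -/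
def sgn (l : Fˣ) (p : F[X]) : F :=
  (-1) ^ p.natDegree * p.leadingCoeff * (l : F) ^ (p.natDegree / 2)

/-- Comparing the leading coefficients of `p` and `dual l p` shows that the square of the leading
coefficient times `l ^ d` is 1. -/
lemma sgn_sq {l : Fˣ} {d : ℕ} (hl : l = 1 ∨ Even d) (p : FixedPoly F l d) :
    sgn l p.1 ^ 2 = 1 := by
  have h1 := leadingCoeff_dual l p.2.1.2
  rw [p.2.2] at h1
  have hne : p.1.leadingCoeff ≠ 0 := leadingCoeff_ne_zero.mpr (ne_zero_of_coeff_zero p.2.1.2)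
  have h2 : p.1.leadingCoeff ^ 2 * (l : F) ^ p.1.natDegree = 1 := by
    rw [sq]; nth_rewrite 2 [h1]
    have := l.ne_zero
    rw [inv_pow]
    field_simp
  rw [sgn, mul_pow, mul_pow, ← pow_mul, mul_comm _ 2, pow_mul, neg_one_sq, one_pow, one_mul,
    ← pow_mul, p.2.1.1] at *
  rcases hl with rfl | hd
  · simpa using h2
  · rwa [Nat.div_mul_cancel hd.two_dvd]

/-- The coefficients of a polynomial fixed by `dual l` of degree `2 k`. -/
lemma coeff_of_sgn {l : Fˣ} {k : ℕ} {p : F[X]} {e : F} (he : e ^ 2 = 1)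
    (hd : p.natDegree = 2 * k) (hl : p.leadingCoeff * (l : F) ^ k = e) (hp : dual l p = p) {m : ℕ}
    (hm : m ≤ 2 * k) : p.coeff m * (l : F) ^ m = e * (l : F) ^ k * p.coeff (2 * k - m) := by
  have h1 := coeff_dual l p (k := m) (by rwa [hd])
  rw [hp, hd] at h1
  have hl0 := l.ne_zero
  have hne : p.leadingCoeff ≠ 0 := by
    rintro h
    rw [h, zero_mul] at hl
    simp [← hl] at he
  have h3 : p.leadingCoeff⁻¹ = e * (l : F) ^ k := by
    refine inv_eq_of_mul_eq_one_right ?_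
    linear_combination e * hl + he
  rw [h1, h3, inv_pow]
  field_simp

/-- A polynomial of degree `2 k` with constant term `1` fixed by `dual l`. -/
def palindrome (l : Fˣ) (k t : ℕ) (e : F) (c : Fin t → F) : F[X] :=
  ∑ m ∈ Finset.range (2 * k + 1), monomial m
    (if m = 0 then 1 else if h : m - 1 < t then c ⟨m - 1, h⟩ else if m ≤ k then 0 else
      e * ((l : F)⁻¹) ^ (m - k) * (if 2 * k - m = 0 then 1 else
        if h : 2 * k - m - 1 < t then c ⟨2 * k - m - 1, h⟩ else 0))

lemma coeff_palindrome (l : Fˣ) (k t : ℕ) (e : F) (c : Fin t → F) (m : ℕ) (hm : m ≤ 2 * k) :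
    (palindrome l k t e c).coeff m =
    (if m = 0 then 1 else if h : m - 1 < t then c ⟨m - 1, h⟩ else if m ≤ k then 0 else
      e * ((l : F)⁻¹) ^ (m - k) * (if 2 * k - m = 0 then 1 else
        if h : 2 * k - m - 1 < t then c ⟨2 * k - m - 1, h⟩ else 0)) := by
  simp only [palindrome, finsetSum_coeff, coeff_monomial]
  rw [Finset.sum_ite_eq' (Finset.range (2 * k + 1)) m, if_pos (by simp; omega)]

lemma coeff_palindrome_gt (l : Fˣ) (k t : ℕ) (e : F) (c : Fin t → F) (m : ℕ) (hm : 2 * k < m) :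
    (palindrome l k t e c).coeff m = 0 := by
  simp only [palindrome, finsetSum_coeff, coeff_monomial]
  rw [Finset.sum_ite_eq' (Finset.range (2 * k + 1)) m, if_neg (by simp; omega)]

/-- The coefficients below the middle determine those above it, by `coeff_of_sgn`. The middle
coefficient is free for sign `1` and must vanish for sign `-1`. As the constant term is 1, there
remain `k` or `k - 1` free coefficients, in degrees `1, …, t`. -/
lemma card_fixedPoly_sgn (h2 : (2 : F) ≠ 0) (l : Fˣ) {k t : ℕ} (hk : 0 < k) {e : F}
    (het : (e = 1 ∧ t = k) ∨ (e = -1 ∧ t + 1 = k)) :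
    Nat.card {p : FixedPoly F l (2 * k) // sgn l p.1 = e} = Nat.card (Fin t → F) := by
  have he : e ^ 2 = 1 := by rcases het with ⟨rfl, -⟩ | ⟨rfl, -⟩ <;> ring
  have he0 : e ≠ 0 := by rintro rfl; simp at he
  have hl0 := l.ne_zero
  have hsgn : ∀ p : F[X], p.natDegree = 2 * k → sgn l p = p.leadingCoeff * (l : F) ^ k := by
    intro p hp
    rw [sgn, hp, pow_mul, neg_one_sq, one_pow, one_mul, Nat.mul_div_cancel_left _ two_pos]
  refine Nat.card_congr (Equiv.ofBijective (fun p j => p.1.1.coeff (j + 1)) ⟨?_, ?_⟩)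
  · rintro ⟨⟨p, ⟨hp1, hp2⟩, hp3⟩, hp4⟩ ⟨⟨q, ⟨hq1, hq2⟩, hq3⟩, hq4⟩ h
    rw [hsgn p hp1] at hp4
    rw [hsgn q hq1] at hq4
    refine Subtype.ext (Subtype.ext (Polynomial.ext fun m => ?_))
    have hpc : ∀ m ≤ 2 * k, _ := fun m hm => coeff_of_sgn he hp1 hp4 hp3 hm
    have hqc : ∀ m ≤ 2 * k, _ := fun m hm => coeff_of_sgn he hq1 hq4 hq3 hm
    have hlow : ∀ m ≤ k, p.coeff m = q.coeff m := by
      intro m hm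
      rcases Nat.eq_zero_or_pos m with rfl | hm0
      · rw [hp2, hq2]
      by_cases hmt : m - 1 < t
      · have := congrFun h ⟨m - 1, hmt⟩
        simpa [Nat.sub_add_cancel hm0] using this
      · rcases het with ⟨rfl, rfl⟩ | ⟨rfl, rfl⟩
        · omega
        -- Here `m` is the middle degree, and the sign `-1` makes the coefficient equal to its own
        -- negative.
        · obtain rfl : m = t + 1 := by omega
          have hz : ∀ r : F, r * (l : F) ^ (t + 1) = -1 * (l : F) ^ (t + 1) * r → r = 0 := by
            intro r hr
            have : 2 * (l : F) ^ (t + 1) * r = 0 := by linear_combination hr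
            exact (mul_eq_zero.mp this).resolve_left (mul_ne_zero h2 (pow_ne_zero _ hl0))
          have e1 := hpc (t + 1) (by omega)
          have e2 := hqc (t + 1) (by omega)
          rw [show 2 * (t + 1) - (t + 1) = t + 1 by omega] at e1 e2
          rw [hz _ e1, hz _ e2]
    by_cases hm : m ≤ k
    · exact hlow m hm
    by_cases hm' : m ≤ 2 * k
    · have e1 := hpc m hm'
      have e2 := hqc m hm'
      rw [hlow (2 * k - m) (by omega), ← e2] at e1
      exact mul_right_cancel₀ (pow_ne_zero _ hl0) e1
    · exact (coeff_eq_zero_of_natDegree_lt (p := p) (by omega)).trans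
        (coeff_eq_zero_of_natDegree_lt (p := q) (by omega)).symm
  · intro c
    let p := palindrome l k t e c
    have hc := coeff_palindrome l k t e c
    have hlead : p.coeff (2 * k) = e * ((l : F)⁻¹) ^ k := by
      rw [hc _ le_rfl, if_neg (by omega), dif_neg (by omega), if_neg (by omega), if_pos (by omega)]
      rw [show 2 * k - k = k by omega, mul_one]
    have hdeg : p.natDegree = 2 * k := by
      refine natDegree_eq_of_le_of_coeff_ne_zero ?_ ?_
      · rw [natDegree_le_iff_coeff_eq_zero]
        exact fun m hm => coeff_palindrome_gt l k t e c m hm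
      · rw [hlead]
        exact mul_ne_zero he0 (pow_ne_zero _ (inv_ne_zero hl0))
    have h0 : p.coeff 0 = 1 := by rw [hc _ (Nat.zero_le _), if_pos rfl]
    have hld : p.leadingCoeff = e * ((l : F)⁻¹) ^ k := by rw [leadingCoeff, hdeg, hlead]
    have hlow : ∀ m ≤ k, p.coeff m =
        if m = 0 then 1 else if h : m - 1 < t then c ⟨m - 1, h⟩ else 0 := by
      intro m hm
      rw [hc _ (by omega)]
      split_ifs <;> rfl
    have hhigh : ∀ m ≤ k, p.coeff (2 * k - m) = e * ((l : F)⁻¹) ^ (k - m) * p.coeff m := by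
      intro m hm
      rcases Nat.lt_or_ge m k with hmk | hmk
      · rw [hlow m hm, hc _ (by omega), if_neg (by omega), dif_neg (by omega), if_neg (by omega),
          show 2 * k - (2 * k - m) = m by omega, show 2 * k - m - k = k - m by omega]
      · obtain rfl : m = k := by omega
        rw [show 2 * m - m = m by omega, Nat.sub_self, pow_zero, mul_one]
        rcases het with ⟨rfl, rfl⟩ | ⟨rfl, rfl⟩
        · rw [one_mul]
        · rw [hlow _ le_rfl, if_neg (by omega), dif_neg (by omega), mul_zero]
    have hdual : dual l p = p := by
      ext m
      by_cases hm : m ≤ 2 * k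
      · rw [coeff_dual _ _ (by rwa [hdeg]), hdeg, hld]
        have hinv : (e * ((l : F)⁻¹) ^ k)⁻¹ = e * (l : F) ^ k := by
          rw [inv_pow]
          field_simp
          linear_combination -he
        rw [hinv]
        rcases le_total m k with hmk | hmk
        · rw [hhigh m hmk]
          have h3 : (l : F) ^ k * ((l : F)⁻¹) ^ (k - m) * ((l : F)⁻¹) ^ m = 1 := by
            rw [mul_assoc, ← pow_add, Nat.sub_add_cancel hmk, ← mul_pow, mul_inv_cancel₀ hl0,
              one_pow]
          linear_combination (e ^ 2 * p.coeff m) * h3 + p.coeff m * he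
        · obtain ⟨m', rfl⟩ : ∃ m', m = 2 * k - m' := ⟨2 * k - m, by omega⟩
          have hm' : m' ≤ k ∨ 2 * k ≤ m' := by omega
          rcases hm' with hm' | hm'
          · rw [show 2 * k - (2 * k - m') = m' by omega, hhigh m' hm']
            have h3 : (l : F) ^ k * ((l : F)⁻¹) ^ (2 * k - m') = ((l : F)⁻¹) ^ (k - m') := by
              rw [show 2 * k - m' = k + (k - m') by omega, pow_add, ← mul_assoc, ← mul_pow,
                mul_inv_cancel₀ hl0, one_pow, one_mul]
            linear_combination (e * p.coeff m') * h3
          · exfalso; omega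
      · rw [coeff_dual_of_lt _ _ (by omega), coeff_eq_zero_of_natDegree_lt (by omega)]
    refine ⟨⟨⟨p, ⟨hdeg, h0⟩, hdual⟩, ?_⟩, ?_⟩
    · rw [hsgn p hdeg, hld, mul_assoc, ← mul_pow, inv_mul_cancel₀ hl0, one_pow, mul_one]
    · funext j
      have hj := j.2
      have htk : t ≤ k := by omega
      change p.coeff (j + 1) = c j
      rw [hlow _ (by omega), if_neg (by omega), dif_pos (by omega)]
      rfl

/-- Substituting `-X` for `X` commutes with `dual 1` and reverses the sign in odd degree. -/
lemma card_fixedPoly_odd {d : ℕ} (hd : Odd d) :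
    Nat.card {p : FixedPoly F 1 d // sgn 1 p.1 = 1} =
      Nat.card {p : FixedPoly F 1 d // sgn 1 p.1 = -1} := by
  have hs : ∀ p : F[X], p.natDegree = d → sgn 1 (scale (-1) p) = -sgn 1 p := by
    intro p hp
    rw [sgn, sgn, natDegree_scale, leadingCoeff_scale, hp]
    simp [hd.neg_one_pow, inv_neg]
  have hm : ∀ p : FixedPoly F 1 d, ((scale (-1) p.1).natDegree = d ∧
      (scale (-1) p.1).coeff 0 = 1) ∧ dual 1 (scale (-1) p.1) = scale (-1) p.1 := by
    intro p
    refine ⟨⟨by rw [natDegree_scale, p.2.1.1], by rw [coeff_zero_scale, p.2.1.2]⟩, ?_⟩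
    rw [dual_scale _ _ p.2.1.2, dual_eq_scale_dual (1 / -1) 1 p.2.1.2, p.2.2]
    congr 1
    rw [div_one]
    apply Units.ext; simp [inv_neg]
  have hss : ∀ p : F[X], scale (-1) (scale (-1) p) = p := by
    intro p
    rw [← scale_mul]; simp [scale_one]
  refine Nat.card_congr
    ⟨fun p => ⟨⟨scale (-1) p.1.1, hm p.1⟩, by rw [hs _ p.1.2.1.1, p.2]⟩,
      fun p => ⟨⟨scale (-1) p.1.1, hm p.1⟩, by rw [hs _ p.1.2.1.1, p.2, neg_neg]⟩, ?_, ?_⟩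
  · intro p; exact Subtype.ext (Subtype.ext (hss _))
  · intro p; exact Subtype.ext (Subtype.ext (hss _))

end SelfReciprocalPolynomials

end RealPSL

end

noncomputable section

namespace RealPSL

/-! ### Counting sign patterns by a character sum. -/

section SignCount

/-- The number of tuples whose signs have product `1`, as a character sum. -/
lemma two_mul_card_prod_eq_one {I : Type*} [Fintype I] {X : I → Type*} [∀ i, Fintype (X i)]
    (σ : ∀ i, X i → ℤ) (hσ : ∀ i x, σ i x = 1 ∨ σ i x = -1) :
    2 * (Nat.card {x : ∀ i, X i // ∏ i, σ i (x i) = 1} : ℤ) =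
      ∏ i, (Nat.card (X i) : ℤ) + ∏ i, ∑ x, σ i x := by
  classical
  have h1 : ∀ x : ∀ i, X i, ∏ i, σ i (x i) = 1 ∨ ∏ i, σ i (x i) = -1 := by
    intro x
    refine Finset.prod_induction _ (fun z : ℤ => z = 1 ∨ z = -1) ?_ (Or.inl rfl) fun i _ => hσ i _
    rintro a b (rfl | rfl) (rfl | rfl) <;> simp
  rw [Nat.card_eq_fintype_card, Fintype.card_subtype, Finset.card_filter]
  push_cast
  rw [Finset.mul_sum]
  have h2 : ∀ x : ∀ i, X i, (2 * if ∏ i, σ i (x i) = 1 then 1 else 0 : ℤ) =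
      1 + ∏ i, σ i (x i) := by
    intro x
    rcases h1 x with h | h <;> rw [h] <;> norm_num
  simp only [h2]
  rw [Finset.sum_add_distrib, Finset.prod_univ_sum, Fintype.piFinset_univ]
  simp only [Finset.sum_const, Finset.card_univ, Fintype.card_pi, Nat.card_eq_fintype_card]
  simp

end SignCount

/-! ### Evaluation of the count for odd `q`. -/

section Odd

/-- The sign of a polynomial as an integer. -/
def sgnZ {F : Type*} [Field F] (l : Fˣ) (p : F[X]) : ℤ :=
  open scoped Classical in if sgn l p = 1 then 1 else -1

lemma sgnZ_eq {F : Type*} [Field F] (l : Fˣ) (p : F[X]) : sgnZ l p = 1 ∨ sgnZ l p = -1 := by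
  rw [sgnZ]; split_ifs <;> simp

variable {F : Type*} [Field F] [Fintype F]

lemma two_ne_zero_of_odd_card (hq : ¬ Even (Fintype.card F)) : (2 : F) ≠ 0 := by
  intro h
  refine hq ?_
  rw [Nat.even_iff, ← FiniteField.even_card_iff_char_two]
  exact CharP.ringChar_of_prime_eq_zero Nat.prime_two (by exact_mod_cast h)

lemma sgn_eq_one_or {F : Type*} [Field F] {l : Fˣ} {d : ℕ}
    (hl : l = 1 ∨ Even d) (p : FixedPoly F l d) :
    sgn l p.1 = 1 ∨ sgn l p.1 = -1 := by
  have h : (sgn l p.1 - 1) * (sgn l p.1 + 1) = 0 := by linear_combination sgn_sq hl p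
  rcases mul_eq_zero.mp h with h | h
  · exact Or.inl (sub_eq_zero.mp h)
  · exact Or.inr (eq_neg_of_add_eq_zero_left h)

lemma cast_sgnZ {F : Type*} [Field F] {l : Fˣ} {d : ℕ} (hl : l = 1 ∨ Even d) (p : FixedPoly F l d) :
    ((sgnZ l p.1 : ℤ) : F) = sgn l p.1 := by
  rw [sgnZ]
  split_ifs with h
  · rw [h, Int.cast_one]
  · rw [(sgn_eq_one_or hl p).resolve_left h]; simp

instance (l : Fˣ) (d : ℕ) : Fintype (FixedPoly F l d) := Fintype.ofFinite _

lemma card_eq_add (hq : ¬ Even (Fintype.card F)) {l : Fˣ} {d : ℕ} (hl : l = 1 ∨ Even d) :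
    Nat.card (FixedPoly F l d) = Nat.card {p : FixedPoly F l d // sgn l p.1 = 1} +
      Nat.card {p : FixedPoly F l d // sgn l p.1 = -1} := by
  classical
  have h2 := two_ne_zero_of_odd_card hq
  have hne : ∀ p : FixedPoly F l d, sgn l p.1 = -1 ↔ ¬ sgn l p.1 = 1 := by
    intro p
    rcases sgn_eq_one_or hl p with h | h <;> rw [h]
    · simp only [not_true_eq_false, iff_false]
      intro h'
      exact h2 (by linear_combination h')
    · simp only [true_iff]
      intro h'
      exact h2 (by linear_combination -h')
  rw [Nat.card_congr (Equiv.subtypeEquivRight hne), ← Nat.card_sum]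
  exact Nat.card_congr (Equiv.sumCompl _).symm

lemma sum_sgnZ (hq : ¬ Even (Fintype.card F)) {l : Fˣ} {d : ℕ} (hl : l = 1 ∨ Even d) :
    ∑ p : FixedPoly F l d, sgnZ l p.1 =
      (Nat.card {p : FixedPoly F l d // sgn l p.1 = 1} : ℤ) -
      Nat.card {p : FixedPoly F l d // sgn l p.1 = -1} := by
  classical
  have h1 : ∀ p : FixedPoly F l d, sgnZ l p.1 = 2 * (if sgn l p.1 = 1 then 1 else 0) - 1 := by
    intro p
    rw [sgnZ]; split_ifs <;> norm_num
  simp only [h1]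
  rw [Finset.sum_sub_distrib, ← Finset.mul_sum, ← Nat.cast_one (R := ℤ)]
  have h2 := card_eq_add hq hl
  have h3 : (∑ p : FixedPoly F l d, if sgn l p.1 = 1 then ((1 : ℕ) : ℤ) else 0) =
      Nat.card {p : FixedPoly F l d // sgn l p.1 = 1} := by
    rw [Nat.card_eq_fintype_card, Fintype.card_subtype, Finset.card_filter]
    push_cast; rfl
  rw [h3, Finset.sum_const, Finset.card_univ, ← Nat.card_eq_fintype_card, h2]
  simp only [nsmul_eq_mul]
  push_cast
  ring

lemma card_sgn_one (hq : ¬ Even (Fintype.card F)) (l : Fˣ) {k : ℕ} (hk : 0 < k) :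
    Nat.card {p : FixedPoly F l (2 * k) // sgn l p.1 = 1} = Fintype.card F ^ k := by
  rw [card_fixedPoly_sgn (two_ne_zero_of_odd_card hq) l hk (Or.inl ⟨rfl, rfl⟩)]
  simp

lemma card_sgn_neg_one (hq : ¬ Even (Fintype.card F)) (l : Fˣ) {k : ℕ} (hk : 0 < k) :
    Nat.card {p : FixedPoly F l (2 * k) // sgn l p.1 = -1} = Fintype.card F ^ (k - 1) := by
  rw [card_fixedPoly_sgn (two_ne_zero_of_odd_card hq) l hk
    (Or.inr ⟨rfl, Nat.sub_add_cancel hk⟩)]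
  simp

/-- In degree `2 k` the two signs contribute `q ^ k` and `q ^ (k - 1)` polynomials, whatever `l` is.
-/
lemma card_fixedPoly_eq_nqd (hq : ¬ Even (Fintype.card F)) {l : Fˣ} {d : ℕ} (hd : 0 < d)
    (hl : l = 1 ∨ Even d) : Nat.card (FixedPoly F l d) = nqd F d := by
  rw [nqd_eq]
  rcases hl with rfl | hl
  · rfl
  · rw [card_eq_add hq (Or.inr hl), card_eq_add hq (Or.inl rfl)]
    obtain ⟨k, rfl⟩ := hl.two_dvd
    rw [card_sgn_one hq _ (by omega), card_sgn_one hq _ (by omega),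
      card_sgn_neg_one hq _ (by omega), card_sgn_neg_one hq _ (by omega)]

variable {n : ℕ}

lemma mult_pos {ν : n.Partition} {i : ℕ} (hi : i ∈ ν.parts.toFinset) : 0 < mult ν i :=
  Multiset.count_pos.mpr (Multiset.mem_toFinset.mp hi)

lemma mult_eq_zero {ν : n.Partition} {i : ℕ} (hi : i ∉ ν.parts.toFinset) : mult ν i = 0 :=
  Multiset.count_eq_zero.mpr fun h => hi (Multiset.mem_toFinset.mpr h)

lemma zero_notMem (ν : n.Partition) : 0 ∉ ν.parts.toFinset := fun h =>
  (ν.parts_pos (Multiset.mem_toFinset.mp h)).ne' rfl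

lemma sum_mult (ν : n.Partition) : ∑ i ∈ ν.parts.toFinset, i * mult ν i = n := by
  conv_rhs => rw [← ν.parts_sum, Finset.sum_multiset_count]
  exact Finset.sum_congr rfl fun i _ => by rw [mult, smul_eq_mul, mul_comm]

/-- The tuples of self-dual polynomials whose signs have product `1` are counted by `slNu`. -/
lemma card_sgn_prod_eq_slNu (hq : ¬ Even (Fintype.card F)) (ν : n.Partition) (l : Fˣ)
    (hl : l = 1 ∨ ∀ i ∈ ν.parts.toFinset, Even (mult ν i)) :
    (Nat.card {x : ∀ i : ν.parts.toFinset, FixedPoly F l (mult ν i) //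
      ∏ i, sgnZ l (x i).1 ^ (i : ℕ) = 1} : ℚ) = slNu F ν := by
  have hl' : ∀ i ∈ ν.parts.toFinset, l = 1 ∨ Even (mult ν i) := fun i hi =>
    hl.imp_right fun h => h i hi
  have key := two_mul_card_prod_eq_one
    (X := fun i : ν.parts.toFinset => FixedPoly F l (mult ν i))
    (fun (i : ν.parts.toFinset) x => sgnZ l x.1 ^ (i : ℕ)) (by
      intro i x
      rcases sgnZ_eq l x.1 with h | h <;> simp only [h]
      · simp
      · exact neg_one_pow_eq_or ℤ _)
  have hN : ∀ i ∈ ν.parts.toFinset, Nat.card (FixedPoly F l (mult ν i)) = nqd F (mult ν i) :=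
    fun i hi => card_fixedPoly_eq_nqd hq (mult_pos hi) (hl' i hi)
  have hsq : ∀ p : F[X], sgnZ l p ^ 2 = 1 := by
    intro p
    rcases sgnZ_eq l p with h | h <;> rw [h] <;> norm_num
  have hDeven : ∀ i ∈ ν.parts.toFinset, Even i →
      ∑ x : FixedPoly F l (mult ν i), sgnZ l x.1 ^ i = (nqd F (mult ν i) : ℤ) := by
    intro i hi he
    obtain ⟨k, rfl⟩ := he.two_dvd
    rw [← hN _ hi]
    simp [pow_mul, hsq]
  have hDodd : ∀ i ∈ ν.parts.toFinset, Odd i →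
      ∑ x : FixedPoly F l (mult ν i), sgnZ l x.1 ^ i =
      (Nat.card {p : FixedPoly F l (mult ν i) // sgn l p.1 = 1} : ℤ) -
      Nat.card {p : FixedPoly F l (mult ν i) // sgn l p.1 = -1} := by
    intro i hi ho
    rw [← sum_sgnZ hq (hl' i hi)]
    refine Finset.sum_congr rfl fun x _ => ?_
    rcases sgnZ_eq l x.1 with h | h <;> rw [h]
    · rw [one_pow]
    · rw [ho.neg_one_pow]
  rw [Finset.prod_coe_sort ν.parts.toFinset fun i => (Nat.card (FixedPoly F l (mult ν i)) : ℤ),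
    Finset.prod_coe_sort ν.parts.toFinset
      fun i => ∑ x : FixedPoly F l (mult ν i), sgnZ l x.1 ^ i] at key
  have key' := congrArg (fun z : ℤ => (z : ℚ)) key
  simp only [Int.cast_mul, Int.cast_ofNat, Int.cast_natCast, Int.cast_add, Int.cast_prod] at key'
  have hgl : ∏ i ∈ ν.parts.toFinset, (Nat.card (FixedPoly F l (mult ν i)) : ℚ) = glNu F ν :=
    Finset.prod_congr rfl fun i hi => by rw [hN i hi]
  rw [hgl] at key'
  rw [slNu]
  split_ifs with h1 h2
  -- All parts are even, so the powers of the signs are all 1 and both terms of the character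
  -- formula equal `glNu`.
  · have h1 := h1.resolve_left hq
    have : ∏ i ∈ ν.parts.toFinset,
        ((∑ x : FixedPoly F l (mult ν i), sgnZ l x.1 ^ i : ℤ) : ℚ) = glNu F ν := by
      refine Finset.prod_congr rfl fun i hi => ?_
      rw [hDeven i hi, Int.cast_natCast]
      by_contra hodd
      exact (mult_pos hi).ne' (h1 i (Nat.not_even_iff_odd.mp hodd))
    rw [this] at key'
    linarith
  -- An odd part of odd multiplicity forces `l = 1`; its two signs are equally frequent, so the
  -- character sum vanishes.
  · obtain ⟨i, hi⟩ := h2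
    rw [Nat.odd_mul] at hi
    have his : i ∈ ν.parts.toFinset := by
      by_contra h
      rw [mult_eq_zero h] at hi
      exact (by decide : ¬ Odd 0) hi.2
    have hl1 : l = 1 := (hl' i his).resolve_right (Nat.not_even_iff_odd.mpr hi.2)
    have : ∏ i ∈ ν.parts.toFinset,
        ((∑ x : FixedPoly F l (mult ν i), sgnZ l x.1 ^ i : ℤ) : ℚ) = 0 := by
      refine Finset.prod_eq_zero his ?_
      rw [hDodd i his hi.1]
      subst hl1
      rw [card_fixedPoly_odd hi.2, sub_self, Int.cast_zero]
    rw [this] at key'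
    linarith
  · push Not at h2
    have hev : ∀ i ∈ ν.parts.toFinset, Odd i → ∃ k, 0 < k ∧ mult ν i = 2 * k := by
      intro i hi ho
      have := h2 i
      rw [Nat.odd_mul, not_and, Nat.not_odd_iff_even] at this
      obtain ⟨k, hk⟩ := (this ho).two_dvd
      have := mult_pos hi
      exact ⟨k, by omega, hk⟩
    have hsplit : ∀ f : ℕ → ℚ, ∏ i ∈ ν.parts.toFinset, f i =
        (∏ i ∈ ν.parts.toFinset.filter Odd, f i) * ∏ i ∈ ν.parts.toFinset.filter Even, f i := by
      intro f
      rw [← Finset.prod_filter_mul_prod_filter_not ν.parts.toFinset Odd f]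
      congr 1
      refine Finset.prod_congr (Finset.filter_congr fun i _ => Nat.not_odd_iff_even) fun _ _ => rfl
    rw [glNu, hsplit, hsplit (fun i => ((∑ x : FixedPoly F l (mult ν i), sgnZ l x.1 ^ i : ℤ) : ℚ))]
      at key'
    have e1 : ∏ i ∈ ν.parts.toFinset.filter Even,
        ((∑ x : FixedPoly F l (mult ν i), sgnZ l x.1 ^ i : ℤ) : ℚ) =
        ∏ i ∈ ν.parts.toFinset.filter Even, (nqd F (mult ν i) : ℚ) := by
      refine Finset.prod_congr rfl fun i hi => ?_
      obtain ⟨hi1, hi2⟩ := Finset.mem_filter.mp hi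
      rw [hDeven i hi1 hi2, Int.cast_natCast]
    -- For multiplicity `2 k` the difference of the sign counts is `(q - 1) q ^ (k - 1)`. Their sum,
    -- used in `e3`, is `(q + 1) q ^ (k - 1)`, and together they produce `fNu`.
    have e2 : ∏ i ∈ ν.parts.toFinset.filter Odd,
        ((∑ x : FixedPoly F l (mult ν i), sgnZ l x.1 ^ i : ℤ) : ℚ) =
        ((Fintype.card F : ℚ) - 1) ^ rNu ν *
          ∏ i ∈ ν.parts.toFinset.filter Odd, (Fintype.card F : ℚ) ^ (mult ν i / 2 - 1) := by
      rw [rNu, ← Finset.prod_const, ← Finset.prod_mul_distrib]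
      refine Finset.prod_congr rfl fun i hi => ?_
      obtain ⟨hi1, hi2⟩ := Finset.mem_filter.mp hi
      rw [hDodd i hi1 hi2]
      obtain ⟨k, hk, hik⟩ := hev i hi1 hi2
      rw [hik, card_sgn_one hq l hk, card_sgn_neg_one hq l hk, Nat.mul_div_cancel_left _ two_pos]
      obtain ⟨k, rfl⟩ := Nat.exists_eq_succ_of_ne_zero hk.ne'
      push_cast
      simp only [Nat.succ_eq_add_one]
      ring
    have e3 : ∏ i ∈ ν.parts.toFinset.filter Odd, (nqd F (mult ν i) : ℚ) =
        ((Fintype.card F : ℚ) + 1) ^ rNu ν *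
          ∏ i ∈ ν.parts.toFinset.filter Odd, (Fintype.card F : ℚ) ^ (mult ν i / 2 - 1) := by
      rw [rNu, ← Finset.prod_const, ← Finset.prod_mul_distrib]
      refine Finset.prod_congr rfl fun i hi => ?_
      obtain ⟨hi1, hi2⟩ := Finset.mem_filter.mp hi
      rw [← hN i hi1, card_eq_add hq (hl' i hi1)]
      obtain ⟨k, hk, hik⟩ := hev i hi1 hi2
      rw [hik, card_sgn_one hq l hk, card_sgn_neg_one hq l hk, Nat.mul_div_cancel_left _ two_pos]
      obtain ⟨k, rfl⟩ := Nat.exists_eq_succ_of_ne_zero hk.ne'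
      push_cast
      simp only [Nat.succ_eq_add_one]
      ring
    rw [e1, e2, e3] at key'
    rw [fNu]
    linear_combination key' / 2

end Odd

end RealPSL

end

noncomputable section

namespace RealPSL

/-! ### Reduction of class conditions to representatives. -/

section ConjugacyClasses

lemma forall_mem_carrier_iff {G : Type*} [Group G] {P : G → Prop}
    (hP : ∀ x k, P x → P (k * x * k⁻¹)) (x : G) :
    (∀ y ∈ (ConjClasses.mk x).carrier, P y) ↔ P x := by
  constructor
  · intro h
    exact h x ConjClasses.mem_carrier_mk
  · intro h y hy
    rw [ConjClasses.mem_carrier_iff_mk_eq, ConjClasses.mk_eq_mk_iff_isConj] at hy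
    obtain ⟨k, rfl⟩ := isConj_iff.mp hy.symm
    exact hP _ k h

lemma IsReal.conj {G : Type*} [Group G] {x : G} (h : IsReal x) (k : G) :
    IsReal (k * x * k⁻¹) := by
  obtain ⟨m, hm⟩ := h
  refine ⟨k * m * k⁻¹, ?_⟩
  have : k * m * k⁻¹ * (k * x * k⁻¹) * (k * m * k⁻¹)⁻¹ = k * (m * x * m⁻¹) * k⁻¹ := by group
  rw [this, hm]
  group

end ConjugacyClasses

/-! ### Real classes of `PGL_n` as orbits, and Burnside's lemma. -/

section ProjectiveLinear

variable {F : Type*} [Field F] {n : ℕ}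

/-- The scalar matrix `c`. -/
abbrev scal (n : ℕ) {F : Type*} [Field F] (c : Fˣ) : GL (Fin n) F :=
  Matrix.GeneralLinearGroup.scalar (Fin n) c

/-- The projection from `GL_n` to `PGL_n`. -/
abbrev toPGL (g : GL (Fin n) F) : Matrix.ProjGenLinGroup (Fin n) F := Matrix.ProjGenLinGroup.mk g

lemma toPGL_eq_iff {g g' : GL (Fin n) F} : toPGL g = toPGL g' ↔ ∃ c, scal n c * g = g' := by
  rw [Matrix.ProjGenLinGroup.mk_eq_mk_iff]
  exact exists_congr fun c => by rw [Matrix.GeneralLinearGroup.scalar_commute c g]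

lemma toPGL_scal_mul (c : Fˣ) (g : GL (Fin n) F) : toPGL (scal n c * g) = toPGL g := by
  simp

lemma det_scal (c : Fˣ) : (scal n c).det = c ^ n := by simp

lemma exists_toGL_eq {g : GL (Fin n) F} (h : g.det = 1) :
    ∃ s : Matrix.SpecialLinearGroup (Fin n) F, Matrix.SpecialLinearGroup.toGL s = g := by
  have h' : (g : Matrix (Fin n) (Fin n) F).det = 1 := by
    rw [← Matrix.GeneralLinearGroup.val_det_apply, h, Units.val_one]
  exact ⟨⟨g, h'⟩, by ext; rfl⟩

lemma det_toGL (s : Matrix.SpecialLinearGroup (Fin n) F) :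
    (Matrix.SpecialLinearGroup.toGL s).det = 1 := by
  apply Units.ext
  rw [Matrix.GeneralLinearGroup.val_det_apply]
  exact s.2

/-- A matrix can be scaled into `SL_n` iff its determinant is the determinant `c ^ n` of a scalar
matrix. -/
lemma toPGL_mem_range_iff {g : GL (Fin n) F} :
    toPGL g ∈ Set.range (Matrix.ProjectiveSpecialLinearGroup.toPGL :
      Matrix.ProjectiveSpecialLinearGroup (Fin n) F → Matrix.ProjGenLinGroup (Fin n) F) ↔
      ∃ c : Fˣ, g.det = c ^ n := by
  constructor
  · rintro ⟨x, hx⟩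
    obtain ⟨s, rfl⟩ := QuotientGroup.mk_surjective x
    rw [Matrix.ProjectiveSpecialLinearGroup.toPGL_mk, toPGL_eq_iff] at hx
    obtain ⟨c, rfl⟩ := hx
    exact ⟨c, by rw [map_mul, det_toGL, det_scal, mul_one]⟩
  · rintro ⟨c, hc⟩
    have : (scal n c⁻¹ * g).det = 1 := by rw [map_mul, det_scal, hc, inv_pow, inv_mul_cancel]
    obtain ⟨s, hs⟩ := exists_toGL_eq this
    refine ⟨QuotientGroup.mk s, ?_⟩
    rw [Matrix.ProjectiveSpecialLinearGroup.toPGL_mk, hs]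
    exact toPGL_scal_mul _ _

/-- The determinant of a matrix of type `ν` in terms of the polynomials `u_i`. -/
def detU (ν : n.Partition) (u : ℕ → F[X]) : F :=
  ∏ i ∈ ν.parts.toFinset, ((-1) ^ (u i).natDegree * (u i).leadingCoeff⁻¹) ^ i

lemma detU_eq {g : GL (Fin n) F} {ν : n.Partition} (h : ∀ i, (uInv g i).natDegree = mult ν i) :
    detU ν (uInv g) = (g.det : F) :=
  (det_eq_prod_uInv g fun i hi => by rw [h, mult_eq_zero hi]).symm

lemma detU_scale {ν : n.Partition} {u : ℕ → F[X]} (h : ∀ i, (u i).natDegree = mult ν i) (c : Fˣ) :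
    detU ν (fun i => scale c (u i)) = (c : F) ^ n * detU ν u := by
  have h1 : (c : F) ^ n = ∏ i ∈ ν.parts.toFinset, (c : F) ^ (i * mult ν i) := by
    rw [Finset.prod_pow_eq_pow_sum, sum_mult]
  rw [h1, detU, detU, ← Finset.prod_mul_distrib]
  refine Finset.prod_congr rfl fun i _ => ?_
  rw [natDegree_scale, leadingCoeff_scale, h i, mul_comm i, pow_mul, ← mul_pow, mul_inv, inv_pow,
    inv_inv]
  ring

/-- The tuples of polynomials fixed by `dual l` with the determinant of an element of `PSL_n`. -/
abbrev DualTuple (l : Fˣ) (ν : n.Partition) : Type _ :=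
  {u : ℕ → F[X] // (∀ i, ((u i).natDegree = mult ν i ∧ (u i).coeff 0 = 1) ∧ dual l (u i) = u i) ∧
    ∃ c : Fˣ, detU ν u = (c : F) ^ n}

/-- The tuples of polynomials of the real elements of type `ν` of `PSL_n`. -/
abbrev RealTuple (F : Type*) [Field F] (ν : n.Partition) : Type _ :=
  {u : ℕ → F[X] // (∀ i, (u i).natDegree = mult ν i ∧ (u i).coeff 0 = 1) ∧
    (∃ l : Fˣ, ∀ i, dual l (u i) = u i) ∧ ∃ c : Fˣ, detU ν u = (c : F) ^ n}

instance (ν : n.Partition) : MulAction Fˣ (RealTuple F ν) where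
  smul c u := ⟨fun i => scale c (u.1 i), by
    refine ⟨fun i => ⟨by rw [natDegree_scale, (u.2.1 i).1],
      by rw [coeff_zero_scale, (u.2.1 i).2]⟩, ?_, ?_⟩
    · obtain ⟨l, hl⟩ := u.2.2.1
      -- If the roots `α` are permuted by `l / α`, then the roots `c α` are permuted by `c ^ 2 l /
      -- (c α)`.
      refine ⟨c ^ 2 * l, fun i => ?_⟩
      rw [dual_scale _ _ (u.2.1 i).2, dual_eq_scale_dual _ l (u.2.1 i).2, hl]
      congr 1
      rw [sq, mul_assoc, mul_div_cancel_left, mul_div_assoc, div_self', mul_one]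
    · obtain ⟨d, hd⟩ := u.2.2.2
      refine ⟨c * d, ?_⟩
      rw [detU_scale (fun i => (u.2.1 i).1), hd, Units.val_mul, mul_pow]⟩
  one_smul u := Subtype.ext (funext fun i => scale_one _)
  mul_smul c d u := Subtype.ext (funext fun i => scale_mul c d _)

lemma smul_val (ν : n.Partition) (c : Fˣ) (u : RealTuple F ν) (i : ℕ) :
    (c • u).1 i = scale c (u.1 i) := rfl

variable [Fintype F]

/-- Reality in `PGL_n` means that `g` is conjugate in `GL_n` to some `l g⁻¹`, whose polynomials are
the `dual l` of those of `g`. -/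
lemma isReal_toPGL_iff {g : GL (Fin n) F} :
    IsReal (toPGL g) ↔ ∃ l : Fˣ, ∀ i, dual l (uInv g i) = uInv g i := by
  have key : ∀ l : Fˣ, (∀ i, dual l (uInv g i) = uInv g i) ↔ ∃ k, k * g * k⁻¹ = scal n l * g⁻¹ := by
    intro l
    rw [← uInv_eq_iff, funext_iff]
    exact forall_congr' fun i => by rw [uInv_scalar_mul_inv, eq_comm]
  simp only [key]
  constructor
  · rintro ⟨k, hk⟩
    obtain ⟨k, rfl⟩ := Matrix.ProjGenLinGroup.mk_surjective k
    have h1 : toPGL g⁻¹ = toPGL (k * g * k⁻¹) := by simp only [map_mul, map_inv]; exact hk.symm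
    obtain ⟨l, hl⟩ := toPGL_eq_iff.mp h1
    exact ⟨l, k, hl.symm⟩
  · rintro ⟨l, k, hk⟩
    refine ⟨toPGL k, ?_⟩
    rw [← map_mul, ← map_inv, ← map_mul, hk]
    exact (toPGL_scal_mul l g⁻¹).trans (map_inv _ _)

lemma conj_toPGL_iff {g g' : GL (Fin n) F} :
    ConjClasses.mk (toPGL g) = ConjClasses.mk (toPGL g') ↔
      ∃ c : Fˣ, ∀ i, scale c (uInv g i) = uInv g' i := by
  rw [ConjClasses.mk_eq_mk_iff_isConj, isConj_iff]
  constructor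
  · rintro ⟨k, hk⟩
    obtain ⟨k, rfl⟩ := Matrix.ProjGenLinGroup.mk_surjective k
    have h1 : toPGL (k * g * k⁻¹) = toPGL g' := by simp only [map_mul, map_inv]; exact hk
    obtain ⟨c, hc⟩ := toPGL_eq_iff.mp h1
    refine ⟨c, fun i => ?_⟩
    rw [← hc, uInv_scalar_mul, uInv_conj]
  · rintro ⟨c, hc⟩
    have : uInv (scal n c * g) = uInv g' := funext fun i => by rw [uInv_scalar_mul, hc]
    obtain ⟨k, hk⟩ := uInv_eq_iff.mp this
    refine ⟨toPGL k, ?_⟩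
    rw [← hk, ← toPGL_scal_mul c g, ← map_inv, ← map_mul, ← map_mul]

lemma pglHasType_iff {g : GL (Fin n) F} {ν : n.Partition} :
    PGLHasType (toPGL g) ν ↔ ∀ i, (uInv g i).natDegree = mult ν i := by
  constructor
  · rintro ⟨g', hg', ht⟩ i
    obtain ⟨c, rfl⟩ := toPGL_eq_iff.mp hg'
    rw [uInv_scalar_mul, natDegree_scale]
    exact hasType_iff.mp ht i
  · intro h
    exact ⟨g, rfl, hasType_iff.mpr h⟩

lemma PGLHasType.conj {x : Matrix.ProjGenLinGroup (Fin n) F} {ν : n.Partition}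
    (h : PGLHasType x ν) (k : Matrix.ProjGenLinGroup (Fin n) F) : PGLHasType (k * x * k⁻¹) ν := by
  obtain ⟨g, rfl⟩ := Matrix.ProjGenLinGroup.mk_surjective x
  obtain ⟨k, rfl⟩ := Matrix.ProjGenLinGroup.mk_surjective k
  rw [pglHasType_iff] at h
  rw [← map_inv, ← map_mul, ← map_mul, pglHasType_iff, uInv_conj]
  exact h

/-- The conditions on the classes counted by `numRealPGLInPSL`, in terms of a representative. -/
lemma class_conditions_iff (g : GL (Fin n) F) (ν : n.Partition) :
    (IsRealClass (ConjClasses.mk (toPGL g)) ∧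
      (∀ x ∈ (ConjClasses.mk (toPGL g)).carrier, PGLHasType x ν) ∧
      (ConjClasses.mk (toPGL g)).carrier ⊆ Set.range
      (Matrix.ProjectiveSpecialLinearGroup.toPGL :
        Matrix.ProjectiveSpecialLinearGroup (Fin n) F → Matrix.ProjGenLinGroup (Fin n) F)) ↔
    (∃ l : Fˣ, ∀ i, dual l (uInv g i) = uInv g i) ∧
      (∀ i, (uInv g i).natDegree = mult ν i) ∧ ∃ c : Fˣ, g.det = c ^ n := by
  rw [IsRealClass, forall_mem_carrier_iff fun x k h => IsReal.conj h k,
    forall_mem_carrier_iff fun x k h => PGLHasType.conj h k, isReal_toPGL_iff, pglHasType_iff,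
    ← toPGL_mem_range_iff, Set.subset_def]
  rw [forall_mem_carrier_iff (P := fun x => x ∈ Set.range
      (Matrix.ProjectiveSpecialLinearGroup.toPGL :
        Matrix.ProjectiveSpecialLinearGroup (Fin n) F → Matrix.ProjGenLinGroup (Fin n) F))]
  intro x k hx
  obtain ⟨g, rfl⟩ := Matrix.ProjGenLinGroup.mk_surjective x
  obtain ⟨k, rfl⟩ := Matrix.ProjGenLinGroup.mk_surjective k
  obtain ⟨c, hc⟩ := toPGL_mem_range_iff.mp hx
  rw [← map_inv, ← map_mul, ← map_mul]
  refine toPGL_mem_range_iff.mpr ⟨c, ?_⟩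
  rw [map_mul, map_mul, map_inv, mul_right_comm, mul_inv_cancel, one_mul, hc]

lemma finite_tuples (ν : n.Partition) : Finite
    {u : ℕ → F[X] // ∀ i, (u i).natDegree = mult ν i ∧ (u i).coeff 0 = 1} := by
  have := fun d => finite_polyOfDegree (F := F) d
  refine Finite.of_injective (β := ∀ i : ν.parts.toFinset,
    {p : F[X] // p.natDegree = mult ν i ∧ p.coeff 0 = 1}) (fun u i => ⟨u.1 i, u.2 i⟩) ?_
  intro u w h
  refine Subtype.ext (funext fun i => ?_)
  by_cases hi : i ∈ ν.parts.toFinset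
  · exact congrArg Subtype.val (congrFun h ⟨i, hi⟩)
  · have h1 := u.2 i
    have h2 := w.2 i
    rw [mult_eq_zero hi] at h1 h2
    rw [eq_C_of_natDegree_eq_zero h1.1, eq_C_of_natDegree_eq_zero h2.1, h1.2, h2.2]

instance (ν : n.Partition) : Finite (RealTuple F ν) := by
  have := finite_tuples (F := F) ν
  exact Finite.of_injective (β := {u : ℕ → F[X] //
    ∀ i, (u i).natDegree = mult ν i ∧ (u i).coeff 0 = 1}) (fun u => ⟨u.1, u.2.1⟩)
    fun u w h => Subtype.ext (congrArg (fun x => x.1) h)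

lemma exists_uInv_of_realTuple {ν : n.Partition} (u : RealTuple F ν) :
    ∃ g : GL (Fin n) F, uInv g = u.1 := by
  refine exists_uInv_eq (s := ν.parts.toFinset) (fun i => (u.2.1 i).2) (zero_notMem ν)
    (fun i hi => ?_) ?_
  · have := u.2.1 i
    rw [mult_eq_zero hi] at this
    rw [eq_C_of_natDegree_eq_zero this.1, this.2, C_1]
  · exact (Finset.sum_congr rfl fun i _ => by rw [(u.2.1 i).1]).trans (sum_mult ν)

/-- The real classes of `PGL_n` of type `ν` contained in `PSL_n` are the orbits of the scaling
action on tuples of polynomials. -/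
lemma card_orbits_eq (ν : n.Partition) :
    Nat.card (Quotient (MulAction.orbitRel Fˣ (RealTuple F ν))) = numRealPGLInPSL F ν := by
  choose G hG using fun u : RealTuple F ν => exists_uInv_of_realTuple u
  have hcond : ∀ u : RealTuple F ν, _ := fun u => (class_conditions_iff (G u) ν).mpr (by
    rw [hG]
    refine ⟨u.2.2.1, fun i => (u.2.1 i).1, ?_⟩
    obtain ⟨c, hc⟩ := u.2.2.2
    refine ⟨c, Units.ext ?_⟩
    rw [← detU_eq (ν := ν) fun i => by rw [hG, (u.2.1 i).1], hG, hc, Units.val_pow_eq_pow_val])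
  have hiff : ∀ u w : RealTuple F ν,
      ConjClasses.mk (toPGL (G u)) = ConjClasses.mk (toPGL (G w)) ↔ ∃ c : Fˣ, c • u = w := by
    intro u w
    rw [conj_toPGL_iff, hG, hG]
    exact exists_congr fun c => ⟨fun h => Subtype.ext (funext h),
      fun h i => by rw [← h, smul_val]⟩
  let f : Quotient (MulAction.orbitRel Fˣ (RealTuple F ν)) →
      {c : ConjClasses (Matrix.ProjGenLinGroup (Fin n) F) //
        IsRealClass c ∧ (∀ x ∈ c.carrier, PGLHasType x ν) ∧
        c.carrier ⊆ Set.range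
          (Matrix.ProjectiveSpecialLinearGroup.toPGL :
            Matrix.ProjectiveSpecialLinearGroup (Fin n) F → Matrix.ProjGenLinGroup (Fin n) F)} :=
    Quotient.lift (fun u => ⟨ConjClasses.mk (toPGL (G u)), hcond u⟩) (by
      intro u w huw
      obtain ⟨c, hc⟩ := MulAction.orbitRel_apply.mp huw
      exact Subtype.ext ((hiff w u).mpr ⟨c, hc⟩).symm)
  refine Nat.card_congr (Equiv.ofBijective f ⟨?_, ?_⟩)
  · intro x y
    induction x using Quotient.inductionOn with | _ u =>
    induction y using Quotient.inductionOn with | _ w =>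
    intro h
    obtain ⟨c, hc⟩ := (hiff w u).mp (congrArg Subtype.val h).symm
    exact Quotient.sound (MulAction.orbitRel_apply.mpr ⟨c, hc⟩)
  · rintro ⟨c, hc⟩
    obtain ⟨x, rfl⟩ := ConjClasses.mk_surjective c
    obtain ⟨g, rfl⟩ := Matrix.ProjGenLinGroup.mk_surjective x
    obtain ⟨h1, h2, d, hd⟩ := (class_conditions_iff g ν).mp hc
    let u : RealTuple F ν := ⟨uInv g, fun i => ⟨h2 i, uInv_coeff_zero g i⟩, h1, d, by
      rw [detU_eq h2, hd, Units.val_pow_eq_pow_val]⟩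
    refine ⟨Quotient.mk _ u, Subtype.ext ?_⟩
    change ConjClasses.mk (toPGL (G u)) = ConjClasses.mk (toPGL g)
    rw [conj_toPGL_iff]
    exact ⟨1, fun i => by rw [scale_one, hG]⟩

/-- Tuples fixed by some `dual l` correspond to tuples fixed by a scaling. -/
def sigmaDualTupleEquiv (ν : n.Partition) :
    (Σ l : Fˣ, DualTuple l ν) ≃ Σ c : Fˣ, MulAction.fixedBy (RealTuple F ν) c :=
  let L : RealTuple F ν → Fˣ := fun u => u.2.2.1.choose
  have hL : ∀ (u : RealTuple F ν) (i : ℕ), dual (L u) (u.1 i) = u.1 i :=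
    fun u => u.2.2.1.choose_spec
  -- `L u` is one multiplier with `dual (L u)` fixing `u`. All others differ from it by elements of
  -- the stabiliser of `u`.
  have hfix : ∀ (u : RealTuple F ν) (l : Fˣ),
      (∀ i, dual l (u.1 i) = u.1 i) ↔ (l / L u) • u = u := fun u l => by
    rw [Subtype.ext_iff, funext_iff]
    refine forall_congr' fun i => ?_
    rw [smul_val, dual_eq_scale_dual l (L u) (u.2.1 i).2, hL]
  let e1 : ∀ l : Fˣ, DualTuple l ν ≃ {u : RealTuple F ν // ∀ i, dual l (u.1 i) = u.1 i} := fun l =>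
    ⟨fun u => ⟨⟨u.1, fun i => (u.2.1 i).1, ⟨l, fun i => (u.2.1 i).2⟩, u.2.2⟩, fun i => (u.2.1 i).2⟩,
      fun u => ⟨u.1.1, fun i => ⟨u.1.2.1 i, u.2 i⟩, u.1.2.2.2⟩, fun _ => rfl, fun _ => rfl⟩
  -- Dividing the multiplier by `L u` turns the pairs with `dual l u = u` into the pairs counted by
  -- Burnside's lemma.
  let e2 : Fˣ × RealTuple F ν ≃ Fˣ × RealTuple F ν :=
    ⟨fun x => (x.1 / L x.2, x.2), fun x => (x.1 * L x.2, x.2),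
      fun x => Prod.ext (div_mul_cancel _ _) rfl, fun x => Prod.ext (mul_div_cancel_right _ _) rfl⟩
  let p : Fˣ → RealTuple F ν → Prop := fun l u => ∀ i, dual l (u.1 i) = u.1 i
  let q : Fˣ → RealTuple F ν → Prop := fun c u => c • u = u
  let e3 : {x : Fˣ × RealTuple F ν // p x.1 x.2} ≃ {x : Fˣ × RealTuple F ν // q x.1 x.2} :=
    e2.subtypeEquiv fun x => hfix x.2 x.1
  (Equiv.sigmaCongrRight e1).trans ((Equiv.subtypeProdEquivSigmaSubtype p).symm.trans
    (e3.trans (Equiv.subtypeProdEquivSigmaSubtype q)))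

/-- The number of real classes by Burnside's lemma. -/
theorem sum_card_dualTuple [Fintype Fˣ] (ν : n.Partition) :
    ∑ l : Fˣ, Nat.card (DualTuple l ν) = numRealPGLInPSL F ν * Fintype.card Fˣ := by
  classical
  let _ : ∀ c : Fˣ, Fintype (MulAction.fixedBy (RealTuple F ν) c) := fun c => Fintype.ofFinite _
  let _ : Fintype (Quotient (MulAction.orbitRel Fˣ (RealTuple F ν))) := Fintype.ofFinite _
  have hfin : ∀ l, Finite (DualTuple (F := F) l ν) := by
    intro l
    exact Finite.of_injective (β := RealTuple F ν)
      (fun u => ⟨u.1, fun i => (u.2.1 i).1, ⟨l, fun i => (u.2.1 i).2⟩, u.2.2⟩)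
      fun u w h => Subtype.ext (congrArg (fun x => x.1) h)
  let _ : ∀ l, Fintype (DualTuple (F := F) l ν) := fun l => Fintype.ofFinite _
  have h := MulAction.sum_card_fixedBy_eq_card_orbits_mul_card_group Fˣ (RealTuple F ν)
  rw [← card_orbits_eq, Nat.card_eq_fintype_card, ← h]
  simp only [Nat.card_eq_fintype_card]
  rw [← Fintype.card_sigma, ← Fintype.card_sigma]
  exact Fintype.card_congr (sigmaDualTupleEquiv ν)

end ProjectiveLinear

end RealPSL

end

noncomputable section

namespace RealPSL

/-! ### Squares and `n`-th powers in the cyclic group of units. -/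

section CyclicArithmetic

variable {F : Type*} [Field F] [Fintype F]

lemma units_pow_card_sub_one (z : Fˣ) : z ^ (Fintype.card F - 1) = 1 := by
  apply Units.ext
  rw [Units.val_pow_eq_pow_val, FiniteField.pow_card_sub_one_eq_one _ z.ne_zero, Units.val_one]

lemma card_sub_one_pos : 0 < Fintype.card F - 1 :=
  Nat.sub_pos_of_lt Fintype.one_lt_card

lemma twoPart_lt_iff {a b : ℕ} : twoPart a < twoPart b ↔ padicValNat 2 a < padicValNat 2 b :=
  Nat.pow_lt_pow_iff_right one_lt_two

/-- The 2-part of the gcd is at most that of `n`, so the quotient of `N` by the gcd is still even.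
-/
lemma two_dvd_div_gcd {n N : ℕ} (hn : 0 < n) (hN : 0 < N) (h : twoPart n < twoPart N) :
    ∃ m, N = n.gcd N * (2 * m) := by
  rw [twoPart_lt_iff] at h
  obtain ⟨m, hm⟩ := Nat.gcd_dvd_right n N
  have hg : 0 < n.gcd N := Nat.gcd_pos_of_pos_left _ hn
  have hm0 : m ≠ 0 := by rintro rfl; omega
  have h1 : padicValNat 2 N = padicValNat 2 (n.gcd N) + padicValNat 2 m := by
    conv_lhs => rw [hm]
    exact padicValNat.mul hg.ne' hm0
  have h2 : padicValNat 2 (n.gcd N) ≤ padicValNat 2 n :=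
    (padicValNat_dvd_iff_le hn.ne').mp (pow_padicValNat_dvd.trans (Nat.gcd_dvd_left n N))
  have h3 : 2 ∣ m := dvd_of_one_le_padicValNat (by omega)
  obtain ⟨k, rfl⟩ := h3
  exact ⟨k, hm⟩

lemma ringChar_ne_two (hq : ¬ Even (Fintype.card F)) : ringChar F ≠ 2 := by
  rw [Ne, FiniteField.even_card_iff_char_two, ← Nat.even_iff]; exact hq

lemma card_div_two {F : Type*} [Fintype F] (hq : ¬ Even (Fintype.card F)) :
    Fintype.card F / 2 = (Fintype.card F - 1) / 2 := by
  have := Nat.not_even_iff_odd.mp hq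
  obtain ⟨k, hk⟩ := this
  omega

lemma two_dvd_card_sub_one {F : Type*} [Fintype F] (hq : ¬ Even (Fintype.card F)) :
    2 ∣ Fintype.card F - 1 := by
  obtain ⟨k, hk⟩ := Nat.not_even_iff_odd.mp hq
  omega

/-- The order of `z` divides `gcd(n, q - 1)`, which divides `(q - 1) / 2`; Euler's criterion
applies. -/
lemma isSquare_of_pow_eq_one (hq : ¬ Even (Fintype.card F)) {n : ℕ} (hn : 0 < n)
    (h : twoPart n < twoPart (Fintype.card F - 1)) {z : Fˣ} (hz : z ^ n = 1) : IsSquare z := by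
  obtain ⟨m, hm⟩ := two_dvd_div_gcd hn card_sub_one_pos h
  rw [FiniteField.unit_isSquare_iff (ringChar_ne_two hq), card_div_two hq, hm, mul_left_comm,
    Nat.mul_div_cancel_left _ two_pos, pow_mul,
    pow_gcd_eq_one.mpr ⟨hz, units_pow_card_sub_one z⟩, one_pow]

/-- For a nonsquare `y`, `-1 = y ^ ((q - 1) / 2)`. This exponent is a multiple of `gcd(n, q - 1)`,
and Bézout makes a power with that exponent an `n`-th power. -/
lemma exists_neg_one_eq_pow (hq : ¬ Even (Fintype.card F)) {n : ℕ} (hn : 0 < n)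
    (h : twoPart n < twoPart (Fintype.card F - 1)) : ∃ c : Fˣ, -1 = c ^ n := by
  obtain ⟨m, hm⟩ := two_dvd_div_gcd hn card_sub_one_pos h
  obtain ⟨a, ha⟩ := FiniteField.exists_nonsquare (ringChar_ne_two hq)
  have ha0 : a ≠ 0 := by rintro rfl; exact ha ⟨0, by simp⟩
  have h1 : a ^ (Fintype.card F / 2) = -1 := (FiniteField.pow_dichotomy (ringChar_ne_two hq)
    ha0).resolve_left fun h => ha ((FiniteField.isSquare_iff (ringChar_ne_two hq) ha0).mpr h)
  let y : Fˣ := Units.mk0 a ha0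
  have hy : y ^ ((Fintype.card F - 1) / 2) = -1 := by
    apply Units.ext
    rw [← card_div_two hq, Units.val_pow_eq_pow_val, Units.val_mk0, h1]
    simp
  rw [hm, mul_left_comm, Nat.mul_div_cancel_left _ two_pos, mul_comm, pow_mul] at hy
  generalize y ^ m = w at hy
  refine ⟨w ^ (Nat.gcdA n (Fintype.card F - 1)), ?_⟩
  rw [← hy, ← zpow_natCast w, Nat.gcd_eq_gcd_ab, zpow_add, zpow_mul, zpow_mul, zpow_natCast,
    zpow_natCast, units_pow_card_sub_one, one_zpow, mul_one, ← zpow_natCast, ← zpow_natCast,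
    ← zpow_mul, ← zpow_mul, mul_comm]

lemma exists_odd_mul (hq : ¬ Even (Fintype.card F)) {n : ℕ} (hn : 0 < n)
    (h : twoPart (Fintype.card F - 1) < twoPart n) :
    ∃ b l m, Fintype.card F - 1 = 2 ^ b * (2 * m + 1) ∧ n = 2 ^ (b + 1) * l ∧ 0 < b := by
  obtain ⟨b, N, hN, hbN⟩ := Nat.exists_eq_two_pow_mul_odd (card_sub_one_pos (F := F)).ne'
  obtain ⟨m, rfl⟩ := hN
  have hb : padicValNat 2 (Fintype.card F - 1) = b := by
    rw [hbN, padicValNat.mul (by positivity) (by omega), padicValNat.prime_pow,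
      padicValNat.eq_zero_of_not_dvd (by omega), add_zero]
  rw [twoPart_lt_iff, hb] at h
  obtain ⟨l, hl⟩ := (padicValNat_dvd_iff_le (p := 2) hn.ne').mpr h
  refine ⟨b, l, m, hbN, hl, Nat.pos_of_ne_zero ?_⟩
  rintro rfl
  have := two_dvd_card_sub_one hq
  omega

/-- The odd part of `q - 1` times `n` is a multiple of `q - 1`. Raising `-1 = c ^ n` to this odd
power would give `-1 = 1`. -/
lemma not_exists_neg_one_eq_pow (hq : ¬ Even (Fintype.card F)) {n : ℕ} (hn : 0 < n)
    (h : twoPart (Fintype.card F - 1) < twoPart n) : ¬ ∃ c : Fˣ, -1 = c ^ n := by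
  rintro ⟨c, hc⟩
  obtain ⟨b, l, m, hN, rfl, -⟩ := exists_odd_mul hq hn h
  have h1 : (-1 : Fˣ) ^ (2 * m + 1) = -1 := Odd.neg_one_pow ⟨m, rfl⟩
  rw [hc, ← hc, hc, ← pow_mul, show 2 ^ (b + 1) * l * (2 * m + 1) =
    2 ^ b * (2 * m + 1) * (2 * l) by ring, ← hN, pow_mul, units_pow_card_sub_one, one_pow,
    ← hc] at h1
  have h2 := congrArg Units.val h1
  simp only [Units.val_one, Units.val_neg] at h2
  exact two_ne_zero_of_odd_card hq (by linear_combination h2)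

lemma exists_pow_half_eq_pow (hq : ¬ Even (Fintype.card F)) {n : ℕ} (hn : 0 < n)
    (h : twoPart (Fintype.card F - 1) < twoPart n) (z : Fˣ) : ∃ c : Fˣ, z ^ (n / 2) = c ^ n := by
  obtain ⟨b, l, m, hN, rfl, -⟩ := exists_odd_mul hq hn h
  -- With `2 m + 1` the odd part of `q - 1`, one has `(m + 1) n ≡ n / 2` modulo `q - 1`.
  refine ⟨z ^ (m + 1), ?_⟩
  have h1 : 2 ^ (b + 1) * l / 2 = 2 ^ b * l := by
    rw [pow_succ', mul_assoc, Nat.mul_div_cancel_left _ two_pos]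
  rw [h1, ← pow_mul, show (m + 1) * (2 ^ (b + 1) * l) = 2 ^ b * (2 * m + 1) * l + 2 ^ b * l by ring,
    pow_add, ← hN, pow_mul z (Fintype.card F - 1), units_pow_card_sub_one, one_pow, one_mul]

lemma four_dvd (hq : ¬ Even (Fintype.card F)) {n : ℕ} (hn : 0 < n)
    (h : twoPart (Fintype.card F - 1) < twoPart n) : 4 ∣ n := by
  obtain ⟨b, l, m, hN, rfl, hb⟩ := exists_odd_mul hq hn h
  obtain ⟨b, rfl⟩ := Nat.exists_eq_succ_of_ne_zero hb.ne'
  exact ⟨2 ^ b * l, by rw [Nat.succ_eq_add_one]; ring⟩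

end CyclicArithmetic

end RealPSL

end

noncomputable section

namespace RealPSL

/-! ### The number of tuples for each multiplier `l`, and the formula for `psl_ν`. -/

section Counting

variable {F : Type*} [Field F] {n : ℕ}

lemma leadingCoeff_sq_mul {l : Fˣ} {p : F[X]} (h0 : p.coeff 0 = 1) (h : dual l p = p) :
    p.leadingCoeff ^ 2 * (l : F) ^ p.natDegree = 1 := by
  have h1 := leadingCoeff_dual l h0
  rw [h] at h1
  have hne : p.leadingCoeff ≠ 0 := leadingCoeff_ne_zero.mpr (ne_zero_of_coeff_zero h0)
  rw [sq]; nth_rewrite 2 [h1]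
  have := l.ne_zero
  rw [inv_pow]
  field_simp

/-- In degree `2 k + 1`, `leadingCoeff_sq_mul` exhibits `l⁻¹` as the square of the leading
coefficient times `l ^ k`. -/
lemma isSquare_of_dual_eq {l : Fˣ} {p : F[X]} (h0 : p.coeff 0 = 1) (h : dual l p = p)
    (hd : Odd p.natDegree) : IsSquare l := by
  obtain ⟨k, hk⟩ := hd
  have hne : p.leadingCoeff ≠ 0 := leadingCoeff_ne_zero.mpr (ne_zero_of_coeff_zero h0)
  have h1 := leadingCoeff_sq_mul h0 h
  refine ⟨(Units.mk0 _ hne * l ^ k)⁻¹, ?_⟩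
  rw [← mul_inv, eq_inv_iff_mul_eq_one]
  apply Units.ext
  simp only [Units.val_mul, Units.val_pow_eq_pow_val, Units.val_mk0, Units.val_one]
  rw [← h1, hk]
  ring

lemma detU_sq {l : Fˣ} {ν : n.Partition} {u : ℕ → F[X]}
    (h : ∀ i, ((u i).natDegree = mult ν i ∧ (u i).coeff 0 = 1) ∧ dual l (u i) = u i) :
    detU ν u ^ 2 = (l : F) ^ n := by
  have h1 : (l : F) ^ n = ∏ i ∈ ν.parts.toFinset, (l : F) ^ (i * mult ν i) := by
    rw [Finset.prod_pow_eq_pow_sum, sum_mult]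
  rw [h1, detU, ← Finset.prod_pow]
  refine Finset.prod_congr rfl fun i _ => ?_
  have h2 := leadingCoeff_sq_mul (h i).1.2 (h i).2
  have hne : (u i).leadingCoeff ≠ 0 := leadingCoeff_ne_zero.mpr (ne_zero_of_coeff_zero (h i).1.2)
  have h3 : (l : F) ^ mult ν i = ((u i).leadingCoeff⁻¹) ^ 2 := by
    rw [← (h i).1.1, inv_pow, eq_inv_of_mul_eq_one_right h2]
  rw [mul_comm i, pow_mul, h3, ← pow_mul, mul_comm i 2, pow_mul, mul_pow, ← pow_mul,
    mul_comm _ 2, pow_mul (-1 : F), neg_one_sq, one_pow, one_mul]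

/-- Extension of a tuple of polynomials indexed by the parts by the constant polynomial `1`. -/
def extendOne (ν : n.Partition) (x : ν.parts.toFinset → F[X]) (i : ℕ) : F[X] :=
  if h : i ∈ ν.parts.toFinset then x ⟨i, h⟩ else 1

lemma extendOne_mem {ν : n.Partition} (x : ν.parts.toFinset → F[X]) (i : ν.parts.toFinset) :
    extendOne ν x i = x i := by
  rw [extendOne, dif_pos i.2]

lemma extendOne_notMem {ν : n.Partition} (x : ν.parts.toFinset → F[X]) {i : ℕ}
    (hi : i ∉ ν.parts.toFinset) : extendOne ν x i = 1 := by
  rw [extendOne, dif_neg hi]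

/-- A tuple in `DualTuple l ν` is determined by its entries at the parts of `ν`. -/
def dualTupleEquiv (l : Fˣ) (ν : n.Partition) : DualTuple l ν ≃
    {x : ∀ i : ν.parts.toFinset, FixedPoly F l (mult ν i) //
      ∃ c : Fˣ, detU ν (extendOne ν fun i => (x i).1) = (c : F) ^ n} where
  toFun u := ⟨fun i => ⟨u.1 i, u.2.1 i⟩, by
    have : extendOne ν (fun i => u.1 i) = u.1 := by
      funext i
      by_cases hi : i ∈ ν.parts.toFinset
      · exact extendOne_mem _ ⟨i, hi⟩
      · rw [extendOne_notMem _ hi]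
        have := (u.2.1 i).1
        rw [mult_eq_zero hi] at this
        rw [eq_C_of_natDegree_eq_zero this.1, this.2, C_1]
    simp only [this]
    exact u.2.2⟩
  invFun x := ⟨extendOne ν fun i => (x.1 i).1, by
    refine ⟨fun i => ?_, x.2⟩
    by_cases hi : i ∈ ν.parts.toFinset
    · rw [extendOne_mem _ ⟨i, hi⟩]
      exact (x.1 ⟨i, hi⟩).2
    · rw [extendOne_notMem _ hi, mult_eq_zero hi]
      exact ⟨⟨natDegree_one, coeff_one_zero⟩, dual_one l⟩⟩
  left_inv u := by
    refine Subtype.ext (funext fun i => ?_)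
    by_cases hi : i ∈ ν.parts.toFinset
    · exact extendOne_mem (fun i : ν.parts.toFinset => u.1 i) ⟨i, hi⟩
    · have := (u.2.1 i).1
      rw [mult_eq_zero hi] at this
      refine (extendOne_notMem (fun i : ν.parts.toFinset => u.1 i) hi).trans ?_
      rw [eq_C_of_natDegree_eq_zero this.1, this.2, C_1]
  right_inv x := Subtype.ext (funext fun i => Subtype.ext
    (extendOne_mem (fun i => (x.1 i).1) i))

/-- A sign is its own inverse, so each base factor of `detU` is the sign times `l ^ (n_i / 2)`. If
`l ≠ 1` the multiplicities are even and the exponents `i n_i / 2` add up to `n / 2`. -/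
lemma detU_extendOne {l : Fˣ} {ν : n.Partition}
    (hl : l = 1 ∨ ∀ i ∈ ν.parts.toFinset, Even (mult ν i))
    (x : ∀ i : ν.parts.toFinset, FixedPoly F l (mult ν i)) :
    detU ν (extendOne ν fun i => (x i).1) =
      (l : F) ^ (n / 2) * ((∏ i, sgnZ l (x i).1 ^ (i : ℕ) : ℤ) : F) := by
  have h1 : (l : F) ^ (n / 2) = ∏ i : ν.parts.toFinset, (l : F) ^ ((i : ℕ) * (mult ν i / 2)) := by
    rcases hl with rfl | hl
    · simp
    · rw [Finset.prod_coe_sort ν.parts.toFinset fun i => (l : F) ^ (i * (mult ν i / 2)),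
        Finset.prod_pow_eq_pow_sum]
      congr 1
      refine Nat.div_eq_of_eq_mul_right two_pos ?_
      conv_lhs => rw [← sum_mult ν]
      rw [Finset.mul_sum]
      refine Finset.sum_congr rfl fun i hi => ?_
      rw [mul_left_comm, Nat.mul_div_cancel' (hl i hi).two_dvd]
  rw [h1, detU, ← Finset.prod_coe_sort ν.parts.toFinset fun i =>
    ((-1) ^ (extendOne ν (fun i => (x i).1) i).natDegree *
      (extendOne ν (fun i => (x i).1) i).leadingCoeff⁻¹) ^ i,
    Int.cast_prod, ← Finset.prod_mul_distrib]
  refine Finset.prod_congr rfl fun i _ => ?_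
  have hl' : l = 1 ∨ Even (mult ν i) := hl.imp_right fun h => h i i.2
  have hs := sgn_sq hl' (x i)
  rw [Int.cast_pow, cast_sgnZ hl', extendOne_mem, mul_comm (i : ℕ), pow_mul, ← mul_pow]
  congr 1
  have hsi : sgn l (x i).1 = (sgn l (x i).1)⁻¹ :=
    eq_inv_of_mul_eq_one_left (by rw [← sq, hs])
  rw [hsi, sgn, (x i).2.1.1, mul_inv, mul_inv, ← inv_pow (-1 : F), inv_neg_one]
  have := pow_ne_zero (mult ν i / 2) l.ne_zero
  field_simp

/-- For `l = 1` the determinant is `±1`, hence automatically an `n`-th power. -/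
lemma card_dualTuple_one_eq_glNu (h : ∃ c : Fˣ, -1 = c ^ n) (ν : n.Partition) :
    (Nat.card (DualTuple (1 : Fˣ) ν) : ℚ) = glNu F ν := by
  have hall : ∀ x : ∀ i : ν.parts.toFinset, FixedPoly F 1 (mult ν i),
      ∃ c : Fˣ, detU ν (extendOne ν fun i => (x i).1) = (c : F) ^ n := by
    intro x
    rw [detU_extendOne (Or.inl rfl), Units.val_one, one_pow, one_mul]
    have hp : ∏ i, sgnZ 1 (x i).1 ^ (i : ℕ) = 1 ∨ ∏ i, sgnZ 1 (x i).1 ^ (i : ℕ) = -1 := by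
      rw [← Int.isUnit_iff]
      refine (IsUnit.prod_iff).mpr fun i _ => IsUnit.pow _ ?_
      rw [Int.isUnit_iff]
      exact sgnZ_eq _ _
    rcases hp with hp | hp <;> rw [hp]
    · exact ⟨1, by simp⟩
    · obtain ⟨c, hc⟩ := h
      refine ⟨c, ?_⟩
      rw [← Units.val_pow_eq_pow_val, ← hc]
      simp
  rw [Nat.card_congr ((dualTupleEquiv 1 ν).trans (Equiv.subtypeUnivEquiv hall)), Nat.card_pi,
    Nat.cast_prod, glNu, Finset.prod_coe_sort ν.parts.toFinset
      fun i => (Nat.card (FixedPoly F 1 (mult ν i)) : ℚ)]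
  simp only [nqd_eq]

lemma card_dualTuple_eq_zero_of_odd (ν : n.Partition) {l : Fˣ} (hl : ¬ IsSquare l)
    {i : ℕ} (hi : Odd (mult ν i)) : Nat.card (DualTuple l ν) = 0 := by
  rw [Nat.card_eq_zero]
  refine Or.inl ⟨fun u => hl ?_⟩
  exact isSquare_of_dual_eq (u.2.1 i).1.2 (u.2.1 i).2 (by rwa [(u.2.1 i).1.1])

/-- Scaling by `c` multiplies the multiplier `l` by `c ^ 2` and the determinant by `c ^ n`. -/
lemma card_dualTuple_sq (ν : n.Partition) (c : Fˣ) :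
    Nat.card (DualTuple (c * c) ν) = Nat.card (DualTuple (1 : Fˣ) ν) := by
  have key : ∀ (c l : Fˣ) (u : DualTuple l ν),
      (∀ i, ((scale c (u.1 i)).natDegree = mult ν i ∧ (scale c (u.1 i)).coeff 0 = 1) ∧
        dual (c * c * l) (scale c (u.1 i)) = scale c (u.1 i)) ∧
        ∃ d : Fˣ, detU ν (fun i => scale c (u.1 i)) = (d : F) ^ n := by
    intro c l u
    refine ⟨fun i => ⟨⟨by rw [natDegree_scale, (u.2.1 i).1.1],
      by rw [coeff_zero_scale, (u.2.1 i).1.2]⟩, ?_⟩, ?_⟩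
    · rw [dual_scale _ _ (u.2.1 i).1.2, dual_eq_scale_dual _ l (u.2.1 i).1.2, (u.2.1 i).2]
      congr 1
      rw [mul_assoc, mul_div_cancel_left, mul_div_assoc, div_self', mul_one]
    · obtain ⟨d, hd⟩ := u.2.2
      refine ⟨c * d, ?_⟩
      rw [detU_scale (fun i => (u.2.1 i).1.1), hd, Units.val_mul, mul_pow]
  have h1 : c⁻¹ * c⁻¹ * (c * c) = 1 := by group
  refine Nat.card_congr ⟨fun u => ⟨fun i => scale c⁻¹ (u.1 i), by
      have := key c⁻¹ (c * c) u
      rwa [h1] at this⟩,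
    fun u => ⟨fun i => scale c (u.1 i), by
      have := key c 1 u
      rwa [mul_one] at this⟩, fun u => ?_, fun u => ?_⟩
  · refine Subtype.ext (funext fun i => ?_)
    simp only
    rw [← scale_mul, mul_inv_cancel, scale_one]
  · refine Subtype.ext (funext fun i => ?_)
    simp only
    rw [← scale_mul, inv_mul_cancel, scale_one]

variable [Fintype F]

/-- `l ^ (n / 2)` is an `n`-th power and `-1` is not, so the determinant condition says that the
product of the signs is 1. -/
lemma card_dualTuple_eq_slNu (hq : ¬ Even (Fintype.card F)) (hn : 0 < n)
    (h : twoPart (Fintype.card F - 1) < twoPart n) (ν : n.Partition) {l : Fˣ}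
    (hl : l = 1 ∨ ∀ i ∈ ν.parts.toFinset, Even (mult ν i)) :
    (Nat.card (DualTuple l ν) : ℚ) = slNu F ν := by
  rw [← card_sgn_prod_eq_slNu hq ν l hl]
  congr 1
  refine Nat.card_congr ((dualTupleEquiv l ν).trans (Equiv.subtypeEquivRight fun x => ?_))
  rw [detU_extendOne hl]
  have hp : ∏ i, sgnZ l (x i).1 ^ (i : ℕ) = 1 ∨ ∏ i, sgnZ l (x i).1 ^ (i : ℕ) = -1 := by
    rw [← Int.isUnit_iff]
    refine (IsUnit.prod_iff).mpr fun i _ => IsUnit.pow _ ?_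
    rw [Int.isUnit_iff]
    exact sgnZ_eq _ _
  obtain ⟨d, hd⟩ := exists_pow_half_eq_pow hq hn h l
  rw [← Units.val_pow_eq_pow_val, hd]
  constructor
  · rintro ⟨c, hc⟩
    refine hp.resolve_right fun hp => not_exists_neg_one_eq_pow hq hn h ⟨c / d, ?_⟩
    rw [hp] at hc
    rw [div_pow, eq_div_iff_mul_eq', Units.ext_iff, Units.val_pow_eq_pow_val c, ← hc]
    simp
  · intro hp
    exact ⟨d, by rw [hp]; simp⟩

/-- If `det = c ^ n`, then `det ^ 2 = l ^ n` gives `(l / c ^ 2) ^ n = 1`, so that `l / c ^ 2`, and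
with it `l`, is a square. -/
lemma card_dualTuple_eq_zero (hq : ¬ Even (Fintype.card F)) (hn : 0 < n)
    (h : twoPart n < twoPart (Fintype.card F - 1)) (ν : n.Partition) {l : Fˣ}
    (hl : ¬ IsSquare l) : Nat.card (DualTuple l ν) = 0 := by
  rw [Nat.card_eq_zero]
  refine Or.inl ⟨fun u => hl ?_⟩
  obtain ⟨c, hc⟩ := u.2.2
  have h1 := detU_sq u.2.1
  rw [hc] at h1
  have h2 : (l / c ^ 2) ^ n = 1 := by
    rw [div_pow, div_eq_one]
    apply Units.ext
    simp only [Units.val_pow_eq_pow_val]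
    rw [← h1]
    ring
  have h3 := (isSquare_of_pow_eq_one hq hn h h2).mul (IsSquare.sq c)
  rwa [div_mul_cancel] at h3

lemma card_isSquare (hq : ¬ Even (Fintype.card F)) :
    2 * Nat.card {l : Fˣ // IsSquare l} = Nat.card Fˣ := by
  have h1 : Nat.card {l : Fˣ // IsSquare l} = Nat.card (powMonoidHom 2 : Fˣ →* Fˣ).range := by
    refine Nat.card_congr (Equiv.subtypeEquivRight fun l => ?_)
    rw [MonoidHom.mem_range]
    exact ⟨fun ⟨c, hc⟩ => ⟨c, by rw [hc, powMonoidHom_apply, sq]⟩,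
      fun ⟨c, hc⟩ => ⟨c, by rw [← hc, powMonoidHom_apply, sq]⟩⟩
  have h2 : Nat.card Fˣ = Fintype.card F - 1 := by
    rw [Nat.card_units, Nat.card_eq_fintype_card]
  have h3 := two_dvd_card_sub_one hq
  rw [h1, IsCyclic.card_powMonoidHom_range, h2, Nat.gcd_eq_right h3, Nat.mul_div_cancel' h3]

lemma two_mul_sum_ite {α : Type*} [Fintype α] (p : α → Prop) [DecidablePred p] (A B : ℕ)
    (h : 2 * Nat.card {x // p x} = Nat.card α) :
    2 * ∑ x, (if p x then A else B) = (A + B) * Fintype.card α := by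
  have h4 := Finset.card_filter_add_card_filter_not (s := (Finset.univ : Finset α)) p
  rw [Nat.card_eq_fintype_card, Fintype.card_subtype, Nat.card_eq_fintype_card] at h
  rw [Finset.card_univ, ← h] at h4
  rw [Finset.sum_ite, Finset.sum_const, Finset.sum_const, smul_eq_mul, smul_eq_mul]
  have h6 : (Finset.univ.filter fun l : α => ¬ p l).card = (Finset.univ.filter p).card := by
    rw [two_mul] at h4
    exact Nat.add_left_cancel h4
  rw [h6, ← h]
  ring

/-- In the Burnside average, half of the multipliers are squares and count like 1. -/
lemma two_mul_numRealPGLInPSL (hq : ¬ Even (Fintype.card F)) (ν : n.Partition) {B : ℕ}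
    (hB : ∀ l : Fˣ, ¬ IsSquare l → Nat.card (DualTuple l ν) = B) :
    2 * numRealPGLInPSL F ν = Nat.card (DualTuple (1 : Fˣ) ν) + B := by
  classical
  let _ : Fintype Fˣ := Fintype.ofFinite _
  refine Nat.eq_of_mul_eq_mul_right (Fintype.card_pos (α := Fˣ)) ?_
  rw [mul_assoc, ← sum_card_dualTuple, ← two_mul_sum_ite _ _ _ (card_isSquare hq)]
  congr 1
  refine Finset.sum_congr rfl fun l _ => ?_
  split_ifs with h
  · obtain ⟨c, rfl⟩ := h
    exact card_dualTuple_sq ν c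
  · exact hB l h

lemma one_lt_dNu_iff (hn : 0 < n) (ν : n.Partition) :
    1 < dNu ν ↔ ∀ i ∈ ν.parts.toFinset, Even (mult ν i) := by
  have hle : ∀ i ∈ ν.parts.toFinset, i ∈ Finset.Icc 1 n := by
    intro i hi
    have hi' := Multiset.mem_toFinset.mp hi
    exact Finset.mem_Icc.mpr ⟨ν.parts_pos hi', ν.le_of_mem_parts hi'⟩
  have hne : (Finset.Icc 1 n).gcd (mult ν) ≠ 0 := by
    intro h
    rw [Finset.gcd_eq_zero_iff] at h
    have h1 := sum_mult ν
    rw [Finset.sum_eq_zero fun i hi => by rw [h i (hle i hi), mul_zero]] at h1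
    omega
  have h1 : 1 < dNu ν ↔ 2 ∣ (Finset.Icc 1 n).gcd (mult ν) := by
    rw [dNu, twoPart, Nat.one_lt_two_pow_iff, ← Nat.pos_iff_ne_zero]
    exact ⟨dvd_of_one_le_padicValNat, fun h => one_le_padicValNat_of_dvd hne h⟩
  rw [h1, Finset.dvd_gcd_iff]
  refine ⟨fun h i hi => even_iff_two_dvd.mpr (h i (hle i hi)), fun h i _ => ?_⟩
  by_cases hi : i ∈ ν.parts.toFinset
  · exact (h i hi).two_dvd
  · rw [mult_eq_zero hi]; exact dvd_zero 2

/-- The number of real classes of `PGL_n` of type `ν` contained in `PSL_n`. -/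
theorem numRealPGLInPSL_eq (hn : 0 < n)
    (hq : Even (Fintype.card F) ∨ twoPart n ≠ twoPart (Fintype.card F - 1)) (ν : n.Partition) :
    (numRealPGLInPSL F ν : ℚ) = pslNu F ν := by
  by_cases he : Even (Fintype.card F)
  · have hchar : ringChar F = 2 := by
      rw [FiniteField.even_card_iff_char_two, ← Nat.even_iff]; exact he
    let _ : Fintype Fˣ := Fintype.ofFinite _
    have h1 := sum_card_dualTuple (F := F) ν
    -- In characteristic 2 every unit is a square.
    have h2 : ∀ l : Fˣ, Nat.card (DualTuple l ν) = Nat.card (DualTuple (1 : Fˣ) ν) := by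
      intro l
      obtain ⟨c, hc⟩ := FiniteField.isSquare_of_char_two hchar (l : F)
      have hc0 : c ≠ 0 := by rintro rfl; exact l.ne_zero (by rw [hc, zero_mul])
      have : l = Units.mk0 c hc0 * Units.mk0 c hc0 := Units.ext hc
      rw [this, card_dualTuple_sq]
    rw [Finset.sum_congr rfl fun l _ => h2 l, Finset.sum_const, smul_eq_mul, Finset.card_univ,
      mul_comm] at h1
    rw [← Nat.eq_of_mul_eq_mul_right Fintype.card_pos h1, card_dualTuple_one_eq_glNu,
      pslNu, if_pos (Or.inl he)]
    · have : Nat.gcd 2 (Fintype.card F - 1) = 1 := by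
        refine Nat.coprime_two_left.mpr ?_
        obtain ⟨k, hk⟩ := he; have := Fintype.one_lt_card (α := F); exact ⟨k - 1, by omega⟩
      rw [this, Nat.cast_one, div_one]
    · refine ⟨1, ?_⟩
      rw [one_pow, Units.ext_iff, Units.val_neg, Units.val_one]
      have := CharP.cast_eq_zero F (ringChar F)
      rw [hchar] at this
      push_cast at this
      linear_combination -this
  · have hne := hq.resolve_left he
    have h2 : Nat.gcd 2 (Fintype.card F - 1) = 2 := Nat.gcd_eq_left (two_dvd_card_sub_one he)
    rw [pslNu]
    rcases lt_or_gt_of_ne hne with hlt | hgt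
    · rw [if_pos (Or.inr hlt), h2, ← card_dualTuple_one_eq_glNu (exists_neg_one_eq_pow he hn hlt)]
      have := two_mul_numRealPGLInPSL he ν fun l hl => card_dualTuple_eq_zero he hn hlt ν hl
      rw [add_zero] at this
      rw [← this]
      push_cast
      ring
    · rw [if_neg (by rintro (h | h); exacts [he h, lt_asymm hgt h])]
      have hs := card_dualTuple_eq_slNu he hn hgt ν (Or.inl rfl)
      obtain ⟨l₀, hl₀⟩ : ∃ l : Fˣ, ¬ IsSquare l := by
        obtain ⟨a, ha⟩ := FiniteField.exists_nonsquare (ringChar_ne_two he)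
        have ha0 : a ≠ 0 := by rintro rfl; exact ha ⟨0, by simp⟩
        exact ⟨Units.mk0 a ha0, fun ⟨c, hc⟩ => ha ⟨c, congrArg Units.val hc⟩⟩
      split_ifs with hd
      -- All multiplicities are even, so nonsquares contribute as much as 1.
      · rw [one_lt_dNu_iff hn] at hd
        have hB : ∀ l : Fˣ, ¬ IsSquare l →
            Nat.card (DualTuple l ν) = Nat.card (DualTuple (1 : Fˣ) ν) := by
          intro l _
          have := card_dualTuple_eq_slNu he hn hgt ν (l := l) (Or.inr hd)
          rw [← hs] at this
          exact_mod_cast this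
        have := two_mul_numRealPGLInPSL he ν hB
        rw [← hs]
        norm_cast
        omega
      -- An odd multiplicity excludes nonsquare multipliers, which halves the count.
      · rw [one_lt_dNu_iff hn] at hd
        push Not at hd
        obtain ⟨i, -, hi⟩ := hd
        have := two_mul_numRealPGLInPSL he ν fun l hl =>
          card_dualTuple_eq_zero_of_odd ν hl (by rwa [← Nat.not_even_iff_odd])
        rw [add_zero] at this
        rw [← hs, ← this]
        push_cast
        ring

end Counting

end RealPSL

end

noncomputable section

namespace RealPSL

/-! ### Determinants of involutions permuting a basis. -/

section Permutation

lemma sign_of_involution {α : Type*} [Fintype α] [DecidableEq α] {σ : Equiv.Perm α}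
    (h2 : ∀ x, σ (σ x) = x) (hfix : ∀ x, σ x ≠ x) :
    Equiv.Perm.sign σ = (-1) ^ (Fintype.card α / 2) := by
  rw [Equiv.Perm.sign_of_pow_two_eq_one (Equiv.ext fun x => by rw [sq]; exact h2 x)]
  have : IsEmpty (Function.fixedPoints σ) := ⟨fun x => hfix x.1 x.2⟩
  rw [Fintype.card_eq_zero (α := Function.fixedPoints σ), Nat.sub_zero]

lemma det_of_perm_basis {F V κ : Type*} [Field F] [AddCommGroup V] [Module F V] [Fintype κ]
    [DecidableEq κ] (b : Module.Basis κ F V) (σ : Equiv.Perm κ) {H : Module.End F V}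
    (h : ∀ i, H (b i) = b (σ i)) : LinearMap.det H = (Equiv.Perm.sign σ : ℤ) := by
  rw [← LinearMap.det_toMatrix b]
  have : LinearMap.toMatrix b b H = (σ⁻¹).permMatrix F := by
    ext i j
    rw [LinearMap.toMatrix_apply, h, Module.Basis.repr_self, Finsupp.single_apply,
      Equiv.Perm.permMatrix, PEquiv.toMatrix_apply, Equiv.toPEquiv_apply]
    simp only [Option.mem_def, Option.some.injEq]
    exact if_congr (by rw [Equiv.Perm.inv_eq_iff_eq, eq_comm]) rfl rfl
  rw [this, Matrix.det_permutation, Equiv.Perm.sign_inv]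

end Permutation

/-! ### Construction of reversing involutions of controlled determinant. -/

section Reversal

variable {F : Type*} [Field F]

/-- The involution `H` conjugates `φ` to `l • φ⁻¹`. -/
structure Reverses {V : Type*} [AddCommGroup V] [Module F V] (l : Fˣ) (φ H : Module.End F V) :
    Prop where
  sq : ∀ x, H (H x) = x
  rev : ∀ x, H (φ (H (φ x))) = (l : F) • x

lemma Reverses.conj {V V' : Type*} [AddCommGroup V] [Module F V] [AddCommGroup V'] [Module F V']
    {l : Fˣ} {φ H : Module.End F V} (h : Reverses l φ H) {ψ : Module.End F V'} (s : V' ≃ₗ[F] V)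
    (hs : ∀ x, s (ψ x) = φ (s x)) :
    Reverses l ψ (s.symm.toLinearMap ∘ₗ H ∘ₗ s.toLinearMap) := by
  refine ⟨fun x => by simp [h.sq], fun x => s.injective ?_⟩
  simp [hs, h.rev]

lemma Reverses.neg {V : Type*} [AddCommGroup V] [Module F V]
    {l : Fˣ} {φ H : Module.End F V} (h : Reverses l φ H) : Reverses l φ (-H) :=
  ⟨fun x => by simp [h.sq], fun x => by simp [h.rev]⟩

lemma Reverses.pi {ι : Type*} {M : ι → Type*} [∀ k, AddCommGroup (M k)] [∀ k, Module F (M k)]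
    {l : Fˣ} {φ H : ∀ k, Module.End F (M k)} (h : ∀ k, Reverses l (φ k) (H k)) :
    Reverses l (LinearMap.pi fun k => φ k ∘ₗ LinearMap.proj k : Module.End F (∀ k, M k))
      (LinearMap.pi fun k => H k ∘ₗ LinearMap.proj k) :=
  ⟨fun x => funext fun k => (h k).sq (x k), fun x => funext fun k => (h k).rev (x k)⟩

lemma Reverses.det_eq {V : Type*} [AddCommGroup V] [Module F V]
    {l : Fˣ} {φ H : Module.End F V} (h : Reverses l φ H) :
    LinearMap.det H = 1 ∨ LinearMap.det H = -1 := by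
  have h1 : H * H = 1 := LinearMap.ext h.sq
  have h2 := congrArg LinearMap.det h1
  rw [map_mul, map_one] at h2
  exact mul_self_eq_one_iff.mp h2

lemma Decomp.pi {ι : Type*} {M κ : ι → Type*} [∀ k, AddCommGroup (M k)] [∀ k, Module F (M k)]
    {φ : ∀ k, Module.End F (M k)} {v : ∀ k, κ k → F[X]} {a : ∀ k, κ k → ℕ}
    (h : ∀ k, Decomp (φ k) (v k) (a k)) :
    Decomp (LinearMap.pi fun k => φ k ∘ₗ LinearMap.proj k : Module.End F (∀ k, M k))
      (fun s : Σ k, κ k => v s.1 s.2) (fun s => a s.1 s.2) := by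
  choose e he using fun k => (h k).equiv
  exact ⟨fun s => (h s.1).irreducible s.2, fun s => (h s.1).coeff_zero s.2,
    fun s => (h s.1).pos s.2,
    (LinearEquiv.piCongrRight e).trans (LinearEquiv.piCurry F
      (fun k (j : κ k) => AdjoinRoot (v k j ^ a k j))).symm, fun x s => he s.1 (x s.1) s.2⟩

/-- The elementary divisors of a block which is invariant under `dual l`. -/
def blockMultiset (l : Fˣ) (x : F[X] × ℕ) : Multiset (F[X] × ℕ) :=
  open scoped Classical in if dual l x.1 = x.1 then {x} else {x, (dual l x.1, x.2)}

lemma reverses_flip {l : Fˣ} {W : F[X]} (hW : dual l W = W) (h0 : W.coeff 0 = 1) :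
    Reverses l (LinearMap.mulLeft F (AdjoinRoot.root W)) (flip l W W hW h0).toLinearMap := by
  refine ⟨fun x => flip_flip l W W hW h0 hW h0 x, fun x => ?_⟩
  simp only [LinearMap.mulLeft_apply, AlgHom.toLinearMap_apply]
  rw [map_mul, flip_flip l W W hW h0 hW h0, ← mul_assoc, mul_comm (flip _ _ _ _ _ _),
    root_mul_flip_root, Algebra.smul_def]

/-- For `l = 1` the flip inverts the root, so a power of the root may be put in front without losing
the involution. Exponent `deg W - 1` makes it a permutation of the power basis. -/
lemma reverses_pow_mul_flip {W : F[X]} (hW : dual 1 W = W) (h0 : W.coeff 0 = 1) (k : ℕ) :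
    Reverses 1 (LinearMap.mulLeft F (AdjoinRoot.root W))
      (LinearMap.mulLeft F (AdjoinRoot.root W ^ k) ∘ₗ (flip 1 W W hW h0).toLinearMap) := by
  have h1 := root_mul_flip_root 1 W W hW h0
  rw [Units.val_one, map_one] at h1
  refine ⟨fun x => ?_, fun x => ?_⟩
  · simp only [LinearMap.comp_apply, LinearMap.mulLeft_apply, AlgHom.toLinearMap_apply]
    rw [map_mul, flip_flip 1 W W hW h0 hW h0, map_pow, ← mul_assoc, ← mul_pow, h1, one_pow, one_mul]
  · simp only [LinearMap.comp_apply, LinearMap.mulLeft_apply, AlgHom.toLinearMap_apply]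
    rw [map_mul, map_mul, flip_flip 1 W W hW h0 hW h0, map_pow, mul_left_comm, ← mul_assoc (_ ^ k),
      ← mul_pow, h1, one_pow, one_mul, ← mul_assoc, mul_comm (flip _ _ _ _ _ _), h1, one_mul,
      Units.val_one, one_smul]

/-- The map reverses the basis of powers of the root; in even degree this permutation has no fixed
point. -/
lemma det_pow_mul_flip {W : F[X]} (hW : dual 1 W = W) (h0 : W.coeff 0 = 1)
    (hd : Even W.natDegree) :
    LinearMap.det (LinearMap.mulLeft F (AdjoinRoot.root W ^ (W.natDegree - 1)) ∘ₗ
      (flip 1 W W hW h0).toLinearMap) = (-1) ^ (W.natDegree / 2) := by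
  have hne := ne_zero_of_coeff_zero h0
  have hdim : (AdjoinRoot.powerBasis hne).dim = W.natDegree := AdjoinRoot.powerBasis_dim hne
  have h1 := root_mul_flip_root 1 W W hW h0
  rw [Units.val_one, map_one] at h1
  rw [det_of_perm_basis (AdjoinRoot.powerBasis hne).basis Fin.revPerm, sign_of_involution]
  · rw [Fintype.card_fin, hdim]
    push_cast
    rfl
  · intro i
    simp
  · intro i hi
    have := congrArg Fin.val hi
    rw [Fin.revPerm_apply, Fin.val_rev] at this
    obtain ⟨m, hm⟩ := hd
    have := i.2
    omega
  · intro i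
    rw [PowerBasis.basis_eq_pow, PowerBasis.basis_eq_pow, AdjoinRoot.powerBasis_gen,
      Fin.revPerm_apply, Fin.val_rev]
    simp only [LinearMap.comp_apply, LinearMap.mulLeft_apply, AlgHom.toLinearMap_apply]
    have hi : W.natDegree - 1 = ((AdjoinRoot.powerBasis hne).dim - (i + 1)) + i := by
      have := i.2
      omega
    rw [map_pow, hi, pow_add, mul_assoc, ← mul_pow, h1, one_pow, mul_one]

/-- The swap of two summands which are exchanged by `dual l`. -/
def flipSwap (l : Fˣ) (W W' : F[X]) (h : dual l W' = W) (h0 : W'.coeff 0 = 1)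
    (h' : dual l W = W') (h0' : W.coeff 0 = 1) : Module.End F (AdjoinRoot W × AdjoinRoot W') :=
  LinearMap.prod ((flip l W' W h' h0').toLinearMap ∘ₗ LinearMap.snd F _ _)
    ((flip l W W' h h0).toLinearMap ∘ₗ LinearMap.fst F _ _)

lemma reverses_flipSwap (l : Fˣ) (W W' : F[X]) (h : dual l W' = W) (h0 : W'.coeff 0 = 1)
    (h' : dual l W = W') (h0' : W.coeff 0 = 1) :
    Reverses l (LinearMap.prodMap (LinearMap.mulLeft F (AdjoinRoot.root W))
      (LinearMap.mulLeft F (AdjoinRoot.root W'))) (flipSwap l W W' h h0 h' h0') := by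
  refine ⟨fun x => Prod.ext (flip_flip l W W' h h0 h' h0' x.1) (flip_flip l W' W h' h0' h h0 x.2),
    fun x => Prod.ext ?_ ?_⟩
  · change flip l W' W h' h0' (AdjoinRoot.root W' * flip l W W' h h0 (AdjoinRoot.root W * x.1)) =
      (l : F) • x.1
    rw [map_mul, flip_flip l W W' h h0 h' h0', ← mul_assoc, mul_comm (flip _ _ _ _ _ _),
      root_mul_flip_root, Algebra.smul_def]
  · change flip l W W' h h0 (AdjoinRoot.root W * flip l W' W h' h0' (AdjoinRoot.root W' * x.2)) =
      (l : F) • x.2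
    rw [map_mul, flip_flip l W' W h' h0' h h0, ← mul_assoc, mul_comm (flip _ _ _ _ _ _),
      root_mul_flip_root, Algebra.smul_def]

/-- A basis of one summand together with its image under the flip is permuted by `deg W`
transpositions. -/
lemma det_flipSwap (l : Fˣ) (W W' : F[X]) (h : dual l W' = W) (h0 : W'.coeff 0 = 1)
    (h' : dual l W = W') (h0' : W.coeff 0 = 1) :
    LinearMap.det (flipSwap l W W' h h0 h' h0') = (-1) ^ W.natDegree := by
  have hne := ne_zero_of_coeff_zero h0'
  have := finite_adjoinRoot hne
  let b := Module.finBasis F (AdjoinRoot W)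
  rw [det_of_perm_basis (b.prod (b.map (flipEquiv l W W' h h0 h' h0'))) (Equiv.sumComm _ _),
    sign_of_involution]
  · rw [Fintype.card_sum, Fintype.card_fin, finrank_adjoinRoot hne, ← two_mul,
      Nat.mul_div_cancel_left _ two_pos]
    push_cast
    rfl
  · rintro (i | i) <;> rfl
  · rintro (i | i) <;> simp
  · rintro (i | i)
    · refine Prod.ext ?_ ?_
      · simp [flipSwap]
      · simp [flipSwap, flipEquiv]
    · refine Prod.ext ?_ ?_
      · simp only [flipSwap, flipEquiv, Equiv.sumComm_apply, Sum.swap_inr]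
        simp [flip_flip]
      · simp [flipSwap]

/-- Passing to coordinates `Fin d → F` gives all blocks a common shape, so that they can be chosen
simultaneously. -/
lemma exists_block_of_model {M ι : Type*} [AddCommGroup M] [Module F M] [Module.Finite F M]
    [Fintype ι] {l : Fˣ} {ψ H : Module.End F M} {v : ι → F[X]} {a : ι → ℕ} (hd : Decomp ψ v a)
    (hH : Reverses l ψ H) (hdet : l = 1 → Odd (Module.finrank F M) ∨
      LinearMap.det H = (-1) ^ (Module.finrank F M / 2)) :
    ∃ (d : ℕ) (φ H : Module.End F (Fin d → F)) (m : ℕ) (w : Fin m → F[X]) (b : Fin m → ℕ),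
      Decomp φ w b ∧ Finset.univ.val.map (fun j => (w j, b j)) =
        Finset.univ.val.map (fun j => (v j, a j)) ∧
      Reverses l φ H ∧ (l = 1 → Odd d ∨ LinearMap.det H = (-1) ^ (d / 2)) := by
  let s : M ≃ₗ[F] (Fin (Module.finrank F M) → F) := (Module.finBasis F M).equivFun
  let e := (Fintype.equivFin ι).symm
  have hs : ∀ x, s.symm ((s.toLinearMap ∘ₗ ψ ∘ₗ s.symm.toLinearMap) x) = ψ (s.symm x) := by
    intro x; simp
  refine ⟨Module.finrank F M, s.toLinearMap ∘ₗ ψ ∘ₗ s.symm.toLinearMap,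
    s.toLinearMap ∘ₗ H ∘ₗ s.symm.toLinearMap, Fintype.card ι, v ∘ e, a ∘ e,
    (hd.conj s.symm hs).reindex e, ?_, hH.conj s.symm hs, ?_⟩
  · have h1 : (Finset.univ : Finset ι).val = Finset.univ.val.map e := by
      rw [← Finset.map_univ_equiv e]; rfl
    rw [h1, Multiset.map_map]
    rfl
  · rw [LinearMap.det_conj]
    exact hdet

/-- A self-dual elementary divisor is reversed by a flip within its summand, any other by swapping
its summand with the dual one. The determinant matters only for `l = 1`. -/
lemma exists_block (l : Fˣ) {x : F[X] × ℕ} (hirr : Irreducible x.1) (h0 : x.1.coeff 0 = 1)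
    (hpos : 0 < x.2) :
    ∃ (d : ℕ) (φ H : Module.End F (Fin d → F)) (m : ℕ) (w : Fin m → F[X]) (b : Fin m → ℕ),
      Decomp φ w b ∧ Finset.univ.val.map (fun j => (w j, b j)) = blockMultiset l x ∧
      Reverses l φ H ∧ (l = 1 → Odd d ∨ LinearMap.det H = (-1) ^ (d / 2)) := by
  obtain ⟨w, a⟩ := x
  simp only at hirr h0 hpos
  have hW0 := coeff_zero_pow h0 a
  have hWne := ne_zero_of_coeff_zero hW0
  have := finite_adjoinRoot hWne
  rw [blockMultiset]
  split_ifs with h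
  · simp only at h
    have hW : dual l (w ^ a) = w ^ a := by rw [dual_pow, h]
    have hd : Decomp (LinearMap.mulLeft F (AdjoinRoot.root (w ^ a))) (fun _ : Unit => w)
        (fun _ => a) :=
      ⟨fun _ => hirr, fun _ => h0, fun _ => hpos,
        (LinearEquiv.funUnique Unit F (AdjoinRoot (w ^ a))).symm, fun _ _ => rfl⟩
    have hm : Finset.univ.val.map (fun _ : Unit => (w, a)) = {(w, a)} := rfl
    rw [← hm]
    by_cases hl : l = 1
    · subst hl
      refine exists_block_of_model hd (reverses_pow_mul_flip hW hW0 ((w ^ a).natDegree - 1))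
        fun _ => ?_
      rw [finrank_adjoinRoot hWne, or_iff_not_imp_left, Nat.not_odd_iff_even]
      exact det_pow_mul_flip hW hW0
    · exact exists_block_of_model hd (reverses_flip hW hW0) fun h => absurd h hl
  · simp only at h
    have h0' := coeff_zero_dual l hirr.ne_zero
    have hW' := coeff_zero_pow h0' a
    have hd1 : dual l (w ^ a) = dual l w ^ a := dual_pow l w a
    have hd2 : dual l (dual l w ^ a) = w ^ a := by rw [dual_pow, dual_dual l h0]
    have := finite_adjoinRoot (ne_zero_of_coeff_zero hW')
    let v : Bool → F[X] := fun b => bif b then w else dual l w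
    have hd : Decomp (LinearMap.prodMap (LinearMap.mulLeft F (AdjoinRoot.root (w ^ a)))
      (LinearMap.mulLeft F (AdjoinRoot.root (dual l w ^ a)))) v (fun _ => a) := by
      refine ⟨?_, ?_, fun _ => hpos, ?_⟩
      · rintro (_ | _)
        · exact irreducible_dual l h0 hirr
        · exact hirr
      · rintro (_ | _)
        · exact h0'
        · exact h0
      · let e : (AdjoinRoot (w ^ a) × AdjoinRoot (dual l w ^ a)) ≃ₗ[F]
            (∀ b, AdjoinRoot (v b ^ a)) :=
          { toFun := fun x b => match b with
              | true => x.1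
              | false => x.2
            invFun := fun y => (y true, y false)
            left_inv := fun x => rfl
            right_inv := fun y => by funext b; cases b <;> rfl
            map_add' := fun x y => by funext b; cases b <;> rfl
            map_smul' := fun c x => by funext b; cases b <;> rfl }
        exact ⟨e, fun x b => by cases b <;> rfl⟩
    have hm : Finset.univ.val.map (fun b : Bool => (v b, a)) = {(w, a), (dual l w, a)} := rfl
    rw [← hm]
    refine exists_block_of_model hd (reverses_flipSwap l _ _ hd2 hW' hd1 hW0) fun _ => Or.inr ?_
    rw [det_flipSwap, Module.finrank_prod, finrank_adjoinRoot hWne,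
      finrank_adjoinRoot (ne_zero_of_coeff_zero hW'), ← hd1, natDegree_dual l hW0, ← two_mul,
      Nat.mul_div_cancel_left _ two_pos]

/-- A multiset invariant under an involution is a union of orbits. -/
lemma exists_bind_eq {α : Type*} {s : Multiset α} {τ : α → α} (hτ : ∀ x ∈ s, τ (τ x) = x)
    (hs : s.map τ = s) [DecidableEq α] :
    ∃ t : Multiset α, t ≤ s ∧ s = t.bind fun x => if τ x = x then {x} else {x, τ x} := by
  classical
  -- An arbitrary order serves to pick the smaller element of each orbit; invariance of `s` makes
  -- the larger elements the images of the smaller ones.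
  let _ : LinearOrder α := linearOrderOfSTO WellOrderingRel
  have h1 : s.filter (fun x => τ x < x) = (s.filter fun x => x < τ x).map τ := by
    conv_lhs => rw [← hs]
    rw [Multiset.filter_map]
    congr 1
    refine Multiset.filter_congr fun x hx => ?_
    rw [Function.comp_apply, hτ x hx]
  refine ⟨s.filter fun x => x ≤ τ x, Multiset.filter_le _ _, ?_⟩
  have h2 : s = s.filter (fun x => x ≤ τ x) + s.filter (fun x => τ x < x) := by
    conv_lhs => rw [← Multiset.filter_add_not (fun x => x ≤ τ x) s]
    simp only [not_le]
  have h3 : s.filter (fun x => x ≤ τ x) =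
      s.filter (fun x => τ x = x) + s.filter (fun x => x < τ x) := by
    conv_lhs => rw [← Multiset.filter_add_not (fun x => τ x = x) (s.filter fun x => x ≤ τ x)]
    rw [Multiset.filter_filter, Multiset.filter_filter]
    congr 1
    · exact Multiset.filter_congr fun x _ => ⟨fun h => h.1, fun h => ⟨h, h.ge⟩⟩
    · exact Multiset.filter_congr fun x _ => ⟨fun h => lt_of_le_of_ne h.2 (Ne.symm h.1),
        fun h => ⟨h.ne', h.le⟩⟩
  conv_lhs => rw [h2]
  rw [h1, h3, Multiset.add_bind, add_assoc]
  congr 1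
  · rw [Multiset.bind_congr (g := fun x => {x}) fun x hx =>
      if_pos (Multiset.mem_filter.mp hx).2, Multiset.bind_singleton, Multiset.map_id']
  · have h4 : ((s.filter fun x => x < τ x).bind fun x => if τ x = x then {x} else {x, τ x}) =
        (s.filter fun x => x < τ x).bind fun x => {x} + {τ x} :=
      Multiset.bind_congr fun x hx => if_neg (Multiset.mem_filter.mp hx).2.ne'
    rw [h4, Multiset.bind_add, Multiset.bind_singleton, Multiset.bind_singleton, Multiset.map_id']

/-- An endomorphism whose elementary divisors are invariant under `dual l` is reversed. -/
theorem Decomp.exists_reverses {V ι : Type*} [AddCommGroup V] [Module F V] [Fintype ι]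
    [FiniteDimensional F V] {l : Fˣ}
    {φ : Module.End F V} {v : ι → F[X]} {a : ι → ℕ} (h : Decomp φ v a)
    (hinv : Finset.univ.val.map (fun j => (RealPSL.dual l (v j), a j)) =
      Finset.univ.val.map (fun j => (v j, a j))) :
    ∃ H, Reverses l φ H ∧ (l = 1 → 4 ∣ Module.finrank F V → LinearMap.det H = 1) := by
  classical
  obtain ⟨t, ht, hst⟩ := exists_bind_eq (s := Finset.univ.val.map (fun j => (v j, a j)))
    (τ := fun x => (RealPSL.dual l x.1, x.2)) (by
      intro x hx
      obtain ⟨j, -, rfl⟩ := Multiset.mem_map.mp hx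
      simp only [dual_dual l (h.coeff_zero j)]) (by
      rw [Multiset.map_map]; exact hinv)
  have hmem : ∀ x : t, Irreducible (x : F[X] × ℕ).1 ∧ (x : F[X] × ℕ).1.coeff 0 = 1 ∧
      0 < (x : F[X] × ℕ).2 := by
    intro x
    obtain ⟨j, -, hj⟩ := Multiset.mem_map.mp (Multiset.mem_of_le ht Multiset.coe_mem)
    rw [← hj]
    exact ⟨h.irreducible j, h.coeff_zero j, h.pos j⟩
  choose d ψ H m w b hd hm hH hdet using fun x : t =>
    exists_block l (hmem x).1 (hmem x).2.1 (hmem x).2.2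
  have hd' := Decomp.pi hd
  obtain ⟨s, hs⟩ := h.exists_conj hd' (by
    rw [hst]
    conv_lhs => rw [← Multiset.map_univ_coe t]
    rw [Multiset.bind_map, ← Finset.univ_sigma_univ]
    change _ = Multiset.map _ (Multiset.bind _ _)
    rw [Multiset.map_bind]
    refine Multiset.bind_congr fun x _ => ?_
    rw [Multiset.map_map, Function.comp_def]
    refine Eq.trans ?_ (hm x).symm
    rw [blockMultiset]
    simp only [Prod.ext_iff, and_true])
  have hfin : Module.finrank F V = ∑ x : t, d x := by
    rw [s.finrank_eq, Module.finrank_pi_fintype]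
    simp
  -- Negating the involution on a block of odd dimension changes the sign of the determinant at
  -- will.
  by_cases hodd : ∃ x, Odd (d x)
  · obtain ⟨x₀, hx₀⟩ := hodd
    have hr := (Reverses.pi hH).conj s hs
    rcases hr.det_eq with h1 | h1
    · exact ⟨_, hr, fun _ _ => h1⟩
    · have hH' : ∀ x, Reverses l (ψ x) (if x = x₀ then -H x else H x) := by
        intro x
        split_ifs
        · exact (hH x).neg
        · exact hH x
      refine ⟨_, (Reverses.pi hH').conj s hs, fun _ _ => ?_⟩
      have h2 := LinearMap.det_conj (LinearMap.pi fun k => H k ∘ₗ LinearMap.proj k) s.symm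
      have h3 := LinearMap.det_conj (LinearMap.pi fun k =>
        (if k = x₀ then -H k else H k) ∘ₗ LinearMap.proj k) s.symm
      rw [LinearEquiv.symm_symm] at h2 h3
      rw [h3, det_pi_map, ← Finset.mul_prod_erase _ _ (Finset.mem_univ x₀), if_pos rfl,
        ← neg_one_smul F (H x₀), LinearMap.det_smul, Module.finrank_fin_fun, hx₀.neg_one_pow,
        mul_assoc, Finset.prod_congr rfl fun x hx => by rw [if_neg (Finset.ne_of_mem_erase hx)],
        Finset.mul_prod_erase _ (fun x => LinearMap.det (H x)) (Finset.mem_univ x₀), ← det_pi_map,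
        ← h2, h1]
      ring
  · push Not at hodd
    refine ⟨_, (Reverses.pi hH).conj s hs, fun hl h4 => ?_⟩
    have h2 := LinearMap.det_conj (LinearMap.pi fun k => H k ∘ₗ LinearMap.proj k) s.symm
    rw [LinearEquiv.symm_symm] at h2
    rw [h2, det_pi_map, Finset.prod_congr rfl fun x _ => (hdet x hl).resolve_left (hodd x),
      Finset.prod_pow_eq_pow_sum]
    -- Without odd blocks the determinant is `-1` to half the dimension, which is even when 4
    -- divides the dimension.
    have h5 : 2 * ∑ x, d x / 2 = Module.finrank F V := by
      rw [hfin, Finset.mul_sum]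
      exact Finset.sum_congr rfl fun x _ =>
        Nat.mul_div_cancel' (Nat.not_odd_iff_even.mp (hodd x)).two_dvd
    exact Even.neg_one_pow (by
      rw [even_iff_two_dvd]
      omega)

end Reversal

end RealPSL

end

noncomputable section

namespace RealPSL

/-! ### Real elements of `PSL_n` are strongly real. -/

section StrongReality

variable {F : Type*} [Field F] {n : ℕ}

/-- Apply `p(φ) = 0` to the vector of the model all of whose coordinates are 1. -/
lemma Decomp.pow_dvd {V ι : Type*} [AddCommGroup V] [Module F V] {φ : Module.End F V}
    {v : ι → F[X]} {a : ι → ℕ} (h : Decomp φ v a) {p : F[X]} (hp : aeval φ p = 0) (j : ι) :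
    v j ^ a j ∣ p := by
  classical
  obtain ⟨e, he⟩ := h.equiv
  have h1 := apply_aeval_of_intertwining e.toLinearMap he p (e.symm 1) j
  rw [hp] at h1
  simp only [LinearMap.zero_apply, map_zero, Pi.zero_apply, LinearEquiv.coe_coe,
    LinearEquiv.apply_symm_apply, Pi.one_apply, mul_one] at h1
  exact AdjoinRoot.mk_eq_zero.mp h1.symm

/-- The determinant of a root of a non-square scalar. -/
lemma det_of_sq_eq_smul {V : Type*} [AddCommGroup V] [Module F V] [FiniteDimensional F V]
    {φ : Module.End F V} {l : Fˣ} (hl : ¬ IsSquare l) (h : ∀ x, φ (φ x) = (l : F) • x) :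
    LinearMap.det φ = (-(l : F)) ^ (Module.finrank F V / 2) := by
  have hinj : Function.Injective φ := fun x y hxy => by
    have := congrArg φ hxy
    rw [h, h] at this
    exact smul_right_injective _ l.ne_zero this
  obtain ⟨r, v, a, hd⟩ := exists_decomp hinj
  have hirr : Irreducible (X ^ 2 - C (l : F)) := by
    refine X_pow_sub_C_irreducible_of_prime Nat.prime_two fun b hb => hl ?_
    have hb0 : b ≠ 0 := by rintro rfl; exact l.ne_zero (by rw [← hb]; simp)
    exact ⟨Units.mk0 b hb0, Units.ext (by rw [← hb, sq]; rfl)⟩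
  have hzero : aeval φ (X ^ 2 - C (l : F)) = 0 := by
    ext x
    simp [sq, h]
  -- As `X ^ 2 - l` is irreducible and kills `φ`, every elementary divisor is this polynomial to the
  -- first power, normalised to constant term 1. Each contributes `-l` to the determinant.
  have hv : ∀ j, v j = C (-(l : F)⁻¹) * (X ^ 2 - C (l : F)) ∧ a j = 1 := by
    intro j
    have h1 := hd.pow_dvd hzero j
    have h2 : v j ∣ X ^ 2 - C (l : F) := (dvd_pow_self _ (hd.pos j).ne').trans h1
    have h3 := (hd.irreducible j).associated_of_dvd hirr h2
    constructor
    · refine eq_of_associated (hd.coeff_zero j) ?_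
        (h3.trans (associated_C_mul (neg_ne_zero.mpr (inv_ne_zero l.ne_zero)) _))
      simp
    · have h4 : v j ^ a j ∣ v j ^ 1 := by rw [pow_one]; exact h1.trans h3.symm.dvd
      rw [pow_dvd_pow_iff (hd.irreducible j).ne_zero (hd.irreducible j).not_isUnit] at h4
      have := hd.pos j
      omega
  have hdeg : (C (-(l : F)⁻¹) * (X ^ 2 - C (l : F))).natDegree = 2 := by
    rw [natDegree_C_mul (neg_ne_zero.mpr (inv_ne_zero l.ne_zero)), natDegree_X_pow_sub_C]
  have hlead : (C (-(l : F)⁻¹) * (X ^ 2 - C (l : F))).leadingCoeff = -(l : F)⁻¹ := by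
    rw [leadingCoeff_mul, leadingCoeff_C, leadingCoeff_X_pow_sub_C two_pos, mul_one]
  have hn : Module.finrank F V = 2 * r := by
    rw [hd.finrank, Finset.sum_congr rfl fun j _ => by rw [(hv j).1, (hv j).2, hdeg]]
    simp [mul_comm]
  rw [hd.det, Finset.prod_congr rfl fun j _ => by rw [(hv j).1, (hv j).2, hdeg, hlead],
    Finset.prod_const, Finset.card_univ, Fintype.card_fin, hn, Nat.mul_div_cancel_left _ two_pos]
  simp

variable [Fintype F]

lemma exists_involution {g : GL (Fin n) F} {l : Fˣ} (h : ∀ i, dual l (uInv g i) = uInv g i) :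
    ∃ t : GL (Fin n) F, t * t = 1 ∧ t * g * t * g = scal n l ∧ (t.det = 1 ∨ t.det = -1) ∧
      (l = 1 → 4 ∣ n → t.det = 1) := by
  obtain ⟨r, v, a, hd⟩ := exists_decomp_lin g
  have hu := uInv_eq hd
  have h1 : Decomp (lin (scal n l * g⁻¹)) (fun j => dual l (v j)) a := hd.dual l fun x => by
    have : g * (scal n l * g⁻¹) = scal n l := by
      rw [← mul_assoc, ← Matrix.GeneralLinearGroup.scalar_commute l g, mul_assoc, mul_inv_cancel,
        mul_one]
    rw [← Module.End.mul_apply, ← lin_mul, this, lin_scalar_apply]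
  have h2 := map_eq_of_partProd_eq h1 hd fun i => by
    rw [← uInv_eq h1, ← hu, uInv_scalar_mul_inv, h]
  obtain ⟨H, hH, hdet⟩ := hd.exists_reverses h2
  have hinj : Function.Injective H := fun x y hxy => by rw [← hH.sq x, hxy, hH.sq]
  obtain ⟨t, rfl⟩ := exists_lin_eq hinj
  have hval : ∀ {c : Fˣ}, LinearMap.det (lin t) = (c : F) → t.det = c := fun hc =>
    Units.ext (by rw [← det_lin, hc])
  refine ⟨t, ?_, ?_, ?_, fun hl h4 => hval (hdet hl (by rwa [Module.finrank_fin_fun]))⟩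
  · apply lin_injective
    rw [lin_mul, lin_one]
    exact LinearMap.ext hH.sq
  · apply lin_injective
    rw [lin_mul, lin_mul, lin_mul]
    refine LinearMap.ext fun x => ?_
    rw [lin_scalar_apply]
    exact hH.rev x
  · exact hH.det_eq.imp (fun h => hval (by rw [h, Units.val_one]))
      fun h => hval (by rw [h, Units.val_neg, Units.val_one])

lemma toPGL_mul {F : Type*} [Field F] (g g' : GL (Fin n) F) : toPGL (g * g') = toPGL g * toPGL g' :=
  map_mul _ g g'

lemma toPGL_one {F : Type*} [Field F] : toPGL (1 : GL (Fin n) F) = 1 := map_one _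

lemma toPGL_scal {F : Type*} [Field F] (c : Fˣ) : toPGL (scal n c) = 1 := by
  rw [← mul_one (scal n c), toPGL_scal_mul, toPGL_one]

lemma isStronglyReal_of_exists {F : Type*} [Field F] {x : Matrix.ProjectiveSpecialLinearGroup (Fin n) F}
    {g t : GL (Fin n) F} (hx : Matrix.ProjectiveSpecialLinearGroup.toPGL x = toPGL g)
    {c : Fˣ} (hdet : t.det = c ^ n) (h2 : toPGL (t * t) = 1) (hrev : toPGL (t * g * t * g) = 1) :
    IsStronglyReal x := by
  obtain ⟨y, hy⟩ := toPGL_mem_range_iff.mpr ⟨c, hdet⟩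
  have hy2 : y * y = 1 := by
    apply Matrix.ProjectiveSpecialLinearGroup.toPGL_injective
    rw [map_mul, map_one, hy, ← h2, toPGL_mul]
  refine ⟨y, by rw [sq, hy2], ?_⟩
  rw [inv_eq_of_mul_eq_one_right hy2, eq_inv_iff_mul_eq_one]
  apply Matrix.ProjectiveSpecialLinearGroup.toPGL_injective
  rw [map_mul, map_mul, map_mul, map_one, hy, hx, ← hrev, toPGL_mul, toPGL_mul, toPGL_mul]

/-- The elements of `PSL_n` which are real in `PGL_n` are strongly real. -/
theorem isStronglyReal_of_isReal_toPGL (hn : 0 < n)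
    (hq : Even (Fintype.card F) ∨ twoPart n ≠ twoPart (Fintype.card F - 1))
    {x : Matrix.ProjectiveSpecialLinearGroup (Fin n) F}
    (h : IsReal (Matrix.ProjectiveSpecialLinearGroup.toPGL x)) : IsStronglyReal x := by
  obtain ⟨g, hg⟩ := Matrix.ProjGenLinGroup.mk_surjective
    (Matrix.ProjectiveSpecialLinearGroup.toPGL x)
  rw [← hg] at h
  obtain ⟨l, hl⟩ := isReal_toPGL_iff.mp h
  -- If `-1` is an `n`-th power, every involution of determinant `±1` gives an element of `PSL_n`.
  by_cases hneg : ∃ c : Fˣ, -1 = c ^ n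
  · obtain ⟨t, ht2, htr, hdet, -⟩ := exists_involution hl
    have : ∃ c : Fˣ, t.det = c ^ n := by
      rcases hdet with hdet | hdet
      · exact ⟨1, by rw [hdet, one_pow]⟩
      · rwa [hdet]
    obtain ⟨c, hc⟩ := this
    exact isStronglyReal_of_exists hg.symm hc (by rw [ht2, toPGL_one]) (by rw [htr, toPGL_scal])
  · have hodd : ¬ Even (Fintype.card F) := by
      intro he
      refine hneg ⟨1, ?_⟩
      have hchar : ringChar F = 2 := by
        rw [FiniteField.even_card_iff_char_two, ← Nat.even_iff]; exact he
      rw [one_pow, Units.ext_iff, Units.val_neg, Units.val_one]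
      have := CharP.cast_eq_zero F (ringChar F)
      rw [hchar] at this
      push_cast at this
      linear_combination -this
    have hgt : twoPart (Fintype.card F - 1) < twoPart n :=
      lt_of_le_of_ne (not_lt.mp fun h => hneg (exists_neg_one_eq_pow hodd hn h))
        (hq.resolve_left hodd).symm
    have h4 := four_dvd hodd hn hgt
    by_cases hsq : IsSquare l
    · obtain ⟨ρ, rfl⟩ := hsq
      -- Scaling `g` by the inverse of a square root of `l` reduces to `l = 1`, where `4 ∣ n`
      -- provides an involution of determinant 1.
      have hl' : ∀ i, dual 1 (uInv (scal n ρ⁻¹ * g) i) = uInv (scal n ρ⁻¹ * g) i := by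
        intro i
        have h0 := uInv_coeff_zero g i
        rw [uInv_scalar_mul, dual_scale _ _ h0, dual_eq_scale_dual _ (ρ * ρ) h0, hl]
        congr 1
        rw [one_div, inv_inv, div_eq_iff_eq_mul, inv_mul_cancel_left]
      obtain ⟨t, ht2, htr, -, hdet⟩ := exists_involution hl'
      exact isStronglyReal_of_exists (c := 1) (hg.symm.trans (toPGL_scal_mul _ _).symm)
        (by rw [hdet rfl h4, one_pow]) (by rw [ht2, toPGL_one]) (by rw [htr, toPGL_scal])
    · obtain ⟨t, ht2, htr, -, -⟩ := exists_involution hl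
      -- For a nonsquare `l` the conjugating element is `t g`: it also inverts `g` in `PGL_n`, its
      -- square is scalar, and its determinant `(-l) ^ (n / 2)` is the `n`-th power `l ^ (n / 2)`
      -- since `n / 2` is even.
      have h1 : t * g * (t * g) = scal n l := by rw [← mul_assoc, htr]
      have h2 := det_of_sq_eq_smul (φ := lin (t * g)) hsq fun x => by
        rw [← Module.End.mul_apply, ← lin_mul, h1, lin_scalar_apply]
      obtain ⟨c, hc⟩ := exists_pow_half_eq_pow hodd hn hgt l
      have hdet : (t * g).det = c ^ n := by
        rw [← hc]
        apply Units.ext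
        rw [← det_lin, h2, Module.finrank_fin_fun, Even.neg_pow, Units.val_pow_eq_pow_val]
        rw [even_iff_two_dvd]
        omega
      refine isStronglyReal_of_exists hg.symm hdet (by rw [h1, toPGL_scal]) ?_
      have h3 : toPGL g * toPGL t * toPGL g = toPGL t := by
        have h4 : toPGL t * toPGL t = 1 := by rw [← toPGL_mul, ht2, toPGL_one]
        have h5 : toPGL t * (toPGL g * toPGL t * toPGL g) = 1 := by
          rw [← mul_assoc, ← mul_assoc, ← toPGL_mul, ← toPGL_mul, ← toPGL_mul, htr, toPGL_scal]
        exact mul_left_cancel (h5.trans h4.symm)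
      have h6 : t * g * g * (t * g) * g = t * g * (g * t * g) * g := by simp only [mul_assoc]
      rw [h6, toPGL_mul, toPGL_mul _ (g * t * g), toPGL_mul (g * t), toPGL_mul g t, h3,
        ← toPGL_mul, ← toPGL_mul, htr, toPGL_scal]

end StrongReality

end RealPSL

end

noncomputable section

namespace RealPSL

/-! ### Lower bound for determinants on centralizers, by norms. -/

section CentralizerDeterminants

variable {F : Type*} [Field F]

lemma aeval_pow_card_pow [Fintype F] {A : Type*} [CommRing A] [Algebra F A] (t : A) (f : F[X])
    (s : ℕ) : aeval (t ^ Fintype.card F ^ s) f = aeval t f ^ Fintype.card F ^ s := by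
  induction s with
  | zero => simp
  | succ s ih =>
    rw [pow_succ, pow_mul, ← expand_aeval, FiniteField.expand_card, map_pow, ih, ← pow_mul]

/-- Every `a`-th power is a norm of a unit of `F[X] / (v ^ a)`. -/
lemma exists_norm_eq_pow [Fintype F] {v : F[X]} (hv : Irreducible v) (a : ℕ) (c : F) :
    ∃ y : AdjoinRoot (v ^ a), Algebra.norm F y = c ^ a := by
  have : Fact (Irreducible v) := ⟨hv⟩
  have h1 := finite_adjoinRoot hv.ne_zero
  have h2 := finite_adjoinRoot (pow_ne_zero a hv.ne_zero)
  -- The residue field embeds in `F[X] / (v ^ a)`: raising to the power `q ^ a ≥ a` commutes with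
  -- `v` and kills the nilpotent `v(root)`, so `root ^ (q ^ a)` is a root of `v`.
  let σ : AdjoinRoot v →ₐ[F] AdjoinRoot (v ^ a) :=
    AdjoinRoot.liftAlgHom v (Algebra.ofId F _) (AdjoinRoot.root (v ^ a) ^ Fintype.card F ^ a) (by
      change aeval _ v = 0
      rw [aeval_pow_card_pow, AdjoinRoot.aeval_eq, ← map_pow, AdjoinRoot.mk_eq_zero]
      exact pow_dvd_pow v (Nat.lt_pow_self Fintype.one_lt_card).le)
  let _ : Algebra (AdjoinRoot v) (AdjoinRoot (v ^ a)) := σ.toRingHom.toAlgebra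
  have : IsScalarTower F (AdjoinRoot v) (AdjoinRoot (v ^ a)) :=
    IsScalarTower.of_algebraMap_eq fun x => (σ.commutes x).symm
  have : Module.Finite (AdjoinRoot v) (AdjoinRoot (v ^ a)) := Module.Finite.right F _ _
  have hfin : Module.finrank (AdjoinRoot v) (AdjoinRoot (v ^ a)) = a := by
    have := Module.finrank_mul_finrank F (AdjoinRoot v) (AdjoinRoot (v ^ a))
    rw [finrank_adjoinRoot hv.ne_zero, finrank_adjoinRoot (pow_ne_zero a hv.ne_zero),
      natDegree_pow, mul_comm a] at this
    exact Nat.eq_of_mul_eq_mul_left hv.natDegree_pos this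
  have : Finite (AdjoinRoot v) := Module.finite_of_finite F
  -- The algebra has dimension `a` over the residue field, so the norm of an element of that field
  -- is the `a`-th power of its norm to `F`.
  obtain ⟨z, hz⟩ := FiniteField.norm_surjective F (AdjoinRoot v) c
  refine ⟨algebraMap (AdjoinRoot v) _ z, ?_⟩
  rw [← Algebra.norm_norm (S := AdjoinRoot v), Algebra.norm_algebraMap, hfin, map_pow, hz]

lemma Decomp.exists_commute_det [Fintype F] {V ι : Type*} [AddCommGroup V] [Module F V]
    [Fintype ι] {φ : Module.End F V} {v : ι → F[X]} {a : ι → ℕ} (h : Decomp φ v a) (j : ι)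
    (c : F) : ∃ T : Module.End F V, (∀ x, T (φ x) = φ (T x)) ∧ LinearMap.det T = c ^ a j := by
  classical
  obtain ⟨y, hy⟩ := exists_norm_eq_pow (h.irreducible j) (a j) c
  obtain ⟨e, he⟩ := h.equiv
  have : ∀ j, Module.Finite F (AdjoinRoot (v j ^ a j)) := fun j =>
    finite_adjoinRoot (pow_ne_zero _ (h.irreducible j).ne_zero)
  let Y : ∀ j, AdjoinRoot (v j ^ a j) := Function.update 1 j y
  let T : Module.End F (∀ j, AdjoinRoot (v j ^ a j)) :=
    LinearMap.pi fun k => LinearMap.mulLeft F (Y k) ∘ₗ LinearMap.proj k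
  refine ⟨e.symm.toLinearMap ∘ₗ T ∘ₗ e.toLinearMap, fun x => e.injective ?_, ?_⟩
  · funext k
    simp [T, he, mul_left_comm]
  · have h1 := LinearMap.det_conj T e.symm
    rw [LinearEquiv.symm_symm] at h1
    rw [h1, det_pi_map, Finset.prod_eq_single j, ← hy, Algebra.norm_apply]
    · simp [Y]; rfl
    · intro k _ hk
      simp [Y, Function.update_of_ne hk]
    · simp

end CentralizerDeterminants

/-! ### Upper bound for determinants of maps commuting with `φ` up to a scalar. -/

section DeterminantPowers

variable {F V : Type*} [Field F] [AddCommGroup V] [Module F V]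

lemma det_eq_of_equiv {M M' : Type*} [AddCommGroup M] [Module F M] [AddCommGroup M'] [Module F M']
    {f : Module.End F M} {f' : Module.End F M'} (e : M ≃ₗ[F] M') (h : ∀ x, e (f x) = f' (e x)) :
    LinearMap.det f = LinearMap.det f' := by
  rw [← LinearMap.det_conj f e]
  congr 1
  ext x
  simp [h]

open scoped Classical in
/-- The determinant of `h` on an invariant subspace. -/
def detOn (h : Module.End F V) (p : Submodule F V) : F :=
  if hp : ∀ x ∈ p, h x ∈ p then LinearMap.det (h.restrict hp) else 1

lemma detOn_of_invariant {h : Module.End F V} {p : Submodule F V} (hp : ∀ x ∈ p, h x ∈ p) :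
    detOn h p = LinearMap.det (h.restrict hp) := dif_pos hp

lemma detOn_bot (h : Module.End F V) : detOn h ⊥ = 1 := by
  rw [detOn_of_invariant (by intro x hx; rw [(Submodule.mem_bot F).mp hx, map_zero]; exact zero_mem _)]
  exact LinearMap.det_eq_one_of_subsingleton _

lemma detOn_top (h : Module.End F V) : detOn h ⊤ = LinearMap.det h := by
  rw [detOn_of_invariant fun x _ => Submodule.mem_top]
  exact det_eq_of_equiv Submodule.topEquiv fun x => rfl

/-- `T` identifies the quotient of `p` by `p ⊓ ker T` with `T(p)`, compatibly with `h`. -/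
lemma detOn_eq_mul [FiniteDimensional F V] {h T : Module.End F V} (hT : ∀ x, T (h x) = h (T x))
    {p : Submodule F V} (hp : ∀ x ∈ p, h x ∈ p) :
    detOn h p = detOn h (p.map T) * detOn h (p ⊓ LinearMap.ker T) := by
  have h1 : ∀ x ∈ p.map T, h x ∈ p.map T := by
    rintro _ ⟨x, hx, rfl⟩
    exact ⟨h x, hp x hx, hT x⟩
  have h2 : ∀ x ∈ p ⊓ LinearMap.ker T, h x ∈ p ⊓ LinearMap.ker T := by
    rintro x ⟨hx, hx'⟩
    refine ⟨hp x hx, ?_⟩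
    exact (hT x).trans ((congrArg h hx').trans (map_zero h))
  rw [detOn_of_invariant hp, detOn_of_invariant h1, detOn_of_invariant h2]
  let T' := T.domRestrict p
  have h3 : LinearMap.ker T' ≤ (LinearMap.ker T').comap (h.restrict hp) := by
    intro x hx
    rw [LinearMap.mem_ker] at hx
    change T (h x) = 0
    rw [hT]
    exact (congrArg h hx).trans (map_zero _)
  rw [LinearMap.det_eq_det_mul_det (LinearMap.ker T') (h.restrict hp) h3, mul_comm]
  congr 1
  · have hr : LinearMap.range T' = p.map T := LinearMap.range_domRestrict p T
    refine det_eq_of_equiv (T'.quotKerEquivRange.trans (LinearEquiv.ofEq _ _ hr)) fun x => ?_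
    obtain ⟨x, rfl⟩ := Submodule.Quotient.mk_surjective _ x
    refine Subtype.ext ?_
    change T (h x) = h (T x)
    exact hT x
  · let e : LinearMap.ker T' ≃ₗ[F] (p ⊓ LinearMap.ker T : Submodule F V) :=
      { toFun := fun x => ⟨x.1.1, x.1.2, x.2⟩
        invFun := fun x => ⟨⟨x.1, x.2.1⟩, x.2.2⟩
        left_inv := fun x => rfl
        right_inv := fun x => rfl
        map_add' := fun x y => rfl
        map_smul' := fun c x => rfl }
    exact det_eq_of_equiv e fun x => rfl

/-- The intersection of the kernel of `N` and the image of `N ^ k`. -/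
def kerRange (N : Module.End F V) (k : ℕ) : Submodule F V :=
  (LinearMap.ker (N ^ (k + 1))).map (N ^ k)

/-- In the filtration by the kernels of powers of `N`, the map `N ^ i` identifies the `i`-th
quotient with `kerRange N i`. -/
lemma detOn_ker_pow [FiniteDimensional F V] {h N : Module.End F V} (hN : Commute N h) (k : ℕ) :
    detOn h (LinearMap.ker (N ^ k)) = ∏ i ∈ Finset.range k, detOn h (kerRange N i) := by
  have hc : ∀ k x, (N ^ k) (h x) = h ((N ^ k) x) := fun k x =>
    congrArg (fun f : Module.End F V => f x) (hN.pow_left k)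
  induction k with
  | zero =>
    have : LinearMap.ker (N ^ 0) = ⊥ := by
      rw [pow_zero, Module.End.one_eq_id, LinearMap.ker_id]
    rw [this, detOn_bot, Finset.prod_range_zero]
  | succ k ih =>
    have hle : LinearMap.ker (N ^ k) ≤ LinearMap.ker (N ^ (k + 1)) := by
      intro x hx
      rw [LinearMap.mem_ker] at hx ⊢
      rw [pow_succ', Module.End.mul_apply, hx, map_zero]
    rw [detOn_eq_mul (hc k) (p := LinearMap.ker (N ^ (k + 1))), inf_eq_right.mpr hle, ih,
      Finset.prod_range_succ, mul_comm]
    · rfl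
    · intro x hx
      rw [LinearMap.mem_ker] at hx ⊢
      rw [hc, hx, map_zero]

/-- The spaces `kerRange N k` are constant on consecutive blocks of `m` indices, so the determinants
on them multiply to an `m`-th power. -/
lemma exists_det_eq_pow [FiniteDimensional F V] {h N : Module.End F V} (hN : Commute N h)
    {m M : ℕ} (hM : N ^ (m * M) = 0)
    (hE : ∀ k, ¬ m ∣ k + 1 → kerRange N k = kerRange N (k + 1)) :
    ∃ c, LinearMap.det h = c ^ m := by
  have h1 := detOn_ker_pow hN (m * M)
  rw [hM, LinearMap.ker_zero, detOn_top] at h1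
  have h2 : ∀ i, ∀ j < m, kerRange N (m * i + j) = kerRange N (m * i) := by
    intro i j
    induction j with
    | zero => exact fun _ => rfl
    | succ j ih =>
      intro hj
      rw [← ih (by omega), eq_comm]
      refine hE _ fun hd => ?_
      rw [add_assoc, Nat.dvd_add_right (dvd_mul_right m i)] at hd
      exact absurd (Nat.le_of_dvd (by omega) hd) (by omega)
  have h3 : ∀ M, ∏ i ∈ Finset.range (m * M), detOn h (kerRange N i) =
      (∏ i ∈ Finset.range M, detOn h (kerRange N (m * i))) ^ m := by
    intro M
    induction M with
    | zero => simp
    | succ M ih =>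
      rw [mul_add, mul_one, Finset.prod_range_add, ih, Finset.prod_range_succ, mul_pow]
      congr 1
      rw [Finset.prod_congr rfl fun j hj => by rw [h2 M j (Finset.mem_range.mp hj)],
        Finset.prod_const, Finset.card_range]
  exact ⟨_, h1.trans (h3 M)⟩

lemma aeval_pow_apply_of_intertwining {ι : Type*} {φ : Module.End F V} {w : ι → F[X]}
    (e : V →ₗ[F] (∀ j, AdjoinRoot (w j))) (he : ∀ x j, e (φ x) j = AdjoinRoot.root (w j) * e x j)
    (p : F[X]) (k : ℕ) (x : V) (j : ι) :
    e ((aeval φ p ^ k) x) j = AdjoinRoot.mk (w j) p ^ k * e x j := by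
  rw [← map_pow, apply_aeval_of_intertwining e he, map_pow]

/-- The images `kerRange N k` only change at the exponents of the elementary divisors. -/
lemma Decomp.kerRange_eq {ι : Type*} {φ : Module.End F V} {v : ι → F[X]} {a : ι → ℕ}
    (h : Decomp φ v a) {P : F[X]} (hP : ∀ j, ∃ w, P = v j * w ∧ ¬ v j ∣ w) {k : ℕ}
    (ha : ∀ j, a j ≠ k + 1) : kerRange (aeval φ P) k = kerRange (aeval φ P) (k + 1) := by
  obtain ⟨e, he⟩ := h.equiv
  have hap := aeval_pow_apply_of_intertwining e.toLinearMap he P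
  simp only [LinearEquiv.coe_coe] at hap
  refine le_antisymm ?_ ?_
  · rintro _ ⟨y, hy, rfl⟩
    -- If `a j ≤ k`, then `P ^ k` is zero in this summand. Otherwise `a j ≥ k + 2`, so `v j` divides
    -- the component of `y`, and one more factor `P` splits off because `P / v j` is a unit modulo
    -- `v j ^ a j`.
    have hz : ∀ j, ∃ z, AdjoinRoot.mk (v j ^ a j) P ^ (k + 1) * z =
        AdjoinRoot.mk (v j ^ a j) P ^ k * e y j := by
      intro j
      obtain ⟨w, hw, hdvd⟩ := hP j
      have hvj := h.irreducible j
      obtain ⟨Y, hY⟩ := AdjoinRoot.mk_surjective (e y j)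
      have h1 := hap (k + 1) y j
      rw [LinearMap.mem_ker.mp hy, map_zero, Pi.zero_apply] at h1
      rw [← hY] at h1 ⊢
      rw [← map_pow, ← map_mul, eq_comm, AdjoinRoot.mk_eq_zero] at h1
      rcases Nat.lt_or_ge k (a j) with hk | hk
      · obtain ⟨b, hb⟩ := Nat.exists_eq_add_of_le (show k + 1 + 1 ≤ a j by
          have := ha j
          omega)
        rw [hb, add_assoc, pow_add, hw, mul_pow, mul_assoc,
          mul_dvd_mul_iff_left (pow_ne_zero _ hvj.ne_zero)] at h1
        have h2 : v j ∣ w ^ (k + 1) * Y := (dvd_pow_self _ (by omega)).trans h1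
        have h3 : v j ∣ Y := (hvj.prime.dvd_or_dvd h2).resolve_left
          fun h' => hdvd (hvj.prime.dvd_of_dvd_pow h')
        obtain ⟨s, rfl⟩ := h3
        have hc : IsCoprime w (v j ^ a j) := ((hvj.coprime_iff_not_dvd.mpr hdvd).symm).pow_right
        obtain ⟨x, t, hxt⟩ := hc
        refine ⟨AdjoinRoot.mk _ (x * s), ?_⟩
        rw [← map_pow, ← map_pow, ← map_mul, ← map_mul, AdjoinRoot.mk_eq_mk, hw]
        refine ⟨-(v j * w) ^ k * v j * s * t, ?_⟩
        linear_combination (v j * w) ^ k * v j * s * hxt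
      · refine ⟨0, ?_⟩
        have h2 : AdjoinRoot.mk (v j ^ a j) P ^ k = 0 := by
          rw [← map_pow, AdjoinRoot.mk_eq_zero, hw, mul_pow]
          exact (pow_dvd_pow _ hk).trans (dvd_mul_right _ _)
        rw [mul_zero, h2, zero_mul]
    choose z hz using hz
    have hz' : (aeval φ P ^ (k + 1)) (e.symm z) = (aeval φ P ^ k) y := by
      apply e.injective
      funext j
      rw [hap, hap, LinearEquiv.apply_symm_apply, hz]
    refine ⟨e.symm z, ?_, hz'⟩
    change (aeval φ P ^ (k + 1 + 1)) (e.symm z) = 0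
    rw [pow_succ', Module.End.mul_apply, hz', ← Module.End.mul_apply, ← pow_succ']
    exact hy
  · rintro _ ⟨y, hy, rfl⟩
    refine ⟨aeval φ P y, ?_, ?_⟩
    · change (aeval φ P ^ (k + 1)) (aeval φ P y) = 0
      rw [← Module.End.mul_apply, ← pow_succ]
      exact hy
    · rw [← Module.End.mul_apply, ← pow_succ]

lemma irreducible_dvd_X_pow_sub_one [Fintype F] {v : F[X]} (hv : Irreducible v)
    (h0 : v.coeff 0 = 1) : v ∣ X ^ (Fintype.card F ^ v.natDegree - 1) - 1 := by
  have : Fact (Irreducible v) := ⟨hv⟩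
  have h1 := finite_adjoinRoot hv.ne_zero
  have : Finite (AdjoinRoot v) := Module.finite_of_finite F
  let _ : Fintype (AdjoinRoot v) := Fintype.ofFinite _
  have hcard : Fintype.card (AdjoinRoot v) = Fintype.card F ^ v.natDegree := by
    rw [Module.card_eq_pow_finrank (K := F), finrank_adjoinRoot hv.ne_zero]
  have hroot : AdjoinRoot.root v ≠ 0 := by
    intro h
    have := root_mul_rootInv h0
    rw [h, zero_mul] at this
    exact zero_ne_one this
  rw [← AdjoinRoot.mk_eq_zero, map_sub, map_pow, AdjoinRoot.mk_X, map_one, ← hcard,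
    FiniteField.pow_card_sub_one_eq_one _ hroot, sub_self]

/-- If `T` commutes with `φ` up to scalars and all exponents are multiples of `m`, then the
determinant of `T` is an `m`-th power. -/
theorem Decomp.exists_det_eq_pow [Fintype F] [FiniteDimensional F V] {ι : Type*} [Fintype ι]
    {φ T : Module.End F V} {v : ι → F[X]} {a : ι → ℕ} (h : Decomp φ v a) {μ : Fˣ}
    (hT : ∀ x, T (φ x) = (μ : F) • φ (T x)) {m : ℕ} (hm : ∀ j, m ∣ a j) :
    ∃ c, LinearMap.det T = c ^ m := by
  set q := Fintype.card F with hq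
  -- The factor `q - 1` gives `μ ^ Q = 1`, so `φ ^ Q - 1` commutes with `T`. The other factors make
  -- every `v j` divide `X ^ Q - 1`, exactly once because `Q` is non-zero in `F` and hence `X ^ Q -
  -- 1` is squarefree.
  let Q := (q - 1) * ∏ j, (q ^ (v j).natDegree - 1)
  have hq1 : 1 ≤ q := Fintype.card_pos
  have hQ : (Q : F) ≠ 0 := by
    have hcast : (q : F) = 0 := FiniteField.cast_card_eq_zero F
    simp only [Q]
    push_cast
    rw [Nat.cast_sub hq1, hcast, Finset.prod_congr rfl fun j _ => by
      rw [Nat.cast_sub (Nat.one_le_pow _ _ hq1), Nat.cast_pow, hcast,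
        zero_pow (h.irreducible j).natDegree_pos.ne']]
    simp
  let P : F[X] := X ^ Q - 1
  have hsf : Squarefree P := (X_pow_sub_one_separable_iff.mpr hQ).squarefree
  have hP : ∀ j, ∃ w, P = v j * w ∧ ¬ v j ∣ w := by
    intro j
    have h1 : v j ∣ P := by
      refine (irreducible_dvd_X_pow_sub_one (h.irreducible j) (h.coeff_zero j)).trans ?_
      obtain ⟨b, hb⟩ : q ^ (v j).natDegree - 1 ∣ Q :=
        (Finset.dvd_prod_of_mem (fun j => q ^ (v j).natDegree - 1) (Finset.mem_univ j)).trans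
          (dvd_mul_left _ _)
      simp only [P]
      rw [hb, pow_mul]
      exact by simpa using sub_dvd_pow_sub_pow (X ^ (q ^ (v j).natDegree - 1) : F[X]) 1 b
    obtain ⟨w, hw⟩ := h1
    refine ⟨w, hw, fun ⟨s, hs⟩ => (h.irreducible j).not_isUnit (hsf _ ⟨s, ?_⟩)⟩
    rw [hw, hs, mul_assoc]
  have hpow : ∀ k x, T ((φ ^ k) x) = (μ : F) ^ k • (φ ^ k) (T x) := by
    intro k
    induction k with
    | zero => simp
    | succ k ih =>
      intro x
      rw [pow_succ, Module.End.mul_apply, ih, hT, map_smul, smul_smul, pow_succ,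
        Module.End.mul_apply]
  have hμ : (μ : F) ^ Q = 1 := by
    simp only [Q]
    rw [pow_mul, FiniteField.pow_card_sub_one_eq_one _ μ.ne_zero, one_pow]
  have hcomm : Commute (aeval φ P) T := by
    have h1 : aeval φ P = φ ^ Q - 1 := by simp [P]
    rw [h1]
    refine Commute.sub_left (LinearMap.ext fun x => ?_) (Commute.one_left T)
    rw [Module.End.mul_apply, Module.End.mul_apply, hpow, hμ, one_smul]
  refine RealPSL.exists_det_eq_pow (m := m) (M := ∑ j, a j) hcomm ?_ fun k hk =>
    h.kerRange_eq hP fun j hj => hk (hj ▸ hm j)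
  obtain ⟨e, he⟩ := h.equiv
  refine LinearMap.ext fun x => e.injective (funext fun j => ?_)
  have h1 := aeval_pow_apply_of_intertwining e.toLinearMap he P (m * ∑ j, a j) x j
  rw [LinearEquiv.coe_coe] at h1
  rw [h1, LinearMap.zero_apply, map_zero, Pi.zero_apply]
  have hle : a j ≤ m * ∑ j, a j := by
    have h2 : a j ≤ ∑ j, a j := Finset.single_le_sum (fun _ _ => Nat.zero_le _) (Finset.mem_univ j)
    have h3 : 0 < m := Nat.pos_of_dvd_of_pos (hm j) (h.pos j)
    exact h2.trans (Nat.le_mul_of_pos_left _ h3)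
  obtain ⟨w, hw, -⟩ := hP j
  have h2 : AdjoinRoot.mk (v j ^ a j) P ^ (m * ∑ j, a j) = 0 := by
    rw [← map_pow, AdjoinRoot.mk_eq_zero, hw, mul_pow]
    exact (pow_dvd_pow _ hle).trans (dvd_mul_right _ _)
  rw [h2, zero_mul]

end DeterminantPowers

end RealPSL

end

noncomputable section

namespace RealPSL

/-! ### Splitting of `PGL_n` classes in `PSL_n`. -/

section Splitting

lemma pow_gcd_mem {G : Type*} [Group G] {S : Subgroup G} {d : G} {s : Multiset ℕ}
    (h : ∀ i ∈ s, d ^ i ∈ S) : d ^ s.gcd ∈ S := by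
  induction s using Multiset.induction with
  | empty => simp [S.one_mem]
  | cons a s ih =>
    have h1 := h a (Multiset.mem_cons_self a s)
    have h2 := ih fun i hi => h i (Multiset.mem_cons_of_mem hi)
    rw [Multiset.gcd_cons, gcd_eq_nat_gcd, ← zpow_natCast, Nat.gcd_eq_gcd_ab, zpow_add, zpow_mul,
      zpow_mul, zpow_natCast, zpow_natCast]
    exact S.mul_mem (S.zpow_mem h1 _) (S.zpow_mem h2 _)

variable {F : Type*} [Field F] {n : ℕ}

lemma toPGL_conj (t a : GL (Fin n) F) :
    toPGL (t * a * t⁻¹) = toPGL t * toPGL a * (toPGL t)⁻¹ := by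
  rw [toPGL_mul, toPGL_mul]
  congr 1

lemma isReal_toPGL {x : Matrix.ProjectiveSpecialLinearGroup (Fin n) F} (h : IsReal x) :
    IsReal (Matrix.ProjectiveSpecialLinearGroup.toPGL x) := by
  obtain ⟨k, hk⟩ := h
  exact ⟨Matrix.ProjectiveSpecialLinearGroup.toPGL k, by
    rw [← map_inv, ← map_inv, ← map_mul, ← map_mul, hk]⟩

lemma IsStronglyReal.isReal {G : Type*} [Group G] {x : G} (h : IsStronglyReal x) : IsReal x :=
  let ⟨k, _, hk⟩ := h
  ⟨k, hk⟩

lemma isRealClass_mk_iff {G : Type*} [Group G] (x : G) :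
    IsRealClass (ConjClasses.mk x) ↔ IsReal x :=
  forall_mem_carrier_iff (fun _ k h => IsReal.conj h k) x

variable [Fintype F]

/-- The determinants of the elements commuting with `g` up to scalars. -/
lemma mem_range_pow_iff {g : GL (Fin n) F} {ν : n.Partition}
    (hg : ∀ i, (uInv g i).natDegree = mult ν i) (c : Fˣ) :
    c ∈ (powMonoidHom ν.parts.gcd : Fˣ →* Fˣ).range ↔
      ∃ (k : GL (Fin n) F) (μ : Fˣ), k * g = scal n μ * (g * k) ∧ k.det = c := by
  obtain ⟨r, v, a, hd⟩ := exists_decomp_lin g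
  have hu := uInv_eq hd
  rw [hu] at hg
  have hmem : ∀ j, a j ∈ ν.parts := fun j =>
    Multiset.mem_toFinset.mp (hd.mem_of_natDegree (s := ν.parts.toFinset)
      (fun i hi => by rw [hg, mult_eq_zero hi]) j)
  constructor
  · rintro ⟨d, rfl⟩
    have key : powMonoidHom ν.parts.gcd d ∈
        (Subgroup.centralizer {g}).map (Matrix.GeneralLinearGroup.det (n := Fin n) (R := F)) := by
      -- By Bézout it suffices to realise `d ^ i` for each part `i`, and matrices commuting exactly
      -- with `g` are enough.
      refine pow_gcd_mem fun i hi => ?_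
      have hpos : 0 < (partProd v a i).natDegree := by
        rw [hg]; exact mult_pos (Multiset.mem_toFinset.mpr hi)
      obtain ⟨j, rfl⟩ : ∃ j, a j = i := by
        by_contra hne
        push Not at hne
        rw [natDegree_partProd hd.coeff_zero, Finset.sum_eq_zero] at hpos
        · exact lt_irrefl _ hpos
        · intro j hj
          exact absurd (Finset.mem_filter.mp hj).2 (hne j)
      obtain ⟨T, hT, hdet⟩ := hd.exists_commute_det j (d : F)
      have hinj : Function.Injective T := by
        have hunit : IsUnit (LinearMap.det T) := by
          rw [hdet]; exact (d.isUnit).pow _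
        exact ((Module.End.isUnit_iff T).mp ((LinearMap.isUnit_iff_isUnit_det T).mpr hunit)).1
      obtain ⟨k, rfl⟩ := exists_lin_eq hinj
      refine ⟨k, ?_, Units.ext ?_⟩
      · refine Subgroup.mem_centralizer_singleton_iff.mpr (lin_injective ?_)
        rw [lin_mul, lin_mul]
        exact LinearMap.ext hT
      · rw [← det_lin, hdet, Units.val_pow_eq_pow_val]
    obtain ⟨k, hk, hdet⟩ := key
    refine ⟨k, 1, ?_, hdet⟩
    have := Subgroup.mem_centralizer_singleton_iff.mp hk
    rw [show scal n (1 : Fˣ) = 1 from map_one _, one_mul, this]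
  · rintro ⟨k, μ, hk, rfl⟩
    obtain ⟨d, hdet⟩ := hd.exists_det_eq_pow (T := lin k) (μ := μ) (m := ν.parts.gcd) (fun x => by
      rw [← Module.End.mul_apply, ← lin_mul, hk, lin_mul, lin_mul, Module.End.mul_apply,
        lin_scalar_apply, Module.End.mul_apply]) fun j => Multiset.gcd_dvd (hmem j)
    rw [det_lin] at hdet
    -- A zero base is possible only for exponent 0, where the determinant is 1.
    by_cases hd0 : d = 0
    · subst hd0
      have hm : ν.parts.gcd = 0 := by
        by_contra hm
        rw [zero_pow hm] at hdet
        exact k.det.ne_zero hdet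
      refine ⟨1, Units.ext ?_⟩
      rw [hdet, hm]
      simp
    · exact ⟨Units.mk0 d hd0, Units.ext (by rw [hdet]; simp)⟩

/-- The conjugacy classes of `PSL_n` in a conjugacy class of `PGL_n` of type `ν`. -/
theorem nonempty_fiber_equiv (hn : 0 < n) {x : Matrix.ProjectiveSpecialLinearGroup (Fin n) F}
    {g : GL (Fin n) F} (hx : Matrix.ProjectiveSpecialLinearGroup.toPGL x = toPGL g)
    {ν : n.Partition} (hg : ∀ i, (uInv g i).natDegree = mult ν i) :
    Nonempty (Fˣ ⧸ (powMonoidHom ν.parts.gcd : Fˣ →* Fˣ).range ≃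
      {c : ConjClasses (Matrix.ProjectiveSpecialLinearGroup (Fin n) F) //
        ConjClasses.map Matrix.ProjectiveSpecialLinearGroup.toPGL c =
          ConjClasses.mk (toPGL g)}) := by
  have : Nonempty (Fin n) := ⟨⟨0, hn⟩⟩
  set R := (powMonoidHom ν.parts.gcd : Fˣ →* Fˣ).range with hR
  obtain ⟨c₀, hc₀⟩ := toPGL_mem_range_iff.mp ⟨x, hx⟩
  choose K hK using Matrix.GeneralLinearGroup.det_surjective (n := Fin n) (R := F)
  have hY : ∀ c, ∃ y, Matrix.ProjectiveSpecialLinearGroup.toPGL y =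
      toPGL (K c * g * (K c)⁻¹) := fun c => toPGL_mem_range_iff.mpr ⟨c₀, by
    rw [map_mul, map_mul, map_inv, mul_right_comm, mul_inv_cancel, one_mul, hc₀]⟩
  choose Y hY using hY
  -- Lifting an element of `PSL_n` to `GL_n` determines its determinant only up to `n`-th powers.
  -- These are harmless, since the gcd of the parts divides `n`.
  have hnR : ∀ e : Fˣ, e ^ n ∈ R := by
    intro e
    have h1 : ν.parts.gcd ∣ n := by
      have := Multiset.dvd_sum fun i (hi : i ∈ ν.parts) => Multiset.gcd_dvd hi
      rwa [ν.parts_sum] at this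
    obtain ⟨b, hb⟩ := h1
    exact ⟨e ^ b, by rw [powMonoidHom_apply, ← pow_mul, mul_comm b, ← hb]⟩
  have hconj : ∀ {y z : Matrix.ProjectiveSpecialLinearGroup (Fin n) F} {t a b : GL (Fin n) F},
      Matrix.ProjectiveSpecialLinearGroup.toPGL y = toPGL a →
      Matrix.ProjectiveSpecialLinearGroup.toPGL z = toPGL b → t.det = 1 →
      toPGL (t * a * t⁻¹) = toPGL b → ConjClasses.mk y = ConjClasses.mk z := by
    intro y z t a b hy hz ht hab
    obtain ⟨s, hs⟩ := toPGL_mem_range_iff.mpr ⟨1, ht.trans (one_pow n).symm⟩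
    rw [ConjClasses.mk_eq_mk_iff_isConj, isConj_iff]
    refine ⟨s, Matrix.ProjectiveSpecialLinearGroup.toPGL_injective ?_⟩
    rw [map_mul, map_mul, map_inv, hs, hy, hz, ← hab, toPGL_conj]
  -- `Y c` is the conjugate of `g` by a matrix of determinant `c`. A conjugation in `PSL_n` from `Y
  -- c` to `Y c'` yields a matrix commuting with `g` up to a scalar, of determinant `c / c'` up to
  -- an `n`-th power; conversely such a matrix corrects the determinant to 1.
  have hiff : ∀ c c', ConjClasses.mk (Y c) = ConjClasses.mk (Y c') ↔ c⁻¹ * c' ∈ R := by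
    intro c c'
    constructor
    · intro h
      rw [ConjClasses.mk_eq_mk_iff_isConj, isConj_iff] at h
      obtain ⟨s, hs⟩ := h
      obtain ⟨t, ht⟩ := Matrix.ProjGenLinGroup.mk_surjective
        (Matrix.ProjectiveSpecialLinearGroup.toPGL s)
      obtain ⟨e, he⟩ := toPGL_mem_range_iff.mp ⟨s, ht.symm⟩
      have h1 := congrArg Matrix.ProjectiveSpecialLinearGroup.toPGL hs
      rw [map_mul, map_mul, map_inv, hY, hY, ← ht, ← map_inv, ← map_mul, ← map_mul] at h1
      obtain ⟨μ, hμ⟩ := toPGL_eq_iff.mp h1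
      have h2 : (K c')⁻¹ * t * K c * g = scal n μ⁻¹ * (g * ((K c')⁻¹ * t * K c)) := by
        have h3 : g * ((K c')⁻¹ * t * K c) =
            (K c')⁻¹ * (K c' * g * (K c')⁻¹) * (t * K c) := by group
        have h4 := Matrix.GeneralLinearGroup.scalar_commute μ (K c')⁻¹
        rw [h3, ← hμ, ← mul_assoc (K c')⁻¹ (scal n μ), ← h4, mul_assoc (scal n μ),
          mul_assoc (scal n μ), ← mul_assoc (scal n μ⁻¹), ← map_mul, inv_mul_cancel, map_one]
        group
      have h3 := (mem_range_pow_iff hg _).mpr ⟨_, _, h2, rfl⟩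
      rw [map_mul, map_mul, map_inv, hK, hK, he] at h3
      have h4 := R.mul_mem (R.inv_mem h3) (hnR e)
      have h5 : (c'⁻¹ * e ^ n * c)⁻¹ * e ^ n = c⁻¹ * c' := by
        rw [mul_inv, mul_inv, inv_inv, mul_comm c', mul_comm (_ * c'), mul_assoc, mul_right_comm,
          inv_mul_cancel, one_mul, mul_comm]
      rwa [h5] at h4
    · intro h
      obtain ⟨k, μ, hk, hdet⟩ := (mem_range_pow_iff hg _).mp (R.inv_mem h)
      refine hconj (t := K c' * k * (K c)⁻¹) (hY c) (hY c') ?_ ?_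
      · rw [map_mul, map_mul, map_inv, hK, hK, hdet, mul_inv, inv_inv, mul_comm c,
          mul_inv_cancel_left, mul_inv_cancel]
      · have h1 : K c' * k * (K c)⁻¹ * (K c * g * (K c)⁻¹) * (K c' * k * (K c)⁻¹)⁻¹ =
            K c' * (k * g) * (K c' * k)⁻¹ := by group
        have h2 := Matrix.GeneralLinearGroup.scalar_commute μ (K c')
        rw [h1, hk, ← mul_assoc (K c'), ← h2, mul_assoc (scal n μ), mul_assoc (scal n μ),
          toPGL_scal_mul]
        congr 1
        group
  let f : Fˣ ⧸ R → {c : ConjClasses (Matrix.ProjectiveSpecialLinearGroup (Fin n) F) //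
      ConjClasses.map Matrix.ProjectiveSpecialLinearGroup.toPGL c = ConjClasses.mk (toPGL g)} :=
    Quotient.lift (fun c => ⟨ConjClasses.mk (Y c), by
      change ConjClasses.mk (Matrix.ProjectiveSpecialLinearGroup.toPGL (Y c)) = _
      rw [hY, ConjClasses.mk_eq_mk_iff_isConj, isConj_comm, isConj_iff]
      exact ⟨toPGL (K c), (toPGL_conj _ _).symm⟩⟩)
      fun c c' h => Subtype.ext ((hiff c c').mpr (QuotientGroup.leftRel_apply.mp h))
  refine ⟨Equiv.ofBijective f ⟨?_, ?_⟩⟩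
  · intro c c' h
    induction c using Quotient.inductionOn with | _ c =>
    induction c' using Quotient.inductionOn with | _ c' =>
    exact Quotient.sound (QuotientGroup.leftRel_apply.mpr
      ((hiff c c').mp (congrArg Subtype.val h)))
  · rintro ⟨c, hc⟩
    obtain ⟨y, rfl⟩ := ConjClasses.mk_surjective c
    change ConjClasses.mk (Matrix.ProjectiveSpecialLinearGroup.toPGL y) = _ at hc
    rw [ConjClasses.mk_eq_mk_iff_isConj, isConj_comm, isConj_iff] at hc
    obtain ⟨k, hk⟩ := hc
    obtain ⟨k, rfl⟩ := Matrix.ProjGenLinGroup.mk_surjective k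
    rw [← map_inv, ← map_mul, ← map_mul] at hk
    refine ⟨Quotient.mk _ k.det, Subtype.ext ?_⟩
    change ConjClasses.mk (Y k.det) = ConjClasses.mk y
    refine hconj (t := k * (K k.det)⁻¹) (hY _) hk.symm ?_ ?_
    · rw [map_mul, map_inv, hK, mul_inv_cancel]
    · congr 1
      group

/-- The number of real classes of `PSL_n` of type `ν`. -/
theorem numRealPSL_eq (hn : 0 < n)
    (hq : Even (Fintype.card F) ∨ twoPart n ≠ twoPart (Fintype.card F - 1)) (ν : n.Partition) :
    numRealPSL F ν = hNu F ν * numRealPGLInPSL F ν := by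
  let P : ConjClasses (Matrix.ProjGenLinGroup (Fin n) F) → Prop := fun d =>
    IsRealClass d ∧ (∀ x ∈ d.carrier, PGLHasType x ν) ∧
      d.carrier ⊆ Set.range
        (Matrix.ProjectiveSpecialLinearGroup.toPGL :
          Matrix.ProjectiveSpecialLinearGroup (Fin n) F → Matrix.ProjGenLinGroup (Fin n) F)
  have hiff : ∀ c : ConjClasses (Matrix.ProjectiveSpecialLinearGroup (Fin n) F),
      (IsRealClass c ∧ ∀ x ∈ c.carrier, PSLHasType x ν) ↔
      P (ConjClasses.map Matrix.ProjectiveSpecialLinearGroup.toPGL c) := by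
    intro c
    obtain ⟨x, rfl⟩ := ConjClasses.mk_surjective c
    obtain ⟨g, hg⟩ := Matrix.ProjGenLinGroup.mk_surjective
      (Matrix.ProjectiveSpecialLinearGroup.toPGL x)
    have hmap : ConjClasses.map Matrix.ProjectiveSpecialLinearGroup.toPGL (ConjClasses.mk x) =
        ConjClasses.mk (toPGL g) := by rw [toPGL, hg]; rfl
    obtain ⟨d, hd⟩ := toPGL_mem_range_iff.mp ⟨x, hg.symm⟩
    simp only [P]
    rw [hmap, class_conditions_iff, isRealClass_mk_iff, forall_mem_carrier_iff
      (P := fun x => PSLHasType x ν), ← isReal_toPGL_iff, ← pglHasType_iff, PSLHasType, toPGL, hg]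
    -- Strong reality is what brings reality from `PGL_n` back to `PSL_n`; hence either all or none
    -- of the classes over a given class of `PGL_n` are real.
    · refine and_congr ⟨isReal_toPGL, fun h => (isStronglyReal_of_isReal_toPGL hn hq h).isReal⟩
        ⟨fun h => ⟨h, d, hd⟩, fun h => h.1⟩
    · intro x k h
      rw [PSLHasType, map_mul, map_mul, map_inv]
      exact PGLHasType.conj h _
  have hfib : ∀ d : {d // P d},
      Nonempty ({c : ConjClasses (Matrix.ProjectiveSpecialLinearGroup (Fin n) F) //
        ConjClasses.map Matrix.ProjectiveSpecialLinearGroup.toPGL c = d.1} ≃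
        Fˣ ⧸ (powMonoidHom ν.parts.gcd : Fˣ →* Fˣ).range) := by
    rintro ⟨d, hd⟩
    obtain ⟨x, rfl⟩ := ConjClasses.mk_surjective d
    obtain ⟨g, rfl⟩ := Matrix.ProjGenLinGroup.mk_surjective x
    obtain ⟨x, hx⟩ := hd.2.2 ConjClasses.mem_carrier_mk
    obtain ⟨e⟩ := nonempty_fiber_equiv hn hx ((class_conditions_iff g ν).mp hd).2.1
    exact ⟨e.symm⟩
  rw [numRealPSL, ← Nat.card_congr (Equiv.sigmaSubtypeFiberEquivSubtype
      (ConjClasses.map Matrix.ProjectiveSpecialLinearGroup.toPGL) hiff),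
    Nat.card_congr ((Equiv.sigmaCongrRight fun d => (hfib d).some).trans (Equiv.sigmaEquivProd _ _)),
    Nat.card_prod, mul_comm, numRealPGLInPSL]
  congr 1
  -- In the cyclic group of order `q - 1`, the `m`-th powers have index `gcd(q - 1, m)`.
  rw [← Subgroup.index, IsCyclic.index_powMonoidHom_range, Nat.card_units,
    Nat.card_eq_fintype_card, hNu]

end Splitting

end RealPSL

end

theorem theoremt {F : Type*} [Field F] [Fintype F] {n : ℕ} (hn : 0 < n)
    (hq : Even (Fintype.card F) ∨
      RealPSL.twoPart n ≠ RealPSL.twoPart (Fintype.card F - 1)) :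
    (∀ ν : n.Partition,
      (RealPSL.numRealPGLInPSL F ν : ℚ) = RealPSL.pslNu F ν ∧
      (RealPSL.numRealPSL F ν : ℚ) = (RealPSL.hNu F ν : ℚ) * RealPSL.pslNu F ν) ∧
    ∀ c : ConjClasses (Matrix.ProjectiveSpecialLinearGroup (Fin n) F),
      RealPSL.IsRealClass c → RealPSL.IsStronglyRealClass c := by
  refine ⟨fun ν => ⟨RealPSL.numRealPGLInPSL_eq hn hq ν, ?_⟩, fun c hc x hx => ?_⟩
  · rw [RealPSL.numRealPSL_eq hn hq, Nat.cast_mul, RealPSL.numRealPGLInPSL_eq hn hq]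
  · exact RealPSL.isStronglyReal_of_isReal_toPGL hn hq (RealPSL.isReal_toPGL (hc x hx))
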